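/- Let $N\ge 1$, let $\Omega\subseteq\mathbb R^N$ be a bounded domain with $C^2$-boundary, let $\sigma$ be the $(N-1)$-dimensional Hausdorff surface measure on $\partial\Omega$, and let $1<p_1,p_2<\infty$. Put $\mathcal V_i=W^{1,p_i}(\Omega)$ with norm $\|u\|_{1,p_i}=(\|\nabla u\|_{p_i}^{p_i}+\|u\|_{p_i}^{p_i})^{1/p_i}$ and $\mathcal W=\mathcal V_1\times\mathcal V_2$; on $\partial\Omega$, elements of $\mathcal V_i$ are understood in the sense of traces. Let $\lambda_{1,p}$ be the smallest $\lambda$ for which $-\Delta_p u=-|u|^{p-2}u$ in $\Omega$, $|\nabla u|^{p-2}\nabla u\cdot\nu=\lambda|u|^{p-2}u$ on $\partial\Omega$ has a nonzero weak solution. Let $g\colon\partial\Omega\times\mathbb R\times\mathbb R\to\mathbb R$ be a Carathéodory function that is twice differentiable in $(s_1,s_2)$, with $g(x,0,0)=0$ for a.a. $x\in\partial\Omega$, such that $g_{s_1},g_{s_2},g_{s_1s_1},g_{s_1s_2},g_{s_2s_2}$ are Carathéodory functions and $g_{s_1},g_{s_2}$ are bounded on bounded sets. Suppose, with $g_1=g_{s_1}$,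 $g_2=g_{s_2}$ and real constants $k_i,d_i,c_i,\alpha_i$ ($i=1,2$): * (H0) $g_i(x,0,0)=0$ for a.a. $x\in\partial\Omega$; for every bounded $M\subseteq\mathbb R^2$ there is $H\in L^\infty(\partial\Omega)$ with $|g_i(x,s)|\le H(x)$ for a.a. $x$ and all $s\in M$; and there are $K_i>0$, $\alpha\in(0,1]$ and $L_i\ge0$ with $|g_i(x,s,t)-g_i(x',s',t')|\le L_i(|x-x'|^{\alpha}+|s-s'|^{\alpha}+|t-t'|^{\alpha})$ on $\partial\Omega\times[-K_i,K_i]^2$, where $L_i\ge\|H\|_\infty$ for some bound $H$ as above for $M=[-K_i,K_i]^2$. * (H1) $k_i>0$, $d_i<0$, and for a.a. $x\in\partial\Omega$: $g_1(x,k_1,s_2)\le0$ for $s_2\in[0,k_2]$, $g_1(x,d_1,s_2)\ge0$ for $s_2\in[d_2,0]$, $g_2(x,s_1,k_2)\le0$ for $s_1\in[0,k_1]$, $g_2(x,s_1,d_2)\ge0$ for $s_1\in[d_1,0]$. * (H2) $c_i>\lambda_{1,p_i}$, and $\liminf_{s_1\to0^\pm}\frac{g_1(x,s_1,s_2)}{|s_1|^{p_1-2}s_1}\ge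 c_1$ uniformly for a.a. $x\in\partial\Omega$ and all $s_2\in(0,k_2]$ (for $0^+$), respectively all $s_2\in[d_2,0)$ (for $0^-$); likewise $\liminf_{s_2\to0^\pm}\frac{g_2(x,s_1,s_2)}{|s_2|^{p_2-2}s_2}\ge c_2$ uniformly for a.a. $x$ and all $s_1\in(0,k_1]$, respectively all $s_1\in[d_1,0)$. * (H3) $\alpha_i\ge c_i$, and the four limits superior corresponding to (H2) are $\le\alpha_1$, respectively $\le\alpha_2$, uniformly in the same sense. * (H4) For a.a. $x\in\partial\Omega$: $s_2\mapsto g_{s_1}(x,s_1,s_2)$ is nondecreasing on $[d_2,k_2]$ for all $s_1\in[d_1,k_1]$, and $s_1\mapsto g_{s_2}(x,s_1,s_2)$ is nondecreasing on $[d_1,k_1]$ for all $s_2\in[d_2,k_2]$. Consider the system $-\Delta_{p_i}u_i=-|u_i|^{p_i-2}u_i$ in $\Omega$, $|\nabla u_i|^{p_i-2}\nabla u_i\cdot\nu=g_{s_i}(x,u_1,u_2)$ on $\partial\Omega$, $i=1,2$, with weak solutions in $\mathcal W$. A solution is positive (negative) if both components are positive (negative) a.e. in $\Omega$; a positive solution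 $m$ is minimal if every positive solution $u\le m$ equals $m$, and a maximal negative solution is defined analogously. Let $(u_{1,+},u_{2,+})$ be a minimal positive solution with $u_{i,+}\le k_i$ and $(u_{1,-},u_{2,-})$ a maximal negative solution with $u_{i,-}\ge d_i$. Let $\tau_+(x,\cdot),\tau_-(x,\cdot),\tau_0(x,\cdot)$ be the projections of $\mathbb R^2$ onto $[0,u_{1,+}(x)]\times[0,u_{2,+}(x)]$, $[u_{1,-}(x),0]\times[u_{2,-}(x),0]$ and $[u_{1,-}(x),u_{1,+}(x)]\times[u_{2,-}(x),u_{2,+}(x)]$, and, with $r^\pm=\max\{\pm r,0\}$ and $s=(s_1,s_2)$, $$g_+(x,s)=g(x,\tau_+(x,s))+\sum_{i=1}^2\big[(s_i-u_{i,+}(x))^+-s_i^-\big]g_{s_i}(x,\tau_+(x,s)),$$ $$g_-(x,s)=g(x,\tau_-(x,s))+\sum_{i=1}^2\big[s_i^+-(s_i-u_{i,-}(x))^-\big]g_{s_i}(x,\tau_-(x,s)),$$ $$g_0(x,s)=g(x,\tau_0(x,s))+\sum_{i=1}^2\big[(s_i-u_{i,+}(x))^+-(s_i-u_{i,-}(x))^-\big]g_{s_i}(x,\tau_0(x,s)).$$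 For $*\in\{+,-,0\}$ define $E_*\colon\mathcal W\to\mathbb R$ by $$E_*(u_1,u_2)=\tfrac1{p_1}\|u_1\|_{1,p_1}^{p_1}+\tfrac1{p_2}\|u_2\|_{1,p_2}^{p_2}-\int_{\partial\Omega}g_*(x,u_1,u_2)\,d\sigma .$$ A point $v\in\mathcal W$ is a critical point of $E_*$ (in Clarke's sense) if $E_*$ is Lipschitz continuous near $v$ and $0$ belongs to the generalized gradient $\partial E_*(v)$, i.e. $\limsup_{z\to v,\,t\to0^+}\frac{E_*(z+ty)-E_*(z)}{t}\ge0$ for all $y\in\mathcal W$. Then, for a.a. $x\in\partial\Omega$ and $i=1,2$: 1. if $(v_1,v_2)$ is a critical point of $E_+$, then $0\le v_i(x)\le u_{i,+}(x)$; 2. if $(v_1,v_2)$ is a critical point of $E_-$, then $u_{i,-}(x)\le v_i(x)\le0$; 3. if $(v_1,v_2)$ is a critical point of $E_0$, then $u_{i,-}(x)\le v_i(x)\le u_{i,+}(x)$. -/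

import Mathlib

open MeasureTheory Set Filter Topology
open scoped ENNReal ContDiff

noncomputable section

namespace SteklovSystem

/-- Euclidean space of dimension `N`. -/
abbrev Euc (N : ℕ) : Type := EuclideanSpace ℝ (Fin N)

instance fact_one_le_ofReal (p : ℝ) [hp : Fact (1 < p)] : Fact (1 ≤ ENNReal.ofReal p) :=
  ⟨by simpa using ENNReal.ofReal_le_ofReal hp.out.le⟩

/-! ### Domains and surface measure -/

/-- A bounded domain with `C²` boundary: near each boundary point, after choosing a unit direction
`e`, the domain is the strict epigraph in direction `e` of a `C²` function `γ` of the component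
orthogonal to `e`. -/
structure IsC2Domain {N : ℕ} (Ω : Set (Euc N)) : Prop where
  isOpen : IsOpen Ω
  isConnected : IsConnected Ω
  isBounded : Bornology.IsBounded Ω
  boundary : ∀ x₀ ∈ frontier Ω, ∃ e : Euc N, ‖e‖ = 1 ∧ ∃ γ : Euc N → ℝ, ContDiff ℝ 2 γ ∧
    ∀ᶠ x in 𝓝 x₀, (x ∈ Ω ↔ γ (x - inner ℝ e x • e) < inner ℝ e x)

/-- The `(N-1)`-dimensional Hausdorff surface measure on `∂Ω`, with the normalisation that agrees
with Lebesgue measure on hyperplanes. -/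
def surf {N : ℕ} (Ω : Set (Euc N)) : Measure (Euc N) :=
  (Measure.euclideanHausdorffMeasure (N - 1)).restrict (frontier Ω)

/-! ### Sobolev spaces and traces -/

/-- `G` is the weak (distributional) gradient of `u` in `Ω`. -/
def IsWeakGradient {N : ℕ} (Ω : Set (Euc N)) (u : Euc N → ℝ) (G : Euc N → Euc N) : Prop :=
  ∀ φ : Euc N → ℝ, ContDiff ℝ ∞ φ → HasCompactSupport φ → tsupport φ ⊆ Ω → ∀ e : Euc N,
    ∫ x in Ω, u x * fderiv ℝ φ x e = - ∫ x in Ω, inner ℝ (G x) e * φ x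

theorem integrable_mul_fderiv {N : ℕ} {Ω : Set (Euc N)} {q : ℝ≥0∞} [hq : Fact (1 ≤ q)]
    (u : Lp ℝ q (volume.restrict Ω)) {φ : Euc N → ℝ} (hφ : ContDiff ℝ ∞ φ)
    (hc : HasCompactSupport φ) (e : Euc N) :
    Integrable (fun x => u x * fderiv ℝ φ x e) (volume.restrict Ω) := by
  have hl : LocallyIntegrable u (volume.restrict Ω) := (Lp.memLp u).locallyIntegrable hq.out
  have hcont : Continuous (fun x => fderiv ℝ φ x e) :=
    (hφ.continuous_fderiv (by simp)).clm_apply continuous_const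
  have hsupp : HasCompactSupport (fun x => fderiv ℝ φ x e) := hc.fderiv_apply ℝ e
  have := hl.integrable_smul_left_of_hasCompactSupport hcont hsupp
  simpa [smul_eq_mul, mul_comm] using this

theorem integrable_inner_mul {N : ℕ} {Ω : Set (Euc N)} {q : ℝ≥0∞} [hq : Fact (1 ≤ q)]
    (G : Lp (Euc N) q (volume.restrict Ω)) {φ : Euc N → ℝ} (hφ : ContDiff ℝ ∞ φ)
    (hc : HasCompactSupport φ) (e : Euc N) :
    Integrable (fun x => inner ℝ (G x) e * φ x) (volume.restrict Ω) := by
  have hl : LocallyIntegrable G (volume.restrict Ω) := (Lp.memLp G).locallyIntegrable hq.out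
  have h1 := hl.integrable_smul_left_of_hasCompactSupport hφ.continuous hc
  have h2 := h1.inner_const (𝕜 := ℝ) e
  refine h2.congr (Eventually.of_forall fun x => ?_)
  simp [real_inner_smul_left, mul_comm]

/-- `W^{1,p}(Ω)` as the space of pairs `(u, ∇u)` in `L^p(Ω) × L^p(Ω; ℝ^N)`, where `∇u` is the weak
gradient of `u`, with the norm `(‖u‖_p ^ p + ‖∇u‖_p ^ p) ^ (1 / p)`. -/
def sobolev {N : ℕ} (Ω : Set (Euc N)) (p : ℝ) [Fact (1 < p)] :
    Submodule ℝ (WithLp (ENNReal.ofReal p)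
      (Lp ℝ (ENNReal.ofReal p) (volume.restrict Ω) ×
        Lp (Euc N) (ENNReal.ofReal p) (volume.restrict Ω))) where
  carrier := {w | IsWeakGradient Ω w.fst w.snd}
  zero_mem' := by
    intro φ hφ hc hs e
    have h1 : (fun x => (0 : Lp ℝ (ENNReal.ofReal p) (volume.restrict Ω)) x * fderiv ℝ φ x e)
        =ᵐ[volume.restrict Ω] fun _ => 0 := by
      filter_upwards [Lp.coeFn_zero ℝ (ENNReal.ofReal p) (volume.restrict Ω)] with x hx
      rw [hx]
      simp
    have h2 : (fun x => inner ℝ ((0 : Lp (Euc N) (ENNReal.ofReal p) (volume.restrict Ω)) x) e * φ x)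
        =ᵐ[volume.restrict Ω] fun _ => 0 := by
      filter_upwards [Lp.coeFn_zero (Euc N) (ENNReal.ofReal p) (volume.restrict Ω)] with x hx
      rw [hx]
      simp
    exact (integral_congr_ae h1).trans
      ((by simp : _ = -∫ _ in Ω, (0 : ℝ)).trans (congrArg Neg.neg (integral_congr_ae h2).symm))
  add_mem' := by
    intro a b ha hb φ hφ hc hs e
    have h1 : (fun x => (a.fst + b.fst) x * fderiv ℝ φ x e) =ᵐ[volume.restrict Ω]
        fun x => a.fst x * fderiv ℝ φ x e + b.fst x * fderiv ℝ φ x e := by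
      filter_upwards [Lp.coeFn_add a.fst b.fst] with x hx
      rw [hx, Pi.add_apply, add_mul]
    have h2 : (fun x => inner ℝ ((a.snd + b.snd) x) e * φ x) =ᵐ[volume.restrict Ω]
        fun x => inner ℝ (a.snd x) e * φ x + inner ℝ (b.snd x) e * φ x := by
      filter_upwards [Lp.coeFn_add a.snd b.snd] with x hx
      rw [hx, Pi.add_apply, inner_add_left, add_mul]
    have e1 := (integral_congr_ae h1).trans
      (integral_add (integrable_mul_fderiv a.fst hφ hc e) (integrable_mul_fderiv b.fst hφ hc e))
    have e2 := (integral_congr_ae h2).trans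
      (integral_add (integrable_inner_mul a.snd hφ hc e) (integrable_inner_mul b.snd hφ hc e))
    have e3 := ha φ hφ hc hs e
    have e4 := hb φ hφ hc hs e
    refine e1.trans (Eq.trans ?_ (congrArg Neg.neg e2.symm))
    rw [e3, e4, neg_add]
  smul_mem' := by
    intro c a ha φ hφ hc hs e
    have h1 : (fun x => (c • a.fst) x * fderiv ℝ φ x e) =ᵐ[volume.restrict Ω]
        fun x => c * (a.fst x * fderiv ℝ φ x e) := by
      filter_upwards [Lp.coeFn_smul c a.fst] with x hx
      rw [hx, Pi.smul_apply, smul_eq_mul, mul_assoc]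
    have h2 : (fun x => inner ℝ ((c • a.snd) x) e * φ x) =ᵐ[volume.restrict Ω]
        fun x => c * (inner ℝ (a.snd x) e * φ x) := by
      filter_upwards [Lp.coeFn_smul c a.snd] with x hx
      rw [hx, Pi.smul_apply, real_inner_smul_left, mul_assoc]
    have e1 := (integral_congr_ae h1).trans (integral_const_mul c _)
    have e2 := (integral_congr_ae h2).trans (integral_const_mul c _)
    have e3 := ha φ hφ hc hs e
    refine e1.trans (Eq.trans ?_ (congrArg Neg.neg e2.symm))
    rw [e3, mul_neg]

/-- The normed space `W^{1,p}(Ω)`. -/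
abbrev W1 {N : ℕ} (Ω : Set (Euc N)) (p : ℝ) [Fact (1 < p)] : Type := sobolev Ω p

/-- The function underlying an element of `W^{1,p}(Ω)`. -/
def W1.fn {N : ℕ} {Ω : Set (Euc N)} {p : ℝ} [Fact (1 < p)] (u : W1 Ω p) : Euc N → ℝ :=
  fun x => u.1.fst x

/-- The weak gradient of an element of `W^{1,p}(Ω)`. -/
def W1.grad {N : ℕ} {Ω : Set (Euc N)} {p : ℝ} [Fact (1 < p)] (u : W1 Ω p) : Euc N → Euc N :=
  fun x => u.1.snd x

/-- Pairs `(φ|_Ω, φ|_∂Ω)` with `φ` of class `C¹` on `ℝ^N`. -/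
def classicalTraces {N : ℕ} (Ω : Set (Euc N)) (p : ℝ) [Fact (1 < p)] :
    Set (W1 Ω p × Lp ℝ (ENNReal.ofReal p) (surf Ω)) :=
  {z | ∃ φ : Euc N → ℝ, ContDiff ℝ 1 φ ∧ z.1.fn =ᵐ[volume.restrict Ω] φ ∧ z.2 =ᵐ[surf Ω] φ}

/-- `w` is the trace of `u` on `∂Ω`: the pair `(u, w)` is a limit in `W^{1,p}(Ω) × L^p(∂Ω)` of pairs
`(φ|_Ω, φ|_∂Ω)` with `φ` of class `C¹` on `ℝ^N`. -/
def IsTrace {N : ℕ} {Ω : Set (Euc N)} {p : ℝ} [Fact (1 < p)] (u : W1 Ω p)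
    (w : Lp ℝ (ENNReal.ofReal p) (surf Ω)) : Prop :=
  (u, w) ∈ closure (classicalTraces Ω p)

open Classical in
/-- The trace operator `W^{1,p}(Ω) → L^p(∂Ω)`. (On a bounded domain with `C²` boundary every `u` has
exactly one trace; the value `0` is only a default elsewhere.) -/
def trace {N : ℕ} {Ω : Set (Euc N)} {p : ℝ} [Fact (1 < p)] (u : W1 Ω p) :
    Lp ℝ (ENNReal.ofReal p) (surf Ω) :=
  if h : ∃ w, IsTrace u w then h.choose else 0

/-! ### The `p`-Laplacian with boundary terms -/

/-- The integrand `|∇u|^{p-2} ∇u · ∇φ`. -/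
def gradTerm {N : ℕ} {Ω : Set (Euc N)} {p : ℝ} [Fact (1 < p)] (u φ : W1 Ω p) (x : Euc N) : ℝ :=
  ‖u.grad x‖ ^ (p - 2) * inner ℝ (u.grad x) (φ.grad x)

/-- The integrand `|u|^{p-2} u φ` in `Ω`. -/
def massTerm {N : ℕ} {Ω : Set (Euc N)} {p : ℝ} [Fact (1 < p)] (u φ : W1 Ω p) (x : Euc N) : ℝ :=
  |u.fn x| ^ (p - 2) * u.fn x * φ.fn x

/-- `μ` is an eigenvalue of the `p`-Laplacian with Steklov boundary condition:
`-Δ_p u = -|u|^{p-2} u` in `Ω`, `|∇u|^{p-2} ∇u · ν = μ |u|^{p-2} u` on `∂Ω` has a nonzero weak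
solution. -/
def IsSteklovEigenvalue {N : ℕ} (Ω : Set (Euc N)) (p : ℝ) [Fact (1 < p)] (μ : ℝ) : Prop :=
  ∃ u : W1 Ω p, u ≠ 0 ∧ ∀ φ : W1 Ω p,
    (∫ x in Ω, gradTerm u φ x) + ∫ x in Ω, massTerm u φ x =
      μ * ∫ x, |trace u x| ^ (p - 2) * trace u x * trace φ x ∂surf Ω

/-- The first Steklov eigenvalue `λ_{1,p}`. -/
def steklov₁ {N : ℕ} (Ω : Set (Euc N)) (p : ℝ) [Fact (1 < p)] : ℝ :=
  sInf {μ | IsSteklovEigenvalue Ω p μ}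

/-- Weak solutions `u = (u₁, u₂)` of the system `-Δ_{pᵢ} uᵢ = -|uᵢ|^{pᵢ-2} uᵢ` in `Ω`,
`|∇uᵢ|^{pᵢ-2} ∇uᵢ · ν = gᵢ(x, u₁, u₂)` on `∂Ω`, `i = 1, 2`. -/
structure IsWeakSolution {N : ℕ} {Ω : Set (Euc N)} {p₁ p₂ : ℝ} [Fact (1 < p₁)] [Fact (1 < p₂)]
    (g₁ g₂ : Euc N → ℝ → ℝ → ℝ) (u : W1 Ω p₁ × W1 Ω p₂) : Prop where
  integrable₁ : ∀ φ : W1 Ω p₁, IntegrableOn (gradTerm u.1 φ) Ω ∧ IntegrableOn (massTerm u.1 φ) Ω ∧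
    Integrable (fun x => g₁ x (trace u.1 x) (trace u.2 x) * trace φ x) (surf Ω)
  integrable₂ : ∀ φ : W1 Ω p₂, IntegrableOn (gradTerm u.2 φ) Ω ∧ IntegrableOn (massTerm u.2 φ) Ω ∧
    Integrable (fun x => g₂ x (trace u.1 x) (trace u.2 x) * trace φ x) (surf Ω)
  eq₁ : ∀ φ : W1 Ω p₁, (∫ x in Ω, gradTerm u.1 φ x) + ∫ x in Ω, massTerm u.1 φ x =
    ∫ x, g₁ x (trace u.1 x) (trace u.2 x) * trace φ x ∂surf Ω
  eq₂ : ∀ φ : W1 Ω p₂, (∫ x in Ω, gradTerm u.2 φ x) + ∫ x in Ω, massTerm u.2 φ x =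
    ∫ x, g₂ x (trace u.1 x) (trace u.2 x) * trace φ x ∂surf Ω

/-- The componentwise order on `W^{1,p₁}(Ω) × W^{1,p₂}(Ω)`, almost everywhere in `Ω`. -/
def LeAE {N : ℕ} {Ω : Set (Euc N)} {p₁ p₂ : ℝ} [Fact (1 < p₁)] [Fact (1 < p₂)]
    (u v : W1 Ω p₁ × W1 Ω p₂) : Prop :=
  ∀ᵐ x ∂volume.restrict Ω, u.1.fn x ≤ v.1.fn x ∧ u.2.fn x ≤ v.2.fn x

/-- A positive solution: both components are positive. -/
def IsPositiveSolution {N : ℕ} {Ω : Set (Euc N)} {p₁ p₂ : ℝ} [Fact (1 < p₁)] [Fact (1 < p₂)]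
    (g₁ g₂ : Euc N → ℝ → ℝ → ℝ) (u : W1 Ω p₁ × W1 Ω p₂) : Prop :=
  IsWeakSolution g₁ g₂ u ∧ ∀ᵐ x ∂volume.restrict Ω, 0 < u.1.fn x ∧ 0 < u.2.fn x

/-- A negative solution: both components are negative. -/
def IsNegativeSolution {N : ℕ} {Ω : Set (Euc N)} {p₁ p₂ : ℝ} [Fact (1 < p₁)] [Fact (1 < p₂)]
    (g₁ g₂ : Euc N → ℝ → ℝ → ℝ) (u : W1 Ω p₁ × W1 Ω p₂) : Prop :=
  IsWeakSolution g₁ g₂ u ∧ ∀ᵐ x ∂volume.restrict Ω, u.1.fn x < 0 ∧ u.2.fn x < 0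

/-- A minimal positive solution. -/
def IsMinimalPositiveSolution {N : ℕ} {Ω : Set (Euc N)} {p₁ p₂ : ℝ} [Fact (1 < p₁)]
    [Fact (1 < p₂)] (g₁ g₂ : Euc N → ℝ → ℝ → ℝ) (m : W1 Ω p₁ × W1 Ω p₂) : Prop :=
  IsPositiveSolution g₁ g₂ m ∧ ∀ u, IsPositiveSolution g₁ g₂ u → LeAE u m → u = m

/-- A maximal negative solution. -/
def IsMaximalNegativeSolution {N : ℕ} {Ω : Set (Euc N)} {p₁ p₂ : ℝ} [Fact (1 < p₁)]
    [Fact (1 < p₂)] (g₁ g₂ : Euc N → ℝ → ℝ → ℝ) (m : W1 Ω p₁ × W1 Ω p₂) : Prop :=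
  IsNegativeSolution g₁ g₂ m ∧ ∀ u, IsNegativeSolution g₁ g₂ u → LeAE m u → u = m

/-! ### Hypotheses on the boundary nonlinearity

A function on `∂Ω × ℝ × ℝ` is represented by a function on `ℝ^N × ℝ × ℝ` of which only the values
over `∂Ω` are used. -/

/-- Carathéodory functions on `∂Ω × ℝ × ℝ`. -/
def IsCaratheodory {N : ℕ} (Ω : Set (Euc N)) (f : Euc N → ℝ → ℝ → ℝ) : Prop :=
  (∀ s₁ s₂, AEMeasurable (fun x => f x s₁ s₂) (surf Ω)) ∧
    ∀ᵐ x ∂surf Ω, Continuous fun s : ℝ × ℝ => f x s.1 s.2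

/-- Partial derivative with respect to the second variable. -/
def ds₁ {N : ℕ} (g : Euc N → ℝ → ℝ → ℝ) : Euc N → ℝ → ℝ → ℝ :=
  fun x s₁ s₂ => deriv (fun t => g x t s₂) s₁

/-- Partial derivative with respect to the third variable. -/
def ds₂ {N : ℕ} (g : Euc N → ℝ → ℝ → ℝ) : Euc N → ℝ → ℝ → ℝ :=
  fun x s₁ s₂ => deriv (fun t => g x s₁ t) s₂

/-- `f` is bounded on bounded sets: on each bounded `M ⊆ ℝ²` it is dominated by some
`H ∈ L^∞(∂Ω)`. -/
def BoundedOnBounded {N : ℕ} (Ω : Set (Euc N)) (f : Euc N → ℝ → ℝ → ℝ) : Prop :=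
  ∀ M : Set (ℝ × ℝ), Bornology.IsBounded M → ∃ H : Euc N → ℝ, MemLp H ∞ (surf Ω) ∧
    ∀ᵐ x ∂surf Ω, ∀ s ∈ M, |f x s.1 s.2| ≤ H x

/-- The regularity assumptions on the potential `g`. -/
structure IsPotential {N : ℕ} (Ω : Set (Euc N)) (g : Euc N → ℝ → ℝ → ℝ) : Prop where
  caratheodory : IsCaratheodory Ω g
  differentiable : ∀ᵐ x ∂surf Ω, Differentiable ℝ fun s : ℝ × ℝ => g x s.1 s.2
  differentiable_fderiv : ∀ᵐ x ∂surf Ω,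
    Differentiable ℝ (fderiv ℝ fun s : ℝ × ℝ => g x s.1 s.2)
  caratheodory₁ : IsCaratheodory Ω (ds₁ g)
  caratheodory₂ : IsCaratheodory Ω (ds₂ g)
  caratheodory₁₁ : IsCaratheodory Ω (ds₁ (ds₁ g))
  caratheodory₁₂ : IsCaratheodory Ω (ds₂ (ds₁ g))
  caratheodory₂₂ : IsCaratheodory Ω (ds₂ (ds₂ g))
  bounded₁ : BoundedOnBounded Ω (ds₁ g)
  bounded₂ : BoundedOnBounded Ω (ds₂ g)
  zero : ∀ᵐ x ∂surf Ω, g x 0 0 = 0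

/-- Hypothesis (H0) for one component: Carathéodory, zero at the origin, bounded on bounded sets,
and Hölder continuous on `∂Ω × [-K, K] × [-K, K]` with a constant `L` that dominates the bound `H`
on `[-K, K]²`. -/
structure HypH0 {N : ℕ} (Ω : Set (Euc N)) (f : Euc N → ℝ → ℝ → ℝ) : Prop where
  caratheodory : IsCaratheodory Ω f
  zero : ∀ᵐ x ∂surf Ω, f x 0 0 = 0
  bounded : BoundedOnBounded Ω f
  holder : ∃ K > 0, ∃ α ∈ Ioc (0 : ℝ) 1, ∃ L : ℝ, 0 ≤ L ∧
    (∃ H : Euc N → ℝ, eLpNorm H ∞ (surf Ω) ≤ ENNReal.ofReal L ∧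
      AEStronglyMeasurable H (surf Ω) ∧
      ∀ᵐ x ∂surf Ω, ∀ s ∈ Icc (-K) K, ∀ t ∈ Icc (-K) K, |f x s t| ≤ H x) ∧
    ∀ x ∈ frontier Ω, ∀ y ∈ frontier Ω,
      ∀ s ∈ Icc (-K) K, ∀ t ∈ Icc (-K) K, ∀ s' ∈ Icc (-K) K, ∀ t' ∈ Icc (-K) K,
        |f x s t - f y s' t'| ≤ L * (‖x - y‖ ^ α + |s - s'| ^ α + |t - t'| ^ α)

/-- Hypothesis (H1). -/
structure HypH1 {N : ℕ} (Ω : Set (Euc N)) (g₁ g₂ : Euc N → ℝ → ℝ → ℝ) (k₁ k₂ d₁ d₂ : ℝ) :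
    Prop where
  k₁_pos : 0 < k₁
  k₂_pos : 0 < k₂
  d₁_neg : d₁ < 0
  d₂_neg : d₂ < 0
  upper₁ : ∀ᵐ x ∂surf Ω, ∀ s₂ ∈ Icc 0 k₂, g₁ x k₁ s₂ ≤ 0
  lower₁ : ∀ᵐ x ∂surf Ω, ∀ s₂ ∈ Icc d₂ 0, 0 ≤ g₁ x d₁ s₂
  upper₂ : ∀ᵐ x ∂surf Ω, ∀ s₁ ∈ Icc 0 k₁, g₂ x s₁ k₂ ≤ 0
  lower₂ : ∀ᵐ x ∂surf Ω, ∀ s₁ ∈ Icc d₁ 0, 0 ≤ g₂ x s₁ d₂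

/-- `liminf_{s → l} q(x, s, t) ≥ c` uniformly for a.a. `x ∈ ∂Ω` and all `t ∈ T`. -/
def UnifLiminfGe {N : ℕ} (Ω : Set (Euc N)) (l : Filter ℝ) (T : Set ℝ) (q : Euc N → ℝ → ℝ → ℝ)
    (c : ℝ) : Prop :=
  ∀ ε > 0, ∃ S ∈ l, ∀ᵐ x ∂surf Ω, ∀ s ∈ S, ∀ t ∈ T, c - ε ≤ q x s t

/-- `limsup_{s → l} q(x, s, t) ≤ c` uniformly for a.a. `x ∈ ∂Ω` and all `t ∈ T`. -/
def UnifLimsupLe {N : ℕ} (Ω : Set (Euc N)) (l : Filter ℝ) (T : Set ℝ) (q : Euc N → ℝ → ℝ → ℝ)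
    (c : ℝ) : Prop :=
  ∀ ε > 0, ∃ S ∈ l, ∀ᵐ x ∂surf Ω, ∀ s ∈ S, ∀ t ∈ T, q x s t ≤ c + ε

/-- Hypothesis (H2). -/
structure HypH2 {N : ℕ} (Ω : Set (Euc N)) (p₁ p₂ : ℝ) [Fact (1 < p₁)] [Fact (1 < p₂)]
    (g₁ g₂ : Euc N → ℝ → ℝ → ℝ) (k₁ k₂ d₁ d₂ c₁ c₂ : ℝ) : Prop where
  lt₁ : steklov₁ Ω p₁ < c₁
  lt₂ : steklov₁ Ω p₂ < c₂
  right₁ : UnifLiminfGe Ω (𝓝[>] 0) (Ioc 0 k₂)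
    (fun x s₁ s₂ => g₁ x s₁ s₂ / s₁ ^ (p₁ - 1)) c₁
  left₁ : UnifLiminfGe Ω (𝓝[<] 0) (Ico d₂ 0)
    (fun x s₁ s₂ => g₁ x s₁ s₂ / (|s₁| ^ (p₁ - 2) * s₁)) c₁
  right₂ : UnifLiminfGe Ω (𝓝[>] 0) (Ioc 0 k₁)
    (fun x s₂ s₁ => g₂ x s₁ s₂ / s₂ ^ (p₂ - 1)) c₂
  left₂ : UnifLiminfGe Ω (𝓝[<] 0) (Ico d₁ 0)
    (fun x s₂ s₁ => g₂ x s₁ s₂ / (|s₂| ^ (p₂ - 2) * s₂)) c₂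

/-- Hypothesis (H3). -/
structure HypH3 {N : ℕ} (Ω : Set (Euc N)) (p₁ p₂ : ℝ) (g₁ g₂ : Euc N → ℝ → ℝ → ℝ)
    (k₁ k₂ d₁ d₂ c₁ c₂ α₁ α₂ : ℝ) : Prop where
  le₁ : c₁ ≤ α₁
  le₂ : c₂ ≤ α₂
  right₁ : UnifLimsupLe Ω (𝓝[>] 0) (Ioc 0 k₂)
    (fun x s₁ s₂ => g₁ x s₁ s₂ / s₁ ^ (p₁ - 1)) α₁
  left₁ : UnifLimsupLe Ω (𝓝[<] 0) (Ico d₂ 0)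
    (fun x s₁ s₂ => g₁ x s₁ s₂ / (|s₁| ^ (p₁ - 2) * s₁)) α₁
  right₂ : UnifLimsupLe Ω (𝓝[>] 0) (Ioc 0 k₁)
    (fun x s₂ s₁ => g₂ x s₁ s₂ / s₂ ^ (p₂ - 1)) α₂
  left₂ : UnifLimsupLe Ω (𝓝[<] 0) (Ico d₁ 0)
    (fun x s₂ s₁ => g₂ x s₁ s₂ / (|s₂| ^ (p₂ - 2) * s₂)) α₂

/-- Hypothesis (H4), where `(g₁, g₂)` is the gradient of the potential. -/
structure HypH4 {N : ℕ} (Ω : Set (Euc N)) (g₁ g₂ : Euc N → ℝ → ℝ → ℝ) (k₁ k₂ d₁ d₂ : ℝ) :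
    Prop where
  mono₁ : ∀ᵐ x ∂surf Ω, ∀ s₁ ∈ Icc d₁ k₁, MonotoneOn (fun s₂ => g₁ x s₁ s₂) (Icc d₂ k₂)
  mono₂ : ∀ᵐ x ∂surf Ω, ∀ s₂ ∈ Icc d₂ k₂, MonotoneOn (fun s₁ => g₂ x s₁ s₂) (Icc d₁ k₁)

/-! ### Truncations and energies -/

/-- The projection of `s` on `[a, b]` (for `a ≤ b`); the projection of `ℝ²` on a box acts
componentwise. -/
def clamp (a b s : ℝ) : ℝ := max a (min s b)

/-- The truncated potential `g₊`; `u₁, u₂` are the boundary values of the positive solution. -/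
def gPlus {N : ℕ} (g : Euc N → ℝ → ℝ → ℝ) (u₁ u₂ : Euc N → ℝ) (x : Euc N) (s₁ s₂ : ℝ) : ℝ :=
  let τ₁ := clamp 0 (u₁ x) s₁
  let τ₂ := clamp 0 (u₂ x) s₂
  g x τ₁ τ₂ + (s₁ - u₁ x)⁺ * ds₁ g x τ₁ τ₂ + (s₂ - u₂ x)⁺ * ds₂ g x τ₁ τ₂
    - s₁⁻ * ds₁ g x τ₁ τ₂ - s₂⁻ * ds₂ g x τ₁ τ₂

/-- The truncated potential `g₋`; `v₁, v₂` are the boundary values of the negative solution. -/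
def gMinus {N : ℕ} (g : Euc N → ℝ → ℝ → ℝ) (v₁ v₂ : Euc N → ℝ) (x : Euc N) (s₁ s₂ : ℝ) : ℝ :=
  let τ₁ := clamp (v₁ x) 0 s₁
  let τ₂ := clamp (v₂ x) 0 s₂
  g x τ₁ τ₂ - (s₁ - v₁ x)⁻ * ds₁ g x τ₁ τ₂ - (s₂ - v₂ x)⁻ * ds₂ g x τ₁ τ₂
    + s₁⁺ * ds₁ g x τ₁ τ₂ + s₂⁺ * ds₂ g x τ₁ τ₂

/-- The truncated potential `g₀`; `u₁, u₂` and `v₁, v₂` are the boundary values of the positive and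
of the negative solution. -/
def gZero {N : ℕ} (g : Euc N → ℝ → ℝ → ℝ) (u₁ u₂ v₁ v₂ : Euc N → ℝ) (x : Euc N) (s₁ s₂ : ℝ) : ℝ :=
  let τ₁ := clamp (v₁ x) (u₁ x) s₁
  let τ₂ := clamp (v₂ x) (u₂ x) s₂
  g x τ₁ τ₂ - (s₁ - v₁ x)⁻ * ds₁ g x τ₁ τ₂ - (s₂ - v₂ x)⁻ * ds₂ g x τ₁ τ₂
    + (s₁ - u₁ x)⁺ * ds₁ g x τ₁ τ₂ + (s₂ - u₂ x)⁺ * ds₂ g x τ₁ τ₂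

/-- The energy with boundary potential `G`:
`‖w₁‖^{p₁} / p₁ + ‖w₂‖^{p₂} / p₂ - ∫_{∂Ω} G(x, w₁, w₂) dσ`. -/
def energy {N : ℕ} {Ω : Set (Euc N)} {p₁ p₂ : ℝ} [Fact (1 < p₁)] [Fact (1 < p₂)]
    (G : Euc N → ℝ → ℝ → ℝ) (w : W1 Ω p₁ × W1 Ω p₂) : ℝ :=
  1 / p₁ * ‖w.1‖ ^ p₁ + 1 / p₂ * ‖w.2‖ ^ p₂ - ∫ x, G x (trace w.1 x) (trace w.2 x) ∂surf Ω

/-- The functional `E₊`. -/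
def EPlus {N : ℕ} {Ω : Set (Euc N)} {p₁ p₂ : ℝ} [Fact (1 < p₁)] [Fact (1 < p₂)]
    (g : Euc N → ℝ → ℝ → ℝ) (uP : W1 Ω p₁ × W1 Ω p₂) : W1 Ω p₁ × W1 Ω p₂ → ℝ :=
  energy (gPlus g (trace uP.1) (trace uP.2))

/-- The functional `E₋`. -/
def EMinus {N : ℕ} {Ω : Set (Euc N)} {p₁ p₂ : ℝ} [Fact (1 < p₁)] [Fact (1 < p₂)]
    (g : Euc N → ℝ → ℝ → ℝ) (uM : W1 Ω p₁ × W1 Ω p₂) : W1 Ω p₁ × W1 Ω p₂ → ℝ :=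
  energy (gMinus g (trace uM.1) (trace uM.2))

/-- The functional `E₀`. -/
def EZero {N : ℕ} {Ω : Set (Euc N)} {p₁ p₂ : ℝ} [Fact (1 < p₁)] [Fact (1 < p₂)]
    (g : Euc N → ℝ → ℝ → ℝ) (uP uM : W1 Ω p₁ × W1 Ω p₂) : W1 Ω p₁ × W1 Ω p₂ → ℝ :=
  energy (gZero g (trace uP.1) (trace uP.2) (trace uM.1) (trace uM.2))

/-! ### Clarke's generalized gradient -/

/-- `f` is Lipschitz continuous in a neighbourhood of `x`. -/
def LipschitzNear {X : Type*} [NormedAddCommGroup X] (f : X → ℝ) (x : X) : Prop :=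
  ∃ K, ∃ U ∈ 𝓝 x, LipschitzOnWith K f U

/-- Clarke's generalized directional derivative `f°(x; y)`. -/
def clarkeDeriv {X : Type*} [NormedAddCommGroup X] [NormedSpace ℝ X] (f : X → ℝ) (x y : X) : ℝ :=
  limsup (fun q : X × ℝ => (f (q.1 + q.2 • y) - f q.1) / q.2) (𝓝 x ×ˢ 𝓝[>] (0 : ℝ))

/-- Clarke's generalized gradient `∂f(x)`. -/
def clarkeGradient {X : Type*} [NormedAddCommGroup X] [NormedSpace ℝ X] (f : X → ℝ) (x : X) :
    Set (X →L[ℝ] ℝ) :=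
  {ξ | ∀ y, ξ y ≤ clarkeDeriv f x y}

/-- `x` is a critical point of `f`: `f` is Lipschitz near `x`, so that the generalized gradient is
defined there, and `0 ∈ ∂f(x)`. -/
def IsCriticalPoint {X : Type*} [NormedAddCommGroup X] [NormedSpace ℝ X] (f : X → ℝ) (x : X) :
    Prop :=
  LipschitzNear f x ∧ (0 : X →L[ℝ] ℝ) ∈ clarkeGradient f x

end SteklovSystem

end

open SteklovSystem

/-!
The three truncated potentials are instances of one construction. Let `a ≤ 0 ≤ b` be weak solutions
(one of them may be `0`, which is a weak solution because the partial derivatives of `g` vanish at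
the origin), and let `E` be the energy whose boundary potential is `g` on the box spanned by the
traces of `a` and `b`, continued linearly in the distance to the box. The claim is that a critical
point `v` of `E` satisfies `a ≤ v ≤ b` on `∂Ω`. The reflection `s ↦ -s` and the exchange of the two
components reduce it to `v₁ ≤ b₁`, which is proved in `IsC2Domain.trace_le_of_partialCritical`.

The classical argument tests the criticality of `v` with `-y`, where `y = (v₁ - b₁)⁺`: on the
support of `y` the truncated potential has the slope of `g` at the upper corner at most, by the
monotonicity (H4), and `b` solves the equation with that slope, so strict monotonicity of the
`p`-Laplacian with the zero order term forces `y = 0`. Two points make this delicate here.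

* Only difference quotients of `E` at points `z` near `v` are available. For the norm terms,
  convexity bounds them by the increment over a full step, which is continuous in `z`, and strict
  convexity (`W1.le_of_tangent_nonneg`) replaces strict monotonicity of the operator. The part
  `truncMain` of the boundary integral has dominated difference quotients, so it converges along
  points whose traces converge almost everywhere (`IsBoxPotential.exists_tendsto_main_quotient`).
* The part `truncRest` contains `(s₂ - b₂)⁺ g₂(x, τ₁, b₂)`, whose dependence on `s₁` has no modulus
  of continuity that is integrable in `x`, since the second derivatives of `g` need not be bounded.
  Where the step `z₁ → z₁ - t y` changes this term, `z₁` is within `t y` of the box while `v₁` is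
  outside of it, so `y` is at most `Z = (v₁ - z₁ + t y)⁺`, which tends to `0` in `W^{1,p₁}`
  (`truncRest_diff_le`). The increment along `Z` is estimated through the Lipschitz continuity of
  `E` near `v`: comparing the increments of `E` in the first variable at `z₂` and at `z₂ + ρ z₂⁺`,
  the norm terms cancel and `ρ` times the quantity in question remains
  (`IsC2Domain.excess_le`).

The argument uses the trace operator and positive parts in `W^{1,p}(Ω)`. The trace inequality for
functions of class `C¹` (`IsC2Domain.exists_trace_le`) comes from integrating along the lines in the
direction of a chart, and the density of these functions (`IsC2Domain.mem_closure_classical`) from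
mollification with shifted kernels and a partition of unity; together they show that every element
of `W^{1,p}(Ω)` has exactly one trace. Composition with functions of class `C¹` and a limit then
give positive parts and their traces (`IsC2Domain.exists_posPart`), hence the monotonicity of the
trace, which carries `v₁ ≤ b₁` from `Ω` to `∂Ω`.
-/

namespace SteklovSystem

/-! ### Hausdorff measure and projection along a direction -/

/-- The orthogonal projection along the unit vector `e` onto the hyperplane `eᗮ`. -/
noncomputable def projPerp {E : Type*} [NormedAddCommGroup E] [InnerProductSpace ℝ E] (e : E)
    (he : ‖e‖ = 1) (x : E) : (ℝ ∙ e)ᗮ :=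
  ⟨x - inner ℝ e x • e, by
    rw [Submodule.mem_orthogonal_singleton_iff_inner_right, inner_sub_right, inner_smul_right,
      real_inner_self_eq_norm_sq, he]
    ring⟩

theorem continuous_projPerp {E : Type*} [NormedAddCommGroup E] [InnerProductSpace ℝ E] (e : E)
    (he : ‖e‖ = 1) : Continuous (projPerp e he) := by
  unfold projPerp
  fun_prop

/-- Fubini for the splitting of the space into `eᗮ` and the lines parallel to `e`, up to a
constant: both sides integrate against a Haar measure. -/
theorem exists_lintegral_lines_eq {E : Type*} [NormedAddCommGroup E] [InnerProductSpace ℝ E]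
    [FiniteDimensional ℝ E] [MeasurableSpace E] [BorelSpace E] (e : E) (he : ‖e‖ = 1) :
    ∃ C : ℝ≥0∞, C ≠ ⊤ ∧ ∀ F : E → ℝ≥0∞, Measurable F →
      ∫⁻ y : (ℝ ∙ e)ᗮ, ∫⁻ t : ℝ, F (y + t • e) = C * ∫⁻ x, F x := by
  -- the isomorphism `(y, t) ↦ y + t e` carries the product measure to a Haar measure
  let Λ : ((ℝ ∙ e)ᗮ × ℝ) →ₗ[ℝ] E :=
    (Submodule.subtype _).coprod (LinearMap.toSpanSingleton ℝ E e)
  have hΛ : ∀ q, Λ q = (q.1 : E) + q.2 • e := fun q => by simp [Λ]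
  have hperp : ∀ y : (ℝ ∙ e)ᗮ, inner ℝ e (y : E) = 0 := fun y =>
    Submodule.mem_orthogonal_singleton_iff_inner_right.1 y.2
  have hbij : Function.Bijective Λ := by
    constructor
    · rw [← LinearMap.ker_eq_bot, LinearMap.ker_eq_bot']
      rintro ⟨y, t⟩ h
      rw [hΛ] at h
      have h1 := congrArg (inner ℝ e) h
      simp only [inner_add_right, hperp, inner_smul_right, real_inner_self_eq_norm_sq, he,
        inner_zero_right] at h1
      have ht : t = 0 := by linarith
      subst ht
      have hy : (y : E) = 0 := by simpa using h
      ext <;> simp [hy]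
    · intro x
      refine ⟨(projPerp e he x, inner ℝ e x), ?_⟩
      rw [hΛ]
      simp [projPerp]
  let L : ((ℝ ∙ e)ᗮ × ℝ) ≃L[ℝ] E := (LinearEquiv.ofBijective Λ hbij).toContinuousLinearEquiv
  have hL : ∀ q, L q = (q.1 : E) + q.2 • e := hΛ
  let μ : Measure E := Measure.map L ((volume : Measure (ℝ ∙ e)ᗮ).prod (volume : Measure ℝ))
  have hμ : μ.IsAddHaarMeasure := L.isAddHaarMeasure_map _
  refine ⟨Measure.addHaarScalarFactor μ volume, ENNReal.coe_ne_top, fun F hF => ?_⟩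
  have h1 : μ = Measure.addHaarScalarFactor μ volume • (volume : Measure E) :=
    Measure.isAddLeftInvariant_eq_smul μ volume
  have h2 : ∫⁻ x, F x ∂μ = ∫⁻ q : (ℝ ∙ e)ᗮ × ℝ, F (L q) :=
    lintegral_map hF L.continuous.measurable
  have h3 : ∫⁻ q : (ℝ ∙ e)ᗮ × ℝ, F (L q) = ∫⁻ y : (ℝ ∙ e)ᗮ, ∫⁻ t : ℝ, F (y + t • e) := by
    refine (lintegral_prod (fun q => F (L q))
      (hF.comp L.continuous.measurable).aemeasurable).trans ?_
    simp only [hL]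
  rw [← h3, ← h2]
  conv_lhs => rw [h1]
  rw [lintegral_smul_measure]
  rfl

/-- If the projection along `e` has a Lipschitz inverse on `S`, the image of the surface measure on
`S` under this projection is dominated by Lebesgue measure on `eᗮ`. -/
theorem map_projPerp_hausdorff_le {N : ℕ} (hN : 1 ≤ N) (e : Euc N) (he : ‖e‖ = 1)
    {S : Set (Euc N)} {L : NNReal}
    (hL : ∀ x ∈ S, ∀ y ∈ S, ‖x - y‖ ≤ L * ‖projPerp e he x - projPerp e he y‖) :
    Measure.map (projPerp e he) ((Measure.euclideanHausdorffMeasure (N - 1)).restrict S) ≤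
      (L ^ (N - 1) : NNReal) • (volume : Measure (ℝ ∙ e)ᗮ) := by
  have hm : Measurable (projPerp e he) := (continuous_projPerp e he).measurable
  have hrank : Module.finrank ℝ (ℝ ∙ e)ᗮ = N - 1 := by
    have : Fact (Module.finrank ℝ (Euc N) = (N - 1) + 1) := ⟨by simp; omega⟩
    exact Submodule.finrank_orthogonal_span_singleton (by rintro rfl; simp at he)
  refine Measure.le_iff.2 fun B hB => ?_
  rw [Measure.map_apply hm hB, Measure.restrict_apply (hm hB)]
  set A := projPerp e he ⁻¹' B ∩ S with hA
  have hinj : InjOn (projPerp e he) A := fun x hx y hy h => by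
    have := hL x hx.2 y hy.2
    rw [h] at this
    simpa [sub_eq_zero] using this
  have himg : Function.invFunOn (projPerp e he) A '' (projPerp e he '' A) = A :=
    hinj.invFunOn_image subset_rfl
  have hlip : LipschitzOnWith L (Function.invFunOn (projPerp e he) A) (projPerp e he '' A) := by
    refine LipschitzOnWith.of_dist_le_mul ?_
    rintro _ ⟨x, hx, rfl⟩ _ ⟨y, hy, rfl⟩
    rw [hinj.leftInvOn_invFunOn hx, hinj.leftInvOn_invFunOn hy, dist_eq_norm, dist_eq_norm]
    exact hL x hx.2 y hy.2
  have h1 := hlip.hausdorffMeasure_image_le (d := ((N - 1 : ℕ) : ℝ)) (Nat.cast_nonneg _)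
  rw [himg] at h1
  have h2 : Measure.euclideanHausdorffMeasure (N - 1) A ≤ (L : ℝ≥0∞) ^ (N - 1) *
      Measure.euclideanHausdorffMeasure (N - 1) (projPerp e he '' A) := by
    simp only [Measure.euclideanHausdorffMeasure_def, Measure.smul_apply, ENNReal.smul_def,
      smul_eq_mul]
    rw [ENNReal.rpow_natCast] at h1
    rw [mul_left_comm]
    gcongr
  have h3 : (Measure.euclideanHausdorffMeasure (N - 1) : Measure (ℝ ∙ e)ᗮ) = volume := by
    rw [← hrank, InnerProductSpace.euclideanHausdorffMeasure_eq_volume]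
  rw [h3] at h2
  refine h2.trans ?_
  rw [Measure.smul_apply, ENNReal.smul_def, smul_eq_mul]
  push_cast
  gcongr
  rintro _ ⟨x, hx, rfl⟩
  exact hx.1

/-- Integrating over `S` the integral of `F` along the lines in direction `e` costs at most a
constant times the integral of `F` over the whole space. -/
theorem exists_lintegral_surface_lines_le {N : ℕ} (hN : 1 ≤ N) (e : Euc N) (he : ‖e‖ = 1)
    {S : Set (Euc N)} {L : NNReal}
    (hL : ∀ x ∈ S, ∀ y ∈ S, ‖x - y‖ ≤ L * ‖projPerp e he x - projPerp e he y‖) :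
    ∃ C : ℝ≥0∞, C ≠ ⊤ ∧ ∀ F : Euc N → ℝ≥0∞, Measurable F →
      ∫⁻ x in S, ∫⁻ t : ℝ, F (x + t • e) ∂volume ∂(Measure.euclideanHausdorffMeasure (N - 1)) ≤
        C * ∫⁻ x, F x := by
  obtain ⟨C, hC, hF⟩ := exists_lintegral_lines_eq e he
  refine ⟨(L ^ (N - 1) : NNReal) * C, ENNReal.mul_ne_top ENNReal.coe_ne_top hC,
    fun F hFm => ?_⟩
  set q : (ℝ ∙ e)ᗮ → ℝ≥0∞ := fun y => ∫⁻ t : ℝ, F (y + t • e) with hq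
  have hqm : Measurable q := by
    refine Measurable.lintegral_prod_right' (f := fun z : (ℝ ∙ e)ᗮ × ℝ => F (z.1 + z.2 • e)) ?_
    exact hFm.comp (by fun_prop)
  -- the integral along the line through `x` depends on the projection of `x` only
  have hpt : ∀ x : Euc N, ∫⁻ t : ℝ, F (x + t • e) = q (projPerp e he x) := fun x => by
    rw [hq]
    have := lintegral_add_right_eq_self (μ := (volume : Measure ℝ))
      (fun t => F ((projPerp e he x : Euc N) + t • e)) (inner ℝ e x)
    refine Eq.trans ?_ this
    refine lintegral_congr fun t => ?_
    congr 1
    simp [projPerp, add_smul]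
  simp only [hpt]
  rw [← lintegral_map hqm (continuous_projPerp e he).measurable]
  calc _ ≤ ∫⁻ y, q y ∂((L ^ (N - 1) : NNReal) • (volume : Measure (ℝ ∙ e)ᗮ)) :=
        lintegral_mono' (map_projPerp_hausdorff_le hN e he hL) le_rfl
    _ = _ := by
        rw [lintegral_smul_measure, hF F hFm, ENNReal.smul_def, smul_eq_mul, mul_assoc]


/-! ### Local structure of the boundary -/

/-- Near a boundary point of a `C²` domain there is a direction `e` pointing into the domain: short
segments in direction `e` from boundary points lie in `Ω`, the projection along `e` restricted to
the boundary has a Lipschitz inverse, and a cone around `e` can be attached to each point of `Ω`. -/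
theorem IsC2Domain.exists_chart {N : ℕ} {Ω : Set (Euc N)} (hΩ : IsC2Domain Ω) {x₀ : Euc N}
    (hx₀ : x₀ ∈ frontier Ω) :
    ∃ (e : Euc N) (he : ‖e‖ = 1) (r c : ℝ) (L : NNReal), 0 < r ∧ 0 < c ∧
      (∀ x ∈ frontier Ω ∩ Metric.ball x₀ r, ∀ t ∈ Ioo 0 r, x + t • e ∈ Ω) ∧
      (∀ x ∈ frontier Ω ∩ Metric.ball x₀ r, ∀ y ∈ frontier Ω ∩ Metric.ball x₀ r,
        ‖x - y‖ ≤ L * ‖projPerp e he x - projPerp e he y‖) ∧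
      (∀ x ∈ Ω ∩ Metric.ball x₀ r, ∀ t ∈ Ioo 0 r, Metric.ball (x + t • e) (c * t) ⊆ Ω) := by
  obtain ⟨e, he, γ, hγ, hnear⟩ := hΩ.boundary x₀ hx₀
  set P : Euc N → Euc N := fun x => x - inner ℝ e x • e with hP
  have hPc : Continuous P := by fun_prop
  have hPval : ∀ x, (projPerp e he x : Euc N) = P x := fun x => rfl
  have hPsub : ∀ x y, P x - P y = P (x - y) := fun x y => by
    simp only [hP, inner_sub_right, sub_smul]; abel
  have hee : inner ℝ e e = (1 : ℝ) := by rw [real_inner_self_eq_norm_sq, he]; norm_num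
  have hPe : ∀ x (t : ℝ), P (x + t • e) = P x := fun x t => by
    simp only [hP, inner_add_right, inner_smul_right, hee, mul_one, add_smul]; abel
  have hPnorm : ∀ x, ‖P x‖ ≤ ‖x‖ := fun x => by
    have h1 : inner ℝ (P x) (inner ℝ e x • e) = (0 : ℝ) := by
      simp only [hP, inner_sub_left, inner_smul_right, inner_smul_left, hee,
        real_inner_comm x e]
      simp
    have h2 := norm_add_sq_eq_norm_sq_add_norm_sq_of_inner_eq_zero _ _ h1
    have h3 : P x + inner ℝ e x • e = x := by simp [hP]
    rw [h3] at h2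
    exact abs_le_of_sq_le_sq' (by nlinarith [mul_self_nonneg ‖inner ℝ e x • e‖])
      (norm_nonneg _) |>.2
  have hie : ∀ x, |inner ℝ e x| ≤ ‖x‖ := fun x => by
    simpa [he] using abs_real_inner_le_norm e x
  -- `γ` is Lipschitz near the projection of `x₀`
  obtain ⟨K, U, hU, hK⟩ := (hγ.of_le (by norm_num : (1 : WithTop ℕ∞) ≤ 2)).contDiffAt (x := P x₀)
    |>.exists_lipschitzOnWith
  have hPU : ∀ᶠ x in 𝓝 x₀, P x ∈ U := hPc.continuousAt.eventually hU
  obtain ⟨R, hR, hball⟩ := Metric.eventually_nhds_iff_ball.1 (hnear.and hPU)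
  have hmem : ∀ x ∈ Metric.ball x₀ R, (x ∈ Ω ↔ γ (P x) < inner ℝ e x) := fun x hx =>
    (hball x hx).1
  have hlip : ∀ x ∈ Metric.ball x₀ R, ∀ y ∈ Metric.ball x₀ R,
      |γ (P x) - γ (P y)| ≤ K * ‖P x - P y‖ := fun x hx y hy => by
    simpa [Real.dist_eq, dist_eq_norm] using hK.dist_le_mul _ (hball x hx).2 _ (hball y hy).2
  -- the boundary is the graph of `γ`
  have hfr : ∀ x ∈ frontier Ω ∩ Metric.ball x₀ R, γ (P x) = inner ℝ e x := by
    rintro x ⟨hx, hxR⟩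
    have hxΩ : x ∉ Ω := fun h => by
      rw [hΩ.isOpen.frontier_eq] at hx
      exact hx.2 h
    refine le_antisymm ?_ (not_lt.1 fun h => hxΩ ((hmem x hxR).2 h))
    by_contra! hlt
    have h1 : ∀ᶠ y in 𝓝 x, inner ℝ e y < γ (P y) :=
      (Continuous.continuousAt (by fun_prop)).eventually_lt
        (hγ.continuous.comp hPc).continuousAt hlt
    have h2 : ∀ᶠ y in 𝓝 x, y ∉ Ω := by
      filter_upwards [h1, Metric.isOpen_ball.mem_nhds hxR] with y hy hyR hyΩ
      exact absurd ((hmem y hyR).1 hyΩ) (not_lt.2 hy.le)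
    have h3 := frontier_subset_closure hx
    rw [mem_closure_iff_frequently] at h3
    exact h3 h2
  have hsub : Metric.ball x₀ (R / 2) ⊆ Metric.ball x₀ R := Metric.ball_subset_ball (by linarith)
  have hmove : ∀ x ∈ Metric.ball x₀ (R / 2), ∀ w : Euc N, ‖w‖ < R / 2 → x + w ∈ Metric.ball x₀ R := by
    intro x hx w hw
    rw [Metric.mem_ball, dist_eq_norm] at hx ⊢
    have : x + w - x₀ = (x - x₀) + w := by abel
    rw [this]
    linarith [norm_add_le (x - x₀) w]
  have hnt : ∀ t : ℝ, 0 < t → ‖t • e‖ = t := fun t ht => by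
    rw [norm_smul, he, mul_one, Real.norm_of_nonneg ht.le]
  -- in direction `e`, the height above the graph grows by `t`, and `γ` varies by at most `K ‖w‖`
  -- when a point is moved by `w`; this gives the aperture `1 / (K + 1)` of the cone
  refine ⟨e, he, R / 4, 1 / (K + 1), K + 1, by linarith, by positivity, ?_, ?_, ?_⟩
  · rintro x ⟨hx, hxR⟩ t ⟨ht, htR⟩
    have hx2 : x ∈ Metric.ball x₀ (R / 2) := Metric.ball_subset_ball (by linarith) hxR
    rw [hmem _ (hmove x hx2 _ (by rw [hnt t ht]; linarith)), hPe, hfr x ⟨hx, hsub hx2⟩,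
      inner_add_right, inner_smul_right, hee]
    linarith
  · rintro x ⟨hx, hxR⟩ y ⟨hy, hyR⟩
    have hx2 : x ∈ Metric.ball x₀ R := Metric.ball_subset_ball (by linarith) hxR
    have hy2 : y ∈ Metric.ball x₀ R := Metric.ball_subset_ball (by linarith) hyR
    have h1 : x - y = P (x - y) + inner ℝ e (x - y) • e := by simp [hP]
    have h2 : |inner ℝ e (x - y)| ≤ K * ‖P x - P y‖ := by
      rw [inner_sub_right, ← hfr x ⟨hx, hx2⟩, ← hfr y ⟨hy, hy2⟩]
      exact hlip x hx2 y hy2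
    have h3 : ‖projPerp e he x - projPerp e he y‖ = ‖P x - P y‖ := rfl
    rw [h3]
    calc ‖x - y‖ ≤ ‖P (x - y)‖ + ‖inner ℝ e (x - y) • e‖ := by
          conv_lhs => rw [h1]
          exact norm_add_le _ _
      _ ≤ ‖P x - P y‖ + K * ‖P x - P y‖ := by
          rw [hPsub, norm_smul, he, mul_one, Real.norm_eq_abs, ← hPsub]
          gcongr
      _ = _ := by push_cast; ring
  · rintro x ⟨hx, hxR⟩ t ⟨ht, htR⟩ y hy
    have hx2 : x ∈ Metric.ball x₀ (R / 2) := Metric.ball_subset_ball (by linarith) hxR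
    rw [Metric.mem_ball, dist_eq_norm] at hy
    set w := y - (x + t • e) with hw
    have hK1 : (0 : ℝ) < K + 1 := by positivity
    have hw1 : (K + 1) * ‖w‖ < t := by
      rw [div_mul_eq_mul_div, one_mul, lt_div_iff₀ hK1] at hy
      linarith
    have hw2 : ‖w‖ < t := by nlinarith [norm_nonneg w, K.2, mul_nonneg K.2 (norm_nonneg w)]
    have hy0 : y = x + (t • e + w) := by rw [hw]; abel
    have hyR : y ∈ Metric.ball x₀ R := by
      rw [hy0]
      refine hmove x hx2 _ ?_
      have := norm_add_le (t • e) w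
      rw [hnt t ht] at this
      linarith
    rw [hmem y hyR]
    have h1 := (hmem x (hsub hx2)).1 hx
    have h2 := hlip y hyR x (hsub hx2)
    have h3 : P y - P x = P w := by
      rw [hPsub, hw, show y - x = y - (x + t • e) + t • e by abel, hPe]
    rw [h3] at h2
    have h4 : inner ℝ e y = inner ℝ e x + t + inner ℝ e w := by
      rw [hy0, inner_add_right, inner_add_right, inner_smul_right, hee]; ring
    have h5 := abs_le.1 (hie w)
    have h6 : (K : ℝ) * ‖P w‖ ≤ K * ‖w‖ := mul_le_mul_of_nonneg_left (hPnorm w) K.2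
    have h7 := abs_le.1 h2
    rw [h4]
    nlinarith

/-! ### The trace inequality -/

/-- Jensen's inequality for the power `p` on a finite measure space. -/
theorem lintegral_rpow_le {α : Type*} [MeasurableSpace α] {μ : Measure α} {p : ℝ} (hp : 1 < p)
    {f : α → ℝ≥0∞} (hf : AEMeasurable f μ) :
    (∫⁻ x, f x ∂μ) ^ p ≤ μ univ ^ (p - 1) * ∫⁻ x, f x ^ p ∂μ := by
  have hp0 : 0 < p := by linarith
  have h := eLpNorm'_le_eLpNorm'_mul_rpow_measure_univ (μ := μ) one_pos hp.le
    hf.aestronglyMeasurable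
  simp only [eLpNorm', enorm_eq_self, ENNReal.rpow_one, div_one] at h
  refine (ENNReal.rpow_le_rpow h hp0.le).trans ?_
  rw [ENNReal.mul_rpow_of_nonneg _ _ hp0.le, ← ENNReal.rpow_mul, ← ENNReal.rpow_mul,
    one_div_mul_cancel hp0.ne', ENNReal.rpow_one, mul_comm,
    show (1 - 1 / p) * p = p - 1 by field_simp]

/-- The trace inequality on an interval: the value at an end point is controlled by the
`W^{1,p}`-norm. -/
theorem enorm_rpow_le_lintegral_Ioo {p : ℝ} (hp : 1 < p) {h : ℝ} (hh : 0 < h) {f : ℝ → ℝ}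
    (hf : ContDiff ℝ 1 f) :
    ENNReal.ofReal h * ‖f 0‖ₑ ^ p ≤ 2 ^ (p - 1) * ((∫⁻ s in Ioo 0 h, ‖f s‖ₑ ^ p) +
      ENNReal.ofReal h ^ p * ∫⁻ s in Ioo 0 h, ‖deriv f s‖ₑ ^ p) := by
  have hp0 : 0 < p := by linarith
  have hdc : Continuous (deriv f) := hf.continuous_deriv le_rfl
  have hvol : volume.restrict (Ioo 0 h) univ = ENNReal.ofReal h := by simp
  have hA := lintegral_rpow_le (μ := volume.restrict (Ioo 0 h)) hp
    (hdc.enorm.measurable.aemeasurable)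
  rw [hvol] at hA
  have hpt : ∀ s ∈ Ioo 0 h, ‖f 0‖ₑ ^ p ≤ 2 ^ (p - 1) * (‖f s‖ₑ ^ p +
      ENNReal.ofReal h ^ (p - 1) * ∫⁻ s in Ioo 0 h, ‖deriv f s‖ₑ ^ p) := by
    rintro s ⟨hs0, hsh⟩
    have h1 : f 0 = f s + -∫ t in (0 : ℝ)..s, deriv f t := by
      rw [intervalIntegral.integral_deriv_eq_sub
        (fun x _ => hf.differentiable one_ne_zero x) (hdc.intervalIntegrable _ _)]
      ring
    have h2 : ‖f 0‖ₑ ≤ ‖f s‖ₑ + ∫⁻ s in Ioo 0 h, ‖deriv f s‖ₑ := by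
      conv_lhs => rw [h1]
      refine (enorm_add_le _ _).trans ?_
      rw [enorm_neg, intervalIntegral.integral_of_le hs0.le]
      gcongr
      refine (enorm_integral_le_lintegral_enorm _).trans ?_
      refine lintegral_mono_set fun t ht => ⟨ht.1, ht.2.trans_lt hsh⟩
    calc _ ≤ (‖f s‖ₑ + ∫⁻ s in Ioo 0 h, ‖deriv f s‖ₑ) ^ p := by gcongr
      _ ≤ 2 ^ (p - 1) * (‖f s‖ₑ ^ p + (∫⁻ s in Ioo 0 h, ‖deriv f s‖ₑ) ^ p) :=
        ENNReal.rpow_add_le_mul_rpow_add_rpow _ _ hp.le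
      _ ≤ _ := by gcongr
  have hint := setLIntegral_mono' (μ := volume) measurableSet_Ioo hpt
  rw [setLIntegral_const, Real.volume_Ioo, sub_zero, lintegral_const_mul' _ _ (by simp),
    lintegral_add_right _ measurable_const, setLIntegral_const, Real.volume_Ioo, sub_zero] at hint
  rw [mul_comm]
  refine hint.trans ?_
  have hpow : ENNReal.ofReal h ^ p = ENNReal.ofReal h ^ (p - 1) * ENNReal.ofReal h := by
    conv_lhs => rw [show p = (p - 1) + 1 by ring]
    rw [ENNReal.rpow_add _ _ (by simpa using hh) (by simp), ENNReal.rpow_one]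
  rw [hpow, mul_right_comm]

/-- The trace inequality for functions of class `C¹`. -/
theorem IsC2Domain.exists_trace_le {N : ℕ} (hN : 1 ≤ N) {Ω : Set (Euc N)} (hΩ : IsC2Domain Ω)
    {p : ℝ} (hp : 1 < p) :
    ∃ C : ℝ≥0∞, C ≠ ⊤ ∧ ∀ φ : Euc N → ℝ, ContDiff ℝ 1 φ →
      ∫⁻ x, ‖φ x‖ₑ ^ p ∂surf Ω ≤
        C * ∫⁻ x in Ω, (‖φ x‖ₑ ^ p + ‖fderiv ℝ φ x‖ₑ ^ p) := by
  have hp0 : 0 < p := by linarith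
  set F : (Euc N → ℝ) → Euc N → ℝ≥0∞ := fun φ x => ‖φ x‖ₑ ^ p + ‖fderiv ℝ φ x‖ₑ ^ p with hF
  -- the inequality on the part of the boundary inside one chart
  have hloc : ∀ x₀ ∈ frontier Ω, ∃ r > 0, ∃ C : ℝ≥0∞, C ≠ ⊤ ∧ ∀ φ : Euc N → ℝ, ContDiff ℝ 1 φ →
      ∫⁻ x in frontier Ω ∩ Metric.ball x₀ r, ‖φ x‖ₑ ^ p
        ∂(Measure.euclideanHausdorffMeasure (N - 1)) ≤ C * ∫⁻ x in Ω, F φ x := by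
    intro x₀ hx₀
    obtain ⟨e, he, r, c, L, hr, -, hseg, hL, -⟩ := hΩ.exists_chart hx₀
    obtain ⟨C, hC, hCF⟩ := exists_lintegral_surface_lines_le hN e he hL
    have hr0 : ENNReal.ofReal r ≠ 0 := by simpa using hr
    set A : ℝ≥0∞ := (ENNReal.ofReal r)⁻¹ * (2 ^ (p - 1) * (1 + ENNReal.ofReal r ^ p)) with hA
    have hAtop : A ≠ ⊤ := by
      refine ENNReal.mul_ne_top (ENNReal.inv_ne_top.2 hr0) (ENNReal.mul_ne_top ?_ ?_)
      · exact ENNReal.rpow_ne_top_of_nonneg (by linarith) (by simp)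
      · exact ENNReal.add_ne_top.2 ⟨by simp, ENNReal.rpow_ne_top_of_nonneg hp0.le (by simp)⟩
    refine ⟨r, hr, A * C, ENNReal.mul_ne_top hAtop hC, fun φ hφ => ?_⟩
    have hfc : Continuous (fderiv ℝ φ) := hφ.continuous_fderiv one_ne_zero
    have hFm : Measurable (F φ) := by
      have h1 : Measurable fun x => ‖φ x‖ₑ := hφ.continuous.enorm.measurable
      have h2 : Measurable fun x => ‖fderiv ℝ φ x‖ₑ := hfc.enorm.measurable
      exact (h1.pow_const p).add (h2.pow_const p)
    -- the one-dimensional inequality on the segment from `x` into `Ω`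
    have hpt : ∀ x ∈ frontier Ω ∩ Metric.ball x₀ r,
        ‖φ x‖ₑ ^ p ≤ A * ∫⁻ t : ℝ, Ω.indicator (F φ) (x + t • e) := by
      intro x hx
      have hf : ContDiff ℝ 1 (fun t : ℝ => φ (x + t • e)) := hφ.comp (by fun_prop)
      have hder : ∀ t : ℝ, ‖deriv (fun t : ℝ => φ (x + t • e)) t‖ₑ ≤ ‖fderiv ℝ φ (x + t • e)‖ₑ := by
        intro t
        have h1 : HasDerivAt (fun t : ℝ => x + t • e) e t := by
          simpa using ((hasDerivAt_id t).smul_const e).const_add x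
        have h2 := ((hφ.differentiable one_ne_zero (x + t • e)).hasFDerivAt).comp_hasDerivAt t h1
        rw [show deriv (fun t : ℝ => φ (x + t • e)) t = fderiv ℝ φ (x + t • e) e from h2.deriv]
        refine (ContinuousLinearMap.le_opENorm _ _).trans ?_
        rw [← ofReal_norm e, he]
        simp
      have h1 := enorm_rpow_le_lintegral_Ioo hp hr hf
      simp only [zero_smul, add_zero] at h1
      have hI : ∀ f : ℝ → ℝ≥0∞, (∀ t ∈ Ioo 0 r, f t ≤ F φ (x + t • e)) →
          ∫⁻ t in Ioo 0 r, f t ≤ ∫⁻ t : ℝ, Ω.indicator (F φ) (x + t • e) := fun f hf => by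
        rw [← lintegral_indicator measurableSet_Ioo]
        refine lintegral_mono fun t => ?_
        by_cases ht : t ∈ Ioo 0 r
        · rw [indicator_of_mem ht, indicator_of_mem (hseg x hx t ht)]
          exact hf t ht
        · rw [indicator_of_notMem ht]
          exact zero_le
      have h2 : ∫⁻ t in Ioo 0 r, ‖φ (x + t • e)‖ₑ ^ p ≤
          ∫⁻ t : ℝ, Ω.indicator (F φ) (x + t • e) := hI _ fun t _ => le_self_add
      have h3 : ∫⁻ t in Ioo 0 r, ‖deriv (fun t : ℝ => φ (x + t • e)) t‖ₑ ^ p ≤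
          ∫⁻ t : ℝ, Ω.indicator (F φ) (x + t • e) := hI _ fun t _ =>
        (ENNReal.rpow_le_rpow (hder t) hp0.le).trans le_add_self
      calc ‖φ x‖ₑ ^ p = (ENNReal.ofReal r)⁻¹ * (ENNReal.ofReal r * ‖φ x‖ₑ ^ p) := by
            rw [← mul_assoc, ENNReal.inv_mul_cancel hr0 (by simp), one_mul]
        _ ≤ (ENNReal.ofReal r)⁻¹ * (2 ^ (p - 1) *
            ((∫⁻ t : ℝ, Ω.indicator (F φ) (x + t • e)) +
              ENNReal.ofReal r ^ p * ∫⁻ t : ℝ, Ω.indicator (F φ) (x + t • e))) := by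
            exact mul_le_mul_right (h1.trans (by gcongr)) _
        _ = _ := by rw [hA]; ring
    have hS : MeasurableSet (frontier Ω ∩ Metric.ball x₀ r) :=
      measurableSet_frontier.inter measurableSet_ball
    calc ∫⁻ x in frontier Ω ∩ Metric.ball x₀ r, ‖φ x‖ₑ ^ p
            ∂(Measure.euclideanHausdorffMeasure (N - 1))
        ≤ ∫⁻ x in frontier Ω ∩ Metric.ball x₀ r,
          A * ∫⁻ t : ℝ, Ω.indicator (F φ) (x + t • e) ∂volume
            ∂(Measure.euclideanHausdorffMeasure (N - 1)) := setLIntegral_mono' hS hpt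
      _ = A * ∫⁻ x in frontier Ω ∩ Metric.ball x₀ r, ∫⁻ t : ℝ, Ω.indicator (F φ) (x + t • e)
            ∂volume ∂(Measure.euclideanHausdorffMeasure (N - 1)) :=
          lintegral_const_mul' _ _ hAtop
      _ ≤ A * (C * ∫⁻ x, Ω.indicator (F φ) x) := by
          gcongr
          exact hCF _ (hFm.indicator hΩ.isOpen.measurableSet)
      _ = A * C * ∫⁻ x in Ω, F φ x := by
          rw [lintegral_indicator hΩ.isOpen.measurableSet, mul_assoc A]
  -- finitely many charts cover the boundary
  choose! r hr C hC hle using hloc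
  have hcomp : IsCompact (frontier Ω) :=
    Metric.isCompact_of_isClosed_isBounded isClosed_frontier
      (hΩ.isBounded.closure.subset frontier_subset_closure)
  obtain ⟨T, hT, hcov⟩ := hcomp.elim_nhds_subcover (fun x => Metric.ball x (r x))
    fun x hx => Metric.ball_mem_nhds x (hr x hx)
  refine ⟨∑ x ∈ T, C x, ENNReal.sum_ne_top.2 fun x hx => hC x (hT x hx), fun φ hφ => ?_⟩
  have hsub : frontier Ω ⊆ ⋃ x ∈ T, frontier Ω ∩ Metric.ball x (r x) := fun y hy => by
    have := hcov hy
    simp only [mem_iUnion] at this ⊢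
    obtain ⟨x, hx, hyx⟩ := this
    exact ⟨x, hx, hy, hyx⟩
  calc _ ≤ ∫⁻ x in ⋃ x ∈ T, frontier Ω ∩ Metric.ball x (r x), ‖φ x‖ₑ ^ p
          ∂(Measure.euclideanHausdorffMeasure (N - 1)) := lintegral_mono_set hsub
    _ ≤ ∑ x₀ ∈ T, ∫⁻ x in frontier Ω ∩ Metric.ball x₀ (r x₀), ‖φ x‖ₑ ^ p
          ∂(Measure.euclideanHausdorffMeasure (N - 1)) := by
        rw [← Finset.sum_coe_sort T (fun x₀ => ∫⁻ x in frontier Ω ∩ Metric.ball x₀ (r x₀),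
          ‖φ x‖ₑ ^ p ∂(Measure.euclideanHausdorffMeasure (N - 1))), ← tsum_fintype (L := .unconditional _),
          show ⋃ x ∈ T, frontier Ω ∩ Metric.ball x (r x) =
            ⋃ x : T, frontier Ω ∩ Metric.ball x (r x) by ext; simp]
        exact lintegral_iUnion_le _ _
    _ ≤ ∑ x₀ ∈ T, C x₀ * ∫⁻ x in Ω, F φ x :=
        Finset.sum_le_sum fun x₀ hx₀ => hle x₀ (hT x₀ hx₀) φ hφ
    _ = _ := (Finset.sum_mul _ _ _).symm

/-- The surface measure of the boundary is finite. -/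
theorem IsC2Domain.isFiniteMeasure_surf {N : ℕ} (hN : 1 ≤ N) {Ω : Set (Euc N)}
    (hΩ : IsC2Domain Ω) : IsFiniteMeasure (surf Ω) := by
  obtain ⟨C, hC, h⟩ := hΩ.exists_trace_le hN one_lt_two
  refine ⟨?_⟩
  have h1 := h (fun _ => 1) contDiff_const
  simp only [fderiv_fun_const, Pi.zero_apply, enorm_one, ENNReal.one_rpow,
    lintegral_const, one_mul] at h1
  refine h1.trans_lt (ENNReal.mul_lt_top hC.lt_top (ENNReal.mul_lt_top ?_ ?_))
  · simp
  · rw [Measure.restrict_apply_univ]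
    exact hΩ.isBounded.measure_lt_top


/-! ### Convergence in `L^p` -/

theorem ofReal_exponent_ne_zero (p : ℝ) [hp : Fact (1 < p)] : ENNReal.ofReal p ≠ 0 := by
  simpa using zero_lt_one.trans hp.out

theorem toReal_exponent (p : ℝ) [hp : Fact (1 < p)] : (ENNReal.ofReal p).toReal = p :=
  ENNReal.toReal_ofReal (zero_lt_one.trans hp.out).le

theorem tendsto_Lp_of_lintegral {α E ι : Type*} [MeasurableSpace α] [NormedAddCommGroup E]
    {μ : Measure α} {p : ℝ} [hp : Fact (1 < p)] {l : Filter ι} {f : ι → Lp E (ENNReal.ofReal p) μ}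
    {f₀ : Lp E (ENNReal.ofReal p) μ}
    (h : Tendsto (fun n => ∫⁻ x, ‖f n x - f₀ x‖ₑ ^ p ∂μ) l (𝓝 0)) : Tendsto f l (𝓝 f₀) := by
  have hp0 : 0 < p := zero_lt_one.trans hp.out
  rw [Lp.tendsto_Lp_iff_tendsto_eLpNorm']
  simp only [eLpNorm_eq_lintegral_rpow_enorm_toReal (ofReal_exponent_ne_zero p)
    ENNReal.ofReal_ne_top, toReal_exponent]
  have h2 := (ENNReal.continuous_rpow_const (y := 1 / p)).tendsto _ |>.comp h
  simpa [ENNReal.zero_rpow_of_pos (inv_pos.2 hp0), Function.comp_def] using h2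

/-- Dominated convergence in `L^p`. -/
theorem tendsto_Lp_of_dominated {α E : Type*} [MeasurableSpace α] [NormedAddCommGroup E]
    {μ : Measure α} {p : ℝ} [hp : Fact (1 < p)] {f : ℕ → Lp E (ENNReal.ofReal p) μ}
    {f₀ : Lp E (ENNReal.ofReal p) μ} {g : α → ℝ} (hg : MemLp g (ENNReal.ofReal p) μ)
    (hb : ∀ n, ∀ᵐ x ∂μ, ‖f n x - f₀ x‖ ≤ g x)
    (hlim : ∀ᵐ x ∂μ, Tendsto (fun n => f n x) atTop (𝓝 (f₀ x))) :
    Tendsto f atTop (𝓝 f₀) := by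
  have hp0 : 0 < p := zero_lt_one.trans hp.out
  refine tendsto_Lp_of_lintegral ?_
  have h1 : Tendsto (fun n => ∫⁻ x, ‖f n x - f₀ x‖ₑ ^ p ∂μ) atTop
      (𝓝 (∫⁻ _, 0 ∂μ)) := by
    refine tendsto_lintegral_of_dominated_convergence' (fun x => ‖g x‖ₑ ^ p) ?_ ?_ ?_ ?_
    · intro n
      exact ((Lp.aestronglyMeasurable (f n)).sub (Lp.aestronglyMeasurable f₀)).enorm.pow_const p
    · intro n
      filter_upwards [hb n] with x hx
      refine ENNReal.rpow_le_rpow (enorm_le_iff_norm_le.2 ?_) hp0.le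
      exact hx.trans (le_abs_self _)
    · have := hg.eLpNorm_ne_top
      rw [eLpNorm_eq_lintegral_rpow_enorm_toReal (ofReal_exponent_ne_zero p)
        ENNReal.ofReal_ne_top, toReal_exponent] at this
      intro h
      rw [h, ENNReal.top_rpow_of_pos (by positivity)] at this
      exact this rfl
    · filter_upwards [hlim] with x hx
      have h2 : Tendsto (fun n => ‖f n x - f₀ x‖ₑ) atTop (𝓝 0) := by
        have := (hx.sub_const (f₀ x)).enorm
        simpa using this
      have h3 := (ENNReal.continuous_rpow_const (y := p)).tendsto 0 |>.comp h2
      rwa [ENNReal.zero_rpow_of_pos hp0] at h3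
  simpa using h1

theorem exists_subseq_tendsto_ae {α E : Type*} [MeasurableSpace α] [NormedAddCommGroup E]
    {μ : Measure α} {p : ℝ} [hp : Fact (1 < p)] {f : ℕ → Lp E (ENNReal.ofReal p) μ}
    {f₀ : Lp E (ENNReal.ofReal p) μ} (h : Tendsto f atTop (𝓝 f₀)) :
    ∃ ns : ℕ → ℕ, StrictMono ns ∧
      ∀ᵐ x ∂μ, Tendsto (fun n => f (ns n) x) atTop (𝓝 (f₀ x)) :=
  (tendstoInMeasure_of_tendsto_Lp h).exists_seq_tendsto_ae

theorem integral_norm_le_mul_norm {α E : Type*} [MeasurableSpace α] [NormedAddCommGroup E]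
    {μ : Measure α} [IsFiniteMeasure μ] {p : ℝ} [hp : Fact (1 < p)]
    (g : Lp E (ENNReal.ofReal p) μ) :
    ∫ x, ‖g x‖ ∂μ ≤ ‖g‖ * (μ univ ^ (1 - 1 / p)).toReal := by
  have hq : (1 : ℝ≥0∞) ≤ ENNReal.ofReal p := Fact.out
  have h1 := eLpNorm_le_eLpNorm_mul_rpow_measure_univ (μ := μ) hq (Lp.aestronglyMeasurable g)
  rw [toReal_exponent, ENNReal.toReal_one, div_one] at h1
  rw [integral_norm_eq_lintegral_enorm (Lp.aestronglyMeasurable g), ← eLpNorm_one_eq_lintegral_enorm,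
    Lp.norm_def, ← ENNReal.toReal_mul]
  refine ENNReal.toReal_mono (ENNReal.mul_ne_top (Lp.eLpNorm_ne_top g) ?_) h1
  refine ENNReal.rpow_ne_top_of_nonneg ?_ (measure_ne_top _ _)
  have := hp.out
  rw [sub_nonneg, div_le_one (by linarith)]
  exact this.le

/-- On a finite measure space, `L^p`-convergence implies convergence of the integrals against a
fixed bounded field. -/
theorem tendsto_integral_inner_of_tendsto_Lp {α E : Type*} [MeasurableSpace α]
    [NormedAddCommGroup E] [InnerProductSpace ℝ E] {μ : Measure α} [IsFiniteMeasure μ] {p : ℝ}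
    [hp : Fact (1 < p)] {f : ℕ → Lp E (ENNReal.ofReal p) μ} {f₀ : Lp E (ENNReal.ofReal p) μ}
    (h : Tendsto f atTop (𝓝 f₀)) {Ψ : α → E} (hΨ : AEStronglyMeasurable Ψ μ) {K : ℝ}
    (hK : ∀ x, ‖Ψ x‖ ≤ K) :
    Tendsto (fun n => ∫ x, inner ℝ (f n x) (Ψ x) ∂μ) atTop (𝓝 (∫ x, inner ℝ (f₀ x) (Ψ x) ∂μ)) := by
  have hint : ∀ g : Lp E (ENNReal.ofReal p) μ, Integrable (fun x => inner ℝ (g x) (Ψ x)) μ := by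
    intro g
    have h1 : Integrable g μ := (Lp.memLp g).integrable (Fact.out)
    refine (h1.norm.mul_const K).mono ((Lp.aestronglyMeasurable g).inner hΨ)
      (Eventually.of_forall fun x => ?_)
    have hK0 : 0 ≤ K := (norm_nonneg _).trans (hK x)
    rw [norm_mul, norm_norm, Real.norm_of_nonneg hK0]
    exact (norm_inner_le_norm _ _).trans (by gcongr; exact hK x)
  rw [tendsto_iff_norm_sub_tendsto_zero] at h ⊢
  have hlim := (h.mul_const (μ univ ^ (1 - 1 / p)).toReal).const_mul |K|
  rw [zero_mul, mul_zero] at hlim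
  refine squeeze_zero (fun _ => norm_nonneg _) (fun n => ?_) hlim
  rw [← integral_sub (hint _) (hint _)]
  calc _ ≤ ∫ x, |K| * ‖(f n - f₀) x‖ ∂μ := by
        refine norm_integral_le_of_norm_le
          (((Lp.memLp (f n - f₀)).integrable Fact.out).norm.const_mul _) ?_
        filter_upwards [Lp.coeFn_sub (f n) f₀] with x hx
        rw [hx, Pi.sub_apply, ← inner_sub_left, mul_comm]
        refine (norm_inner_le_norm _ _).trans ?_
        gcongr
        exact (hK x).trans (le_abs_self _)
    _ = |K| * ∫ x, ‖(f n - f₀) x‖ ∂μ := integral_const_mul _ _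
    _ ≤ _ := by gcongr; exact integral_norm_le_mul_norm _

/-! ### The space `W^{1,p}` -/

section

variable {N : ℕ} {Ω : Set (Euc N)} {p : ℝ} [hp : Fact (1 < p)]

theorem IsWeakGradient.congr {u u' : Euc N → ℝ} {G G' : Euc N → Euc N}
    (h : IsWeakGradient Ω u G) (hu : u =ᵐ[volume.restrict Ω] u')
    (hG : G =ᵐ[volume.restrict Ω] G') : IsWeakGradient Ω u' G' := by
  intro φ hφ hc hs e
  have h1 : (fun x => u x * fderiv ℝ φ x e) =ᵐ[volume.restrict Ω]
      fun x => u' x * fderiv ℝ φ x e := by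
    filter_upwards [hu] with x hx
    rw [hx]
  have h2 : (fun x => inner ℝ (G x) e * φ x) =ᵐ[volume.restrict Ω]
      fun x => inner ℝ (G' x) e * φ x := by
    filter_upwards [hG] with x hx
    rw [hx]
  rw [← integral_congr_ae h1, ← integral_congr_ae h2]
  exact h φ hφ hc hs e

/-- The element of `W^{1,p}(Ω)` given by a function and its weak gradient. -/
noncomputable def W1.mk (u : Euc N → ℝ) (G : Euc N → Euc N)
    (hu : MemLp u (ENNReal.ofReal p) (volume.restrict Ω))
    (hG : MemLp G (ENNReal.ofReal p) (volume.restrict Ω)) (h : IsWeakGradient Ω u G) : W1 Ω p :=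
  ⟨WithLp.toLp _ (hu.toLp u, hG.toLp G), h.congr hu.coeFn_toLp.symm hG.coeFn_toLp.symm⟩

theorem W1.fn_mk {u : Euc N → ℝ} {G : Euc N → Euc N}
    (hu : MemLp u (ENNReal.ofReal p) (volume.restrict Ω))
    (hG : MemLp G (ENNReal.ofReal p) (volume.restrict Ω)) (h : IsWeakGradient Ω u G) :
    (W1.mk u G hu hG h).fn =ᵐ[volume.restrict Ω] u := hu.coeFn_toLp

theorem W1.grad_mk {u : Euc N → ℝ} {G : Euc N → Euc N}
    (hu : MemLp u (ENNReal.ofReal p) (volume.restrict Ω))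
    (hG : MemLp G (ENNReal.ofReal p) (volume.restrict Ω)) (h : IsWeakGradient Ω u G) :
    (W1.mk u G hu hG h).grad =ᵐ[volume.restrict Ω] G := hG.coeFn_toLp

theorem W1.memLp_fn (u : W1 Ω p) : MemLp u.fn (ENNReal.ofReal p) (volume.restrict Ω) :=
  Lp.memLp _

theorem W1.memLp_grad (u : W1 Ω p) : MemLp u.grad (ENNReal.ofReal p) (volume.restrict Ω) :=
  Lp.memLp _

theorem W1.isWeakGradient (u : W1 Ω p) : IsWeakGradient Ω u.fn u.grad := u.2

theorem W1.fn_add (u v : W1 Ω p) : (u + v).fn =ᵐ[volume.restrict Ω] u.fn + v.fn :=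
  Lp.coeFn_add _ _

theorem W1.fn_sub (u v : W1 Ω p) : (u - v).fn =ᵐ[volume.restrict Ω] u.fn - v.fn :=
  Lp.coeFn_sub _ _

theorem W1.grad_sub (u v : W1 Ω p) : (u - v).grad =ᵐ[volume.restrict Ω] u.grad - v.grad :=
  Lp.coeFn_sub _ _

theorem W1.fn_neg (u : W1 Ω p) : (-u).fn =ᵐ[volume.restrict Ω] -u.fn := Lp.coeFn_neg _

theorem W1.grad_neg (u : W1 Ω p) : (-u).grad =ᵐ[volume.restrict Ω] -u.grad := Lp.coeFn_neg _

theorem W1.fn_zero : (0 : W1 Ω p).fn =ᵐ[volume.restrict Ω] 0 := Lp.coeFn_zero _ _ _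

theorem W1.grad_zero : (0 : W1 Ω p).grad =ᵐ[volume.restrict Ω] 0 := Lp.coeFn_zero _ _ _

theorem integrable_rpow_norm {α E : Type*} [MeasurableSpace α] [NormedAddCommGroup E]
    {μ : Measure α} {f : α → E} (hf : MemLp f (ENNReal.ofReal p) μ) :
    Integrable (fun x => ‖f x‖ ^ p) μ := by
  have := hf.integrable_norm_rpow (ofReal_exponent_ne_zero p) ENNReal.ofReal_ne_top
  rwa [toReal_exponent] at this

theorem Lp_norm_rpow {α E : Type*} [MeasurableSpace α] [NormedAddCommGroup E]
    {μ : Measure α} (f : Lp E (ENNReal.ofReal p) μ) : ‖f‖ ^ p = ∫ x, ‖f x‖ ^ p ∂μ := by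
  have hp0 : 0 < p := zero_lt_one.trans hp.out
  have h0 : 0 ≤ ∫ x, ‖f x‖ ^ p ∂μ := integral_nonneg fun x => by positivity
  rw [Lp.norm_def, (Lp.memLp f).eLpNorm_eq_integral_rpow_norm (ofReal_exponent_ne_zero p)
    ENNReal.ofReal_ne_top, toReal_exponent p, ENNReal.toReal_ofReal (by positivity),
    ← Real.rpow_mul h0, inv_mul_cancel₀ hp0.ne', Real.rpow_one]

theorem W1.norm_rpow (u : W1 Ω p) :
    ‖u‖ ^ p = (∫ x in Ω, ‖u.grad x‖ ^ p) + ∫ x in Ω, |u.fn x| ^ p := by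
  have hp0 : 0 < p := zero_lt_one.trans hp.out
  have h1 : ‖u‖ = (‖u.1.fst‖ ^ p + ‖u.1.snd‖ ^ p) ^ (1 / p) := by
    have := WithLp.prod_norm_eq_add (p := ENNReal.ofReal p) (by rwa [toReal_exponent]) u.1
    rw [toReal_exponent] at this
    exact this
  rw [h1, ← Real.rpow_mul (by positivity), one_div_mul_cancel hp0.ne', Real.rpow_one,
    Lp_norm_rpow, Lp_norm_rpow, add_comm]
  rfl

/-- The weak gradient is determined by the function. -/
theorem W1.ext_fn (hΩ : IsOpen Ω) {u v : W1 Ω p} (h : u.fn =ᵐ[volume.restrict Ω] v.fn) :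
    u = v := by
  have hfn : (u - v).fn =ᵐ[volume.restrict Ω] 0 := by
    filter_upwards [W1.fn_sub u v, h] with x hx hx'
    rw [hx, Pi.sub_apply, hx', sub_self, Pi.zero_apply]
  -- the weak gradient of `u - v = 0` is annihilated by all test functions
  have hgrad : (u - v).grad =ᵐ[volume.restrict Ω] 0 := by
    have hl : LocallyIntegrable (u - v).grad (volume.restrict Ω) :=
      ((u - v).memLp_grad).locallyIntegrable Fact.out
    refine (ae_restrict_iff' hΩ.measurableSet).2
      (hΩ.ae_eq_zero_of_integral_contDiff_smul_eq_zero
        (locallyIntegrableOn_of_locallyIntegrable_restrict hl) fun φ hφ hc hs => ?_)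
    have hint : Integrable (fun x => φ x • (u - v).grad x) (volume.restrict Ω) :=
      hl.integrable_smul_left_of_hasCompactSupport hφ.continuous hc
    have hzero : ∫ x in Ω, φ x • (u - v).grad x = 0 := by
      refine ext_inner_left ℝ fun e => ?_
      rw [← integral_inner hint, inner_zero_right]
      have h1 := (u - v).isWeakGradient φ hφ hc hs e
      have h2 : ∫ x in Ω, (u - v).fn x * fderiv ℝ φ x e = 0 := by
        rw [integral_congr_ae (g := fun _ => 0), integral_zero]
        filter_upwards [hfn] with x hx
        simp [hx]
      rw [h2, eq_comm, neg_eq_zero] at h1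
      rw [← h1]
      refine integral_congr_ae (Eventually.of_forall fun x => ?_)
      simp only [inner_smul_right, real_inner_comm e]
      ring
    rw [← hzero, ← setIntegral_eq_integral_of_forall_compl_eq_zero (s := Ω)]
    intro x hx
    rw [image_eq_zero_of_notMem_tsupport fun h => hx (hs h), zero_smul]
  rw [← sub_eq_zero]
  refine Subtype.ext ?_
  refine (WithLp.ofLp_injective _) (Prod.ext ?_ ?_)
  · exact Lp.ext (hfn.trans (Lp.coeFn_zero _ _ _).symm)
  · exact Lp.ext (hgrad.trans (Lp.coeFn_zero _ _ _).symm)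

/-- Weak gradients pass to the limit in `L^p`. -/
theorem isWeakGradient_of_tendsto (hΩ : Bornology.IsBounded Ω) {u : ℕ → W1 Ω p}
    {f : Lp ℝ (ENNReal.ofReal p) (volume.restrict Ω)}
    {G : Lp (Euc N) (ENNReal.ofReal p) (volume.restrict Ω)}
    (hf : Tendsto (fun n => (u n).1.fst) atTop (𝓝 f))
    (hG : Tendsto (fun n => (u n).1.snd) atTop (𝓝 G)) : IsWeakGradient Ω f G := by
  have hfin : IsFiniteMeasure (volume.restrict Ω) :=
    ⟨by rw [Measure.restrict_apply_univ]; exact hΩ.measure_lt_top⟩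
  intro φ hφ hc hs e
  have hd : Continuous (fun x => fderiv ℝ φ x e) :=
    (hφ.continuous_fderiv (by simp)).clm_apply continuous_const
  obtain ⟨K₁, hK₁⟩ := (hc.fderiv_apply ℝ e).exists_bound_of_continuous hd
  have h2c : Continuous (fun x => φ x • e) := by fun_prop
  obtain ⟨K₂, hK₂⟩ := (hc.smul_right (f' := fun _ => e)).exists_bound_of_continuous h2c
  have h1 := tendsto_integral_inner_of_tendsto_Lp hf hd.aestronglyMeasurable hK₁
  have h2 := tendsto_integral_inner_of_tendsto_Lp hG h2c.aestronglyMeasurable hK₂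
  have e1 : ∀ a b : ℝ, inner ℝ a b = a * b := fun a b => by simp [mul_comm]
  simp only [e1] at h1
  simp only [inner_smul_right, mul_comm (φ _)] at h2
  refine tendsto_nhds_unique h1 (h2.neg.congr fun n => ?_)
  exact ((u n).2 φ hφ hc hs e).symm

theorem W1.tendsto_iff {ι : Type*} {l : Filter ι} {u : ι → W1 Ω p} {u₀ : W1 Ω p} :
    Tendsto u l (𝓝 u₀) ↔ Tendsto (fun n => (u n).1.fst) l (𝓝 u₀.1.fst) ∧
      Tendsto (fun n => (u n).1.snd) l (𝓝 u₀.1.snd) := by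
  rw [tendsto_subtype_rng]
  constructor
  · intro h
    have := (WithLp.prod_continuous_ofLp (ENNReal.ofReal p) _ _).tendsto _ |>.comp h
    exact ⟨(continuous_fst.tendsto _).comp this, (continuous_snd.tendsto _).comp this⟩
  · rintro ⟨h1, h2⟩
    exact (WithLp.prod_continuous_toLp (ENNReal.ofReal p) _ _).tendsto _ |>.comp
      (h1.prodMk_nhds h2)

theorem W1.tendsto_fst {ι : Type*} {l : Filter ι} {u : ι → W1 Ω p} {u₀ : W1 Ω p}
    (h : Tendsto u l (𝓝 u₀)) : Tendsto (fun n => (u n).1.fst) l (𝓝 u₀.1.fst) :=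
  (W1.tendsto_iff.1 h).1

theorem W1.tendsto_snd {ι : Type*} {l : Filter ι} {u : ι → W1 Ω p} {u₀ : W1 Ω p}
    (h : Tendsto u l (𝓝 u₀)) : Tendsto (fun n => (u n).1.snd) l (𝓝 u₀.1.snd) :=
  (W1.tendsto_iff.1 h).2

end


/-! ### Functions of class `C¹` and multiplication by cut-off functions -/

section

variable {N : ℕ} {Ω : Set (Euc N)} {p : ℝ} [hp : Fact (1 < p)]

theorem isFiniteMeasure_restrict_of_isBounded (hΩ : Bornology.IsBounded Ω) :
    IsFiniteMeasure ((volume : Measure (Euc N)).restrict Ω) :=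
  ⟨by rw [Measure.restrict_apply_univ]; exact hΩ.measure_lt_top⟩

theorem isWeakGradient_of_contDiff {φ : Euc N → ℝ} (hφ : ContDiff ℝ 1 φ) :
    IsWeakGradient Ω φ (gradient φ) := by
  intro ψ hψ hc hs e
  have hψ1 : ContDiff ℝ 1 ψ := hψ.of_le (by simp)
  have hdφ : Continuous (fun x => fderiv ℝ φ x e) :=
    (hφ.continuous_fderiv one_ne_zero).clm_apply continuous_const
  have hdψ : Continuous (fun x => fderiv ℝ ψ x e) :=
    (hψ1.continuous_fderiv one_ne_zero).clm_apply continuous_const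
  rw [setIntegral_eq_integral_of_forall_compl_eq_zero,
    setIntegral_eq_integral_of_forall_compl_eq_zero]
  · rw [integral_mul_fderiv_eq_neg_fderiv_mul_of_integrable]
    · simp only [inner_gradient_left]
    · exact (hdφ.mul hψ.continuous).integrable_of_hasCompactSupport hc.mul_left
    · exact (hφ.continuous.mul hdψ).integrable_of_hasCompactSupport
        (hc.fderiv_apply ℝ e).mul_left
    · exact (hφ.continuous.mul hψ.continuous).integrable_of_hasCompactSupport hc.mul_left
    · exact fun x _ => hφ.differentiable one_ne_zero x
    · exact fun x _ => hψ1.differentiable one_ne_zero x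
  · intro x hx
    rw [image_eq_zero_of_notMem_tsupport fun h => hx (hs h), mul_zero]
  · intro x hx
    have : fderiv ℝ ψ x = 0 := by
      by_contra h
      exact hx (hs (support_fderiv_subset ℝ h))
    rw [this, zero_apply, mul_zero]

theorem exists_bound_of_continuous_of_isBounded {E : Type*} [NormedAddCommGroup E]
    (hΩ : Bornology.IsBounded Ω) {f : Euc N → E} (hf : Continuous f) :
    ∃ C, ∀ x ∈ closure Ω, ‖f x‖ ≤ C :=
  (Metric.isCompact_of_isClosed_isBounded isClosed_closure hΩ.closure).exists_bound_of_continuousOn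
    hf.continuousOn

theorem memLp_restrict_of_continuous {E : Type*} [NormedAddCommGroup E]
    [SecondCountableTopologyEither (Euc N) E] (hΩ : Bornology.IsBounded Ω) {μ : Measure (Euc N)}
    [IsFiniteMeasure μ] (hμ : ∀ᵐ x ∂μ, x ∈ closure Ω) {f : Euc N → E}
    (hf : Continuous f) {q : ℝ≥0∞} : MemLp f q μ := by
  obtain ⟨C, hC⟩ := exists_bound_of_continuous_of_isBounded hΩ hf
  exact MemLp.of_bound hf.aestronglyMeasurable C (hμ.mono hC)

theorem ae_restrict_mem_closure (hΩ : IsOpen Ω) :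
    ∀ᵐ x ∂(volume : Measure (Euc N)).restrict Ω, x ∈ closure Ω :=
  (ae_restrict_mem hΩ.measurableSet).mono fun _ hx => subset_closure hx

theorem continuous_gradient {φ : Euc N → ℝ} (hφ : ContDiff ℝ 1 φ) : Continuous (gradient φ) :=
  (InnerProductSpace.toDual ℝ (Euc N)).symm.continuous.comp (hφ.continuous_fderiv one_ne_zero)

theorem norm_gradient (φ : Euc N → ℝ) (x : Euc N) : ‖gradient φ x‖ = ‖fderiv ℝ φ x‖ :=
  LinearIsometryEquiv.norm_map _ _

/-- On a bounded open set, a function of class `C¹` on the whole space belongs to `W^{1,p}`. -/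
theorem W1.exists_of_contDiff (hΩ : IsOpen Ω) (hb : Bornology.IsBounded Ω) {φ : Euc N → ℝ}
    (hφ : ContDiff ℝ 1 φ) :
    ∃ u : W1 Ω p, u.fn =ᵐ[volume.restrict Ω] φ ∧ u.grad =ᵐ[volume.restrict Ω] gradient φ := by
  have := isFiniteMeasure_restrict_of_isBounded hb
  exact ⟨W1.mk φ (gradient φ)
    (memLp_restrict_of_continuous hb (ae_restrict_mem_closure hΩ) hφ.continuous)
    (memLp_restrict_of_continuous hb (ae_restrict_mem_closure hΩ) (continuous_gradient hφ))
    (isWeakGradient_of_contDiff hφ), W1.fn_mk _ _ _, W1.grad_mk _ _ _⟩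

theorem W1.grad_ae_eq_of_contDiff (hΩ : IsOpen Ω) (hb : Bornology.IsBounded Ω) {φ : Euc N → ℝ}
    (hφ : ContDiff ℝ 1 φ) {u : W1 Ω p} (hu : u.fn =ᵐ[volume.restrict Ω] φ) :
    u.grad =ᵐ[volume.restrict Ω] gradient φ := by
  obtain ⟨v, hv, hv'⟩ := W1.exists_of_contDiff (p := p) hΩ hb hφ
  rwa [W1.ext_fn hΩ (hu.trans hv.symm)]

/-- The product rule for the product of a Sobolev function with a smooth cut-off function. -/
theorem W1.exists_mul_smooth {η : Euc N → ℝ} (hη : ContDiff ℝ ∞ η)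
    (hηc : HasCompactSupport η) (u : W1 Ω p) :
    ∃ v : W1 Ω p, v.fn =ᵐ[volume.restrict Ω] (fun x => η x * u.fn x) ∧
      v.grad =ᵐ[volume.restrict Ω] (fun x => η x • u.grad x + u.fn x • gradient η x) := by
  have hη1 : ContDiff ℝ 1 η := hη.of_le (by simp)
  obtain ⟨C₁, hC₁⟩ := hηc.exists_bound_of_continuous hη.continuous
  have hgc : HasCompactSupport (gradient η) := by
    refine (hηc.fderiv (𝕜 := ℝ)).mono' fun x hx => subset_tsupport _ fun h => hx ?_
    simp [gradient, h]
  obtain ⟨C₂, hC₂⟩ := hgc.exists_bound_of_continuous (continuous_gradient hη1)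
  have hm1 : MemLp (fun x => η x * u.fn x) (ENNReal.ofReal p) (volume.restrict Ω) :=
    MemLp.of_le_mul u.memLp_fn (hη.continuous.aestronglyMeasurable.mul u.memLp_fn.1)
      (Eventually.of_forall fun x => by rw [norm_mul]; gcongr; exact hC₁ x)
  have hm2 : MemLp (fun x => η x • u.grad x + u.fn x • gradient η x) (ENNReal.ofReal p)
      (volume.restrict Ω) := by
    refine MemLp.add ?_ ?_
    · exact MemLp.of_le_mul u.memLp_grad (hη.continuous.aestronglyMeasurable.smul u.memLp_grad.1)
        (Eventually.of_forall fun x => by rw [norm_smul]; gcongr; exact hC₁ x)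
    · exact MemLp.of_le_mul u.memLp_fn
        (u.memLp_fn.1.smul (continuous_gradient hη1).aestronglyMeasurable)
        (Eventually.of_forall fun x => by rw [norm_smul, mul_comm]; gcongr; exact hC₂ x)
  refine ⟨W1.mk _ _ hm1 hm2 fun φ hφ hc hs e => ?_, W1.fn_mk _ _ _, W1.grad_mk _ _ _⟩
  -- use `η φ` as a test function for `u`
  have hηφ : ContDiff ℝ ∞ (fun x => η x * φ x) := hη.mul hφ
  have hηφc : HasCompactSupport (fun x => η x * φ x) := hc.mul_left
  have h1 := u.isWeakGradient _ hηφ hηφc ((tsupport_mul_subset_right).trans hs) e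
  have hd : ∀ x, fderiv ℝ (fun x => η x * φ x) x e =
      η x * fderiv ℝ φ x e + φ x * fderiv ℝ η x e := fun x => by
    rw [fderiv_fun_mul (hη1.differentiable one_ne_zero x)
      (hφ.differentiable (by simp) x)]
    simp
  have hψ : Continuous (fun x => φ x • gradient η x) :=
    hφ.continuous.smul (continuous_gradient hη1)
  have hl : LocallyIntegrable u.fn (volume.restrict Ω) := u.memLp_fn.locallyIntegrable Fact.out
  have i1 : Integrable (fun x => u.fn x * (η x * fderiv ℝ φ x e)) (volume.restrict Ω) := by
    have := hl.integrable_smul_left_of_hasCompactSupport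
      (hη.continuous.mul ((hφ.continuous_fderiv (by simp)).clm_apply continuous_const))
      ((hc.fderiv_apply ℝ e).mul_left (f := η))
    simpa [mul_comm] using this
  have i2 : Integrable (fun x => u.fn x * (φ x * fderiv ℝ η x e)) (volume.restrict Ω) := by
    have := hl.integrable_smul_left_of_hasCompactSupport
      (hφ.continuous.mul ((hη.continuous_fderiv (by simp)).clm_apply continuous_const))
      ((hηc.fderiv_apply ℝ e).mul_left (f := φ))
    simpa [mul_comm] using this
  have i3 : Integrable (fun x => inner ℝ (u.grad x) e * (η x * φ x)) (volume.restrict Ω) :=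
    integrable_inner_mul u.1.snd hηφ hηφc e
  simp only [hd, mul_add] at h1
  rw [integral_add i1 i2] at h1
  have e1 : ∫ x in Ω, η x * u.fn x * fderiv ℝ φ x e =
      ∫ x in Ω, u.fn x * (η x * fderiv ℝ φ x e) := by
    refine integral_congr_ae (Eventually.of_forall fun x => ?_)
    simp only
    ring
  have e2 : ∫ x in Ω, inner ℝ (η x • u.grad x + u.fn x • gradient η x) e * φ x =
      (∫ x in Ω, inner ℝ (u.grad x) e * (η x * φ x)) +
        ∫ x in Ω, u.fn x * (φ x * fderiv ℝ η x e) := by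
    rw [← integral_add i3 i2]
    refine integral_congr_ae (Eventually.of_forall fun x => ?_)
    simp only [inner_add_left, real_inner_smul_left, inner_gradient_left]
    ring
  rw [e1, e2]
  linarith

end

/-! ### Mollification -/

open scoped Convolution

/-- The `L^p`-distance between a function and its average against a probability density `k` is at
most the largest `L^p`-distance to its translates by vectors in the support of `k`. -/
theorem lintegral_convolution_sub_le {N : ℕ} {E : Type*} [NormedAddCommGroup E] [NormedSpace ℝ E]
    [CompleteSpace E] {p : ℝ} [hp : Fact (1 < p)] {f : Euc N → E} (hf : StronglyMeasurable f)
    (hfp : MemLp f (ENNReal.ofReal p) volume) {k : Euc N → ℝ} (hk : Continuous k)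
    (hkc : HasCompactSupport k) (hk0 : ∀ x, 0 ≤ k x) (hk1 : ∫ x, k x = 1) {δ : ℝ≥0∞}
    (hδ : ∀ t ∈ Function.support k, ∫⁻ x, ‖f (x - t) - f x‖ₑ ^ p ≤ δ) :
    ∫⁻ x, ‖(k ⋆[ContinuousLinearMap.lsmul ℝ ℝ, volume] f) x - f x‖ₑ ^ p ≤ δ := by
  have hloc : LocallyIntegrable f volume := hfp.locallyIntegrable Fact.out
  have hkm : Measurable (fun t => ENNReal.ofReal (k t)) := hk.measurable.ennreal_ofReal
  -- Jensen's inequality for the probability measure `κ` with density `k`, then Fubini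
  set κ : Measure (Euc N) := volume.withDensity fun t => ENNReal.ofReal (k t) with hκ
  have hκ1 : κ univ = 1 := by
    rw [hκ, withDensity_apply _ MeasurableSet.univ, Measure.restrict_univ,
      ← ofReal_integral_eq_lintegral_ofReal (hk.integrable_of_hasCompactSupport hkc)
        (Eventually.of_forall hk0), hk1, ENNReal.ofReal_one]
  have hmeas : StronglyMeasurable (fun q : Euc N × Euc N => f (q.1 - q.2) - f q.1) :=
    (hf.comp_measurable (measurable_fst.sub measurable_snd)).sub (hf.comp_measurable measurable_fst)
  have hpt : ∀ x, ‖(k ⋆[ContinuousLinearMap.lsmul ℝ ℝ, volume] f) x - f x‖ₑ ^ p ≤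
      ∫⁻ t, ‖f (x - t) - f x‖ₑ ^ p ∂κ := by
    intro x
    have hi1 : Integrable (fun t => k t • f (x - t)) :=
      hkc.convolutionExists_left (ContinuousLinearMap.lsmul ℝ ℝ) hk hloc x
    have hi2 : Integrable (fun t => k t • f x) :=
      (hk.integrable_of_hasCompactSupport hkc).smul_const _
    have h1 : (k ⋆[ContinuousLinearMap.lsmul ℝ ℝ, volume] f) x - f x =
        ∫ t, k t • (f (x - t) - f x) := by
      simp only [smul_sub]
      rw [integral_sub hi1 hi2, integral_smul_const, hk1, one_smul]
      rfl
    have hm : Measurable fun t => ‖f (x - t) - f x‖ₑ :=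
      (hmeas.comp_measurable (measurable_const.prodMk measurable_id)).enorm
    have h2 : ‖(k ⋆[ContinuousLinearMap.lsmul ℝ ℝ, volume] f) x - f x‖ₑ ≤
        ∫⁻ t, ‖f (x - t) - f x‖ₑ ∂κ := by
      rw [h1, hκ, lintegral_withDensity_eq_lintegral_mul _ hkm hm]
      refine (enorm_integral_le_lintegral_enorm _).trans (lintegral_mono fun t => ?_)
      rw [enorm_smul, Pi.mul_apply, Real.enorm_of_nonneg (hk0 t)]
    refine (ENNReal.rpow_le_rpow h2 (zero_lt_one.trans hp.out).le).trans ?_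
    have h3 := lintegral_rpow_le (μ := κ) hp.out hm.aemeasurable
    rwa [hκ1, ENNReal.one_rpow, one_mul] at h3
  have hm2 : Measurable fun q : Euc N × Euc N => ‖f (q.1 - q.2) - f q.1‖ₑ ^ p :=
    hmeas.enorm.pow_const p
  have : SFinite κ := by rw [hκ]; infer_instance
  calc _ ≤ ∫⁻ x, ∫⁻ t, ‖f (x - t) - f x‖ₑ ^ p ∂κ ∂volume := lintegral_mono hpt
    _ = ∫⁻ t, ∫⁻ x, ‖f (x - t) - f x‖ₑ ^ p ∂volume ∂κ := lintegral_lintegral_swap hm2.aemeasurable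
    _ ≤ ∫⁻ _, δ ∂κ := by
        refine lintegral_mono_ae ?_
        rw [hκ, ae_withDensity_iff hkm]
        refine Eventually.of_forall fun t ht => hδ t fun h => ht ?_
        rw [h, ENNReal.ofReal_zero]
    _ = δ := by rw [lintegral_const, hκ1, mul_one]

/-- Translation is continuous in `L^p`. -/
theorem tendsto_lintegral_translate {N : ℕ} {E : Type*} [NormedAddCommGroup E] [NormedSpace ℝ E]
    {p : ℝ} [hp : Fact (1 < p)] {f : Euc N → E} (hfp : MemLp f (ENNReal.ofReal p) volume) :
    Tendsto (fun t => ∫⁻ x, ‖f (x - t) - f x‖ₑ ^ p) (𝓝 0) (𝓝 0) := by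
  have hp0 : 0 < p := zero_lt_one.trans hp.out
  let T : Euc N → C(Euc N, Euc N) := fun t => ⟨fun x => x - t, by fun_prop⟩
  have hTc : Continuous T :=
    (ContinuousMap.mk (fun a : Euc N × Euc N => a.2 - a.1) (by fun_prop)).curry.continuous
  have hTm : ∀ t, MeasurePreserving (T t) volume volume := fun t =>
    measurePreserving_sub_right volume t
  have h := (continuous_const (y := hfp.toLp f)).compMeasurePreservingLp hTc hTm
    ENNReal.ofReal_ne_top
  have h0 := h.tendsto 0
  rw [Lp.tendsto_Lp_iff_tendsto_eLpNorm'] at h0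
  have h1 := (ENNReal.continuous_rpow_const (y := p)).tendsto 0 |>.comp h0
  rw [ENNReal.zero_rpow_of_pos hp0] at h1
  refine h1.congr fun t => ?_
  rw [Function.comp_apply, eLpNorm_eq_lintegral_rpow_enorm_toReal (ofReal_exponent_ne_zero p)
    ENNReal.ofReal_ne_top, toReal_exponent, ← ENNReal.rpow_mul, one_div_mul_cancel hp0.ne',
    ENNReal.rpow_one]
  refine lintegral_congr_ae ?_
  have e0 : ∀ t, Lp.compMeasurePreserving (T t) (hTm t) (hfp.toLp f) =ᵐ[volume]
      fun x => f (x - t) := fun t =>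
    (Lp.coeFn_compMeasurePreserving _ (hTm t)).trans
      ((hTm t).quasiMeasurePreserving.ae_eq hfp.coeFn_toLp)
  filter_upwards [e0 t, e0 0] with x hx hx0
  rw [Pi.sub_apply, hx, hx0, sub_zero]


/-! ### Density of functions of class `C¹` -/

section

variable {N : ℕ} {Ω : Set (Euc N)} {p : ℝ} [hp : Fact (1 < p)]

/-- The elements of `W^{1,p}(Ω)` that have a representative of class `C¹` on the whole space. -/
noncomputable def W1.classical (Ω : Set (Euc N)) (p : ℝ) [hp : Fact (1 < p)] :
    Submodule ℝ (W1 Ω p) where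
  carrier := {u | ∃ φ : Euc N → ℝ, ContDiff ℝ 1 φ ∧ u.fn =ᵐ[volume.restrict Ω] φ}
  zero_mem' := ⟨0, contDiff_const, W1.fn_zero⟩
  add_mem' := by
    rintro u v ⟨φ, hφ, hu⟩ ⟨ψ, hψ, hv⟩
    exact ⟨φ + ψ, hφ.add hψ, (W1.fn_add u v).trans (hu.add hv)⟩
  smul_mem' := by
    rintro c u ⟨φ, hφ, hu⟩
    exact ⟨c • φ, hφ.const_smul c, (Lp.coeFn_smul c u.1.fst).trans (hu.const_smul c)⟩

theorem fderiv_convolution_apply {f : Euc N → ℝ} (hfp : LocallyIntegrable f volume)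
    {k : Euc N → ℝ} (hk : ContDiff ℝ 1 k) (hkc : HasCompactSupport k) (x e : Euc N) :
    fderiv ℝ (k ⋆[ContinuousLinearMap.lsmul ℝ ℝ, volume] f) x e =
      ∫ y, f y * fderiv ℝ k (x - y) e := by
  set L : ℝ →L[ℝ] ℝ →L[ℝ] ℝ := ContinuousLinearMap.lsmul ℝ ℝ with hL
  have hi : Integrable (fun t => L.precompL (Euc N) (fderiv ℝ k t) (f (x - t))) :=
    (hkc.fderiv (𝕜 := ℝ)).convolutionExists_left (L.precompL (Euc N))
      (hk.continuous_fderiv one_ne_zero) hfp x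
  rw [(hkc.hasFDerivAt_convolution_left L hk hfp x).fderiv, convolution,
    ContinuousLinearMap.integral_apply hi, ← integral_sub_left_eq_self _ volume x]
  refine integral_congr_ae (Eventually.of_forall fun y => ?_)
  simp [ContinuousLinearMap.precompL_apply, hL, mul_comm]

/-- Mollification with a kernel `k` commutes with the weak gradient at the points `x` for which the
set `x - tsupport k`, over which the average is taken, lies in `Ω` or misses the support of the
function and of its gradient. The function and its gradient are extended by zero outside `Ω`. -/
theorem gradient_convolution_eq {v : W1 Ω p} {f : Euc N → ℝ} {G : Euc N → Euc N}
    (hf : f =ᵐ[volume.restrict Ω] v.fn) (hG : G =ᵐ[volume.restrict Ω] v.grad)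
    (hfp : LocallyIntegrable f volume) (hGp : LocallyIntegrable G volume)
    (hf0 : ∀ x ∉ Ω, f x = 0) (hG0 : ∀ x ∉ Ω, G x = 0) {k : Euc N → ℝ} (hk : ContDiff ℝ ∞ k)
    (hkc : HasCompactSupport k) {x : Euc N}
    (hx : (∀ y, x - y ∈ tsupport k → y ∈ Ω) ∨ ∀ y, x - y ∈ tsupport k → f y = 0 ∧ G y = 0) :
    gradient (k ⋆[ContinuousLinearMap.lsmul ℝ ℝ, volume] f) x =
      (k ⋆[ContinuousLinearMap.lsmul ℝ ℝ, volume] G) x := by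
  have hk1 : ContDiff ℝ 1 k := hk.of_le (by simp)
  refine ext_inner_right ℝ fun e => ?_
  rw [inner_gradient_left, fderiv_convolution_apply hfp hk1 hkc]
  -- both sides become integrals over `y = x - t`
  have hR : inner ℝ ((k ⋆[ContinuousLinearMap.lsmul ℝ ℝ, volume] G) x) e =
      ∫ y, inner ℝ (G y) e * k (x - y) := by
    have hi : Integrable (fun t => k t • G (x - t)) :=
      hkc.convolutionExists_left (ContinuousLinearMap.lsmul ℝ ℝ) hk.continuous hGp x
    rw [real_inner_comm, convolution]
    simp only [ContinuousLinearMap.lsmul_apply]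
    rw [← integral_inner hi, ← integral_sub_left_eq_self _ volume x]
    refine integral_congr_ae (Eventually.of_forall fun y => ?_)
    simp [inner_smul_right, mul_comm, real_inner_comm]
  rw [hR]
  rcases hx with hx | hx
  · -- here `k (x - ·)` is an admissible test function
    set ψ : Euc N → ℝ := fun y => k (x - y) with hψ
    have hψs : ContDiff ℝ ∞ ψ := hk.comp (contDiff_const.sub contDiff_id)
    have hψc : HasCompactSupport ψ :=
      hkc.comp_homeomorph (Homeomorph.subLeft x)
    have hsub : tsupport ψ ⊆ (fun y => x - y) ⁻¹' tsupport k :=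
      closure_minimal (fun y hy => subset_tsupport _ hy)
        ((isClosed_tsupport k).preimage (by fun_prop))
    have hd : ∀ y, fderiv ℝ ψ y e = -fderiv ℝ k (x - y) e := fun y => by
      have h1 : HasFDerivAt (fun y : Euc N => x - y) (-ContinuousLinearMap.id ℝ (Euc N)) y :=
        (hasFDerivAt_id y).const_sub x
      have h2 := ((hk1.differentiable one_ne_zero (x - y)).hasFDerivAt).comp y h1
      rw [show fderiv ℝ ψ y = _ from h2.fderiv]
      simp
    have hw := v.isWeakGradient ψ hψs hψc (hsub.trans hx) e
    simp only [hd, mul_neg, integral_neg, neg_inj] at hw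
    have e1 : ∫ y, f y * fderiv ℝ k (x - y) e = ∫ y in Ω, v.fn y * fderiv ℝ k (x - y) e := by
      rw [← setIntegral_eq_integral_of_forall_compl_eq_zero (s := Ω)
        fun y hy => by rw [hf0 y hy, zero_mul]]
      refine integral_congr_ae ?_
      filter_upwards [hf] with y hy
      rw [hy]
    have e2 : ∫ y, inner ℝ (G y) e * k (x - y) = ∫ y in Ω, inner ℝ (v.grad y) e * k (x - y) := by
      rw [← setIntegral_eq_integral_of_forall_compl_eq_zero (s := Ω)
        fun y hy => by rw [hG0 y hy, inner_zero_left, zero_mul]]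
      refine integral_congr_ae ?_
      filter_upwards [hG] with y hy
      rw [hy]
    rw [e1, e2, hw]
  · have e1 : ∀ y, f y * fderiv ℝ k (x - y) e = 0 := fun y => by
      by_cases hy : x - y ∈ tsupport k
      · rw [(hx y hy).1, zero_mul]
      · rw [show fderiv ℝ k (x - y) = 0 from by_contra fun h => hy (support_fderiv_subset ℝ h),
          zero_apply, mul_zero]
    have e2 : ∀ y, inner ℝ (G y) e * k (x - y) = 0 := fun y => by
      by_cases hy : x - y ∈ tsupport k
      · rw [(hx y hy).2, inner_zero_left, zero_mul]
      · rw [image_eq_zero_of_notMem_tsupport hy, mul_zero]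
    simp only [e1, e2]

set_option maxHeartbeats 2000000 in
/-- If a cone around `e` can be attached to the points of `Ω` near `x₀`, then every Sobolev function
supported near `x₀` is a limit of functions of class `C¹`: mollify with a kernel concentrated near
`-t • e`, so that only values inside `Ω` are averaged. -/
theorem mem_closure_classical_of_cone (hΩ : IsOpen Ω) (hb : Bornology.IsBounded Ω)
    {x₀ e : Euc N} {r c : ℝ} (hr : 0 < r) (hc : 0 < c) (he : ‖e‖ ≤ 1)
    (hcone : ∀ x ∈ Ω ∩ Metric.ball x₀ r, ∀ t ∈ Ioo 0 r, Metric.ball (x + t • e) (c * t) ⊆ Ω)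
    {v : W1 Ω p}
    (hv : ∀ᵐ x ∂volume.restrict Ω, x ∉ Metric.ball x₀ (r / 2) → v.fn x = 0 ∧ v.grad x = 0) :
    v ∈ (W1.classical Ω p).topologicalClosure := by
  set S : Set (Euc N) := Ω ∩ Metric.ball x₀ (r / 2) with hS
  have hSm : MeasurableSet S := hΩ.measurableSet.inter measurableSet_ball
  set f : Euc N → ℝ := S.indicator v.fn with hf
  set G : Euc N → Euc N := S.indicator v.grad with hG
  have hfs : StronglyMeasurable f := (Lp.stronglyMeasurable v.1.fst).indicator hSm
  have hGs : StronglyMeasurable G := (Lp.stronglyMeasurable v.1.snd).indicator hSm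
  have hfp : MemLp f (ENNReal.ofReal p) volume :=
    (memLp_indicator_iff_restrict hSm).2
      (v.memLp_fn.mono_measure (Measure.restrict_mono inter_subset_left le_rfl))
  have hGp : MemLp G (ENNReal.ofReal p) volume :=
    (memLp_indicator_iff_restrict hSm).2
      (v.memLp_grad.mono_measure (Measure.restrict_mono inter_subset_left le_rfl))
  have hfloc : LocallyIntegrable f volume := hfp.locallyIntegrable Fact.out
  have hGloc : LocallyIntegrable G volume := hGp.locallyIntegrable Fact.out
  have hfG0 : ∀ x, x ∉ S → f x = 0 ∧ G x = 0 := fun x hx =>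
    ⟨indicator_of_notMem hx _, indicator_of_notMem hx _⟩
  have hfv : f =ᵐ[volume.restrict Ω] v.fn := by
    filter_upwards [hv, ae_restrict_mem hΩ.measurableSet] with x hx hxΩ
    by_cases hxb : x ∈ Metric.ball x₀ (r / 2)
    · exact indicator_of_mem (show x ∈ S from ⟨hxΩ, hxb⟩) _
    · rw [(hx hxb).1]
      exact indicator_of_notMem (fun h : x ∈ S => hxb h.2) _
  have hGv : G =ᵐ[volume.restrict Ω] v.grad := by
    filter_upwards [hv, ae_restrict_mem hΩ.measurableSet] with x hx hxΩ
    by_cases hxb : x ∈ Metric.ball x₀ (r / 2)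
    · exact indicator_of_mem (show x ∈ S from ⟨hxΩ, hxb⟩) _
    · rw [(hx hxb).2]
      exact indicator_of_notMem (fun h : x ∈ S => hxb h.2) _
  -- kernels supported in the ball of radius `c t / 2` around `-t e`, for a sequence of `t ≤ τ`
  -- tending to zero; `τ` is so small that they reach from outside `ball x₀ r` not into the support
  set τ : ℝ := r / (2 * (1 + c)) with hτ
  have hτ0 : 0 < τ := by positivity
  have hτr : τ * (1 + c) = r / 2 := by rw [hτ]; field_simp
  set t : ℕ → ℝ := fun n => τ / (n + 1) with ht
  have ht0 : ∀ n, 0 < t n := fun n => by positivity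
  have htτ : ∀ n, t n ≤ τ := fun n => div_le_self hτ0.le (by simp)
  have htlim : Tendsto t atTop (𝓝 0) := by
    simpa [ht, div_eq_mul_inv] using (tendsto_one_div_add_atTop_nhds_zero_nat (𝕜 := ℝ)).const_mul τ
  let b : ∀ n, ContDiffBump (-(t n • e)) := fun n =>
    ⟨c * t n / 4, c * t n / 2, by have := ht0 n; positivity,
      by have := mul_pos hc (ht0 n); linarith⟩
  set k : ℕ → Euc N → ℝ := fun n => (b n).normed volume with hk
  have hks : ∀ n, ContDiff ℝ ∞ (k n) := fun n => (b n).contDiff_normed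
  have hkc : ∀ n, HasCompactSupport (k n) := fun n => (b n).hasCompactSupport_normed
  have hkt : ∀ n, ∀ y ∈ tsupport (k n), ‖y + t n • e‖ ≤ c * t n / 2 := fun n y hy => by
    have : y ∈ Metric.closedBall (-(t n • e)) (b n).rOut := by
      rwa [← (b n).tsupport_normed_eq (μ := volume)]
    rwa [mem_closedBall_iff_norm, sub_neg_eq_add] at this
  have hkn : ∀ n, ∀ y ∈ tsupport (k n), ‖y‖ ≤ (1 + c) * t n := fun n y hy => by
    have h1 := hkt n y hy
    have h2 : ‖t n • e‖ ≤ t n := by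
      rw [norm_smul, Real.norm_of_nonneg (ht0 n).le]
      exact mul_le_of_le_one_right (ht0 n).le he
    have h3 := norm_sub_le (y + t n • e) (t n • e)
    rw [add_sub_cancel_right] at h3
    have := mul_pos hc (ht0 n)
    linarith
  have hgrad : ∀ n, ∀ x ∈ Ω, gradient (k n ⋆[ContinuousLinearMap.lsmul ℝ ℝ, volume] f) x =
      (k n ⋆[ContinuousLinearMap.lsmul ℝ ℝ, volume] G) x := by
    intro n x hxΩ
    refine gradient_convolution_eq hfv hGv hfloc hGloc (fun x hx => (hfG0 x fun h => hx h.1).1)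
      (fun x hx => (hfG0 x fun h => hx h.1).2) (hks n) (hkc n) ?_
    by_cases hxr : x ∈ Metric.ball x₀ r
    · left
      intro y hy
      have htr : t n < r := by
        have := htτ n
        nlinarith [mul_pos hτ0 hc]
      refine hcone x ⟨hxΩ, hxr⟩ (t n) ⟨ht0 n, htr⟩ ?_
      have h1 := hkt n _ hy
      rw [Metric.mem_ball, dist_eq_norm, norm_sub_rev]
      have h2 : x + t n • e - y = x - y + t n • e := by abel
      rw [h2]
      have := mul_pos hc (ht0 n)
      linarith
    · right
      intro y hy
      refine hfG0 y fun h => hxr ?_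
      have h1 := hkn n _ hy
      have h2 := Metric.mem_ball.1 h.2
      rw [Metric.mem_ball]
      have h3 := dist_triangle x y x₀
      rw [dist_eq_norm x y] at h3
      have := htτ n
      nlinarith
  have hCs : ∀ n, ContDiff ℝ 1 (k n ⋆[ContinuousLinearMap.lsmul ℝ ℝ, volume] f) := fun n =>
    (hkc n).contDiff_convolution_left _ ((hks n).of_le (by simp)) hfloc
  choose w hw hw' using fun n => W1.exists_of_contDiff (p := p) hΩ hb (hCs n)
  -- convergence of the mollified functions in `L^p`
  have hconv : ∀ {E : Type} [NormedAddCommGroup E] [NormedSpace ℝ E] [CompleteSpace E]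
      {h : Euc N → E} (_ : StronglyMeasurable h) (_ : MemLp h (ENNReal.ofReal p) volume),
      Tendsto (fun n => ∫⁻ x, ‖(k n ⋆[ContinuousLinearMap.lsmul ℝ ℝ, volume] h) x - h x‖ₑ ^ p)
        atTop (𝓝 0) := by
    intro E _ _ _ h hh hhp
    refine ENNReal.tendsto_nhds_zero.2 fun δ hδ => ?_
    have h1 := ENNReal.tendsto_nhds_zero.1 (tendsto_lintegral_translate hhp) δ hδ
    obtain ⟨ρ, hρ, hball⟩ := Metric.eventually_nhds_iff_ball.1 h1
    have h2 : ∀ᶠ n in atTop, (1 + c) * t n < ρ := by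
      have := htlim.const_mul (1 + c)
      rw [mul_zero] at this
      exact this.eventually_lt_const hρ
    filter_upwards [h2] with n hn
    refine lintegral_convolution_sub_le hh hhp (hks n).continuous (hkc n)
      (fun x => (b n).nonneg_normed x) (b n).integral_normed fun s hs => hball s ?_
    rw [mem_ball_zero_iff]
    exact (hkn n s (subset_tsupport _ hs)).trans_lt hn
  have hlim : Tendsto w atTop (𝓝 v) := by
    refine W1.tendsto_iff.2 ⟨tendsto_Lp_of_lintegral ?_, tendsto_Lp_of_lintegral ?_⟩
    · refine tendsto_of_tendsto_of_tendsto_of_le_of_le tendsto_const_nhds (hconv hfs hfp)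
        (fun _ => zero_le) fun n => ?_
      refine le_trans (le_of_eq (lintegral_congr_ae ?_)) (setLIntegral_le_lintegral Ω _)
      filter_upwards [hw n, hfv] with x h1 h2
      rw [h2, ← h1]
      rfl
    · refine tendsto_of_tendsto_of_tendsto_of_le_of_le tendsto_const_nhds (hconv hGs hGp)
        (fun _ => zero_le) fun n => ?_
      refine le_trans (le_of_eq (lintegral_congr_ae ?_)) (setLIntegral_le_lintegral Ω _)
      filter_upwards [hw' n, hGv, ae_restrict_mem hΩ.measurableSet] with x h1 h2 h3
      rw [h2, ← hgrad n x h3, ← h1]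
      rfl
  exact mem_closure_of_tendsto hlim (Eventually.of_forall fun n => ⟨_, hCs n, hw n⟩)

open scoped Manifold in
/-- On a bounded `C²` domain every element of `W^{1,p}` is a limit of functions of class `C¹` on
the whole space. -/
theorem IsC2Domain.mem_closure_classical (hΩ : IsC2Domain Ω) (u : W1 Ω p) :
    u ∈ (W1.classical Ω p).topologicalClosure := by
  have hchart : ∀ x₀ ∈ closure Ω, ∃ (e : Euc N) (r c : ℝ), 0 < r ∧ 0 < c ∧ ‖e‖ ≤ 1 ∧
      ∀ x ∈ Ω ∩ Metric.ball x₀ r, ∀ t ∈ Ioo 0 r, Metric.ball (x + t • e) (c * t) ⊆ Ω := by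
    intro x₀ hx₀
    -- at interior points the direction `0` will do
    by_cases hxΩ : x₀ ∈ Ω
    · obtain ⟨R, hR, hball⟩ := Metric.isOpen_iff.1 hΩ.isOpen x₀ hxΩ
      refine ⟨0, R / 2, 1, by linarith, one_pos, by simp, ?_⟩
      rintro x ⟨-, hx⟩ t ⟨-, htR⟩
      rw [smul_zero, add_zero, one_mul]
      refine (Metric.ball_subset_ball' ?_).trans hball
      have := Metric.mem_ball.1 hx
      linarith
    · have hfr : x₀ ∈ frontier Ω := by
        rw [hΩ.isOpen.frontier_eq]
        exact ⟨hx₀, hxΩ⟩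
      obtain ⟨e, he, r, c, L, hr, hc, -, -, hcone⟩ := hΩ.exists_chart hfr
      exact ⟨e, r, c, hr, hc, he.le, hcone⟩
  -- decompose `u` by a smooth partition of unity subordinate to the charts
  choose! e r c hr hc he hcone using hchart
  have hcomp : IsCompact (closure Ω) :=
    Metric.isCompact_of_isClosed_isBounded isClosed_closure hΩ.isBounded.closure
  obtain ⟨T, hT, hcov⟩ := hcomp.elim_nhds_subcover (fun x => Metric.ball x (r x / 2))
    fun x hx => Metric.ball_mem_nhds x (half_pos (hr x hx))
  obtain ⟨η, hη⟩ := SmoothPartitionOfUnity.exists_isSubordinate 𝓘(ℝ, Euc N) isClosed_closure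
    (fun x : T => Metric.ball (x : Euc N) (r x / 2)) (fun _ => Metric.isOpen_ball)
    (hcov.trans (iUnion₂_subset fun x hx =>
      subset_iUnion (fun x : T => Metric.ball (x : Euc N) (r x / 2)) ⟨x, hx⟩))
  have hηs : ∀ i, ContDiff ℝ ∞ (η i) := fun i => (η i).contMDiff.contDiff
  have hηc : ∀ i, HasCompactSupport (η i) := fun i =>
    HasCompactSupport.intro (isCompact_closedBall (i : Euc N) (r i / 2)) fun x hx =>
      image_eq_zero_of_notMem_tsupport fun h => hx (Metric.ball_subset_closedBall (hη i h))
  choose v hv hv' using fun i => W1.exists_mul_smooth (hηs i) (hηc i) u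
  have hsum : u = ∑ i, v i := by
    refine W1.ext_fn hΩ.isOpen ?_
    have h1 : ∀ s : Finset T, (∑ i ∈ s, v i).fn =ᵐ[volume.restrict Ω]
        fun x => ∑ i ∈ s, η i x * u.fn x := by
      intro s
      induction s using Finset.induction_on with
      | empty =>
        simp only [Finset.sum_empty]
        exact W1.fn_zero
      | insert i s hi ih =>
        rw [Finset.sum_insert hi]
        filter_upwards [W1.fn_add (v i) (∑ i ∈ s, v i), ih, hv i] with x h1 h2 h3
        rw [h1, Pi.add_apply, h2, h3, Finset.sum_insert hi]
    filter_upwards [h1 Finset.univ, ae_restrict_mem hΩ.isOpen.measurableSet] with x hx hxΩ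
    have h2 := η.sum_eq_one (subset_closure hxΩ)
    rw [finsum_eq_sum_of_fintype] at h2
    rw [hx, ← Finset.sum_mul, h2, one_mul]
  rw [hsum]
  refine Submodule.sum_mem _ fun i _ => ?_
  have hi := hT i i.2
  refine mem_closure_classical_of_cone hΩ.isOpen hΩ.isBounded (hr i hi) (hc i hi) (he i hi)
    (hcone i hi) ?_
  filter_upwards [hv i, hv' i] with x h1 h2 hx
  have h3 : x ∉ tsupport (η i) := fun h => hx (hη i h)
  have h4 : gradient (η i) x = 0 := by
    have : fderiv ℝ (η i) x = 0 := by_contra fun h => h3 (support_fderiv_subset ℝ h)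
    simp [gradient, this]
  rw [h1, h2, h4, image_eq_zero_of_notMem_tsupport h3]
  simp

end


/-! ### The trace operator -/

section

variable {N : ℕ} {Ω : Set (Euc N)} {p : ℝ} [hp : Fact (1 < p)]

theorem Lp_enorm_rpow {α E : Type*} [MeasurableSpace α] [NormedAddCommGroup E] {μ : Measure α}
    (f : Lp E (ENNReal.ofReal p) μ) : ‖f‖ₑ ^ p = ∫⁻ x, ‖f x‖ₑ ^ p ∂μ := by
  have hp0 : 0 < p := zero_lt_one.trans hp.out
  rw [Lp.enorm_def, eLpNorm_eq_lintegral_rpow_enorm_toReal (ofReal_exponent_ne_zero p)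
    ENNReal.ofReal_ne_top, toReal_exponent, ← ENNReal.rpow_mul, one_div_mul_cancel hp0.ne',
    ENNReal.rpow_one]

theorem W1.norm_rpow_eq_add (u : W1 Ω p) : ‖u‖ ^ p = ‖u.1.snd‖ ^ p + ‖u.1.fst‖ ^ p := by
  rw [W1.norm_rpow, Lp_norm_rpow, Lp_norm_rpow]
  rfl

theorem W1.norm_fst_le (u : W1 Ω p) : ‖u.1.fst‖ ≤ ‖u‖ := by
  have hp0 : 0 < p := zero_lt_one.trans hp.out
  refine (Real.rpow_le_rpow_iff (norm_nonneg _) (norm_nonneg _) hp0).1 ?_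
  rw [u.norm_rpow_eq_add]
  exact le_add_of_nonneg_left (by positivity)

theorem W1.norm_snd_le (u : W1 Ω p) : ‖u.1.snd‖ ≤ ‖u‖ := by
  have hp0 : 0 < p := zero_lt_one.trans hp.out
  refine (Real.rpow_le_rpow_iff (norm_nonneg _) (norm_nonneg _) hp0).1 ?_
  rw [u.norm_rpow_eq_add]
  exact le_add_of_nonneg_right (by positivity)

theorem ae_surf_mem_closure : ∀ᵐ x ∂surf Ω, x ∈ closure Ω :=
  (ae_restrict_mem measurableSet_frontier).mono fun _ hx => frontier_subset_closure hx

theorem classicalTraces_sub {z z' : W1 Ω p × Lp ℝ (ENNReal.ofReal p) (surf Ω)}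
    (hz : z ∈ classicalTraces Ω p) (hz' : z' ∈ classicalTraces Ω p) :
    z - z' ∈ classicalTraces Ω p := by
  obtain ⟨φ, hφ, h1, h2⟩ := hz
  obtain ⟨ψ, hψ, h1', h2'⟩ := hz'
  exact ⟨φ - ψ, hφ.sub hψ, (W1.fn_sub _ _).trans (h1.sub h1'),
    (Lp.coeFn_sub _ _).trans (h2.sub h2')⟩

theorem classicalTraces_add {z z' : W1 Ω p × Lp ℝ (ENNReal.ofReal p) (surf Ω)}
    (hz : z ∈ classicalTraces Ω p) (hz' : z' ∈ classicalTraces Ω p) :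
    z + z' ∈ classicalTraces Ω p := by
  obtain ⟨φ, hφ, h1, h2⟩ := hz
  obtain ⟨ψ, hψ, h1', h2'⟩ := hz'
  exact ⟨φ + ψ, hφ.add hψ, (W1.fn_add _ _).trans (h1.add h1'),
    (Lp.coeFn_add _ _).trans (h2.add h2')⟩

theorem classicalTraces_smul (c : ℝ) {z : W1 Ω p × Lp ℝ (ENNReal.ofReal p) (surf Ω)}
    (hz : z ∈ classicalTraces Ω p) : c • z ∈ classicalTraces Ω p := by
  obtain ⟨φ, hφ, h1, h2⟩ := hz
  exact ⟨c • φ, hφ.const_smul c, (Lp.coeFn_smul c z.1.1.fst).trans (h1.const_smul c),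
    (Lp.coeFn_smul _ _).trans (h2.const_smul c)⟩

theorem add_mem_closure_of_add_mem {X : Type*} [TopologicalSpace X] [Add X] [ContinuousAdd X]
    {s : Set X} (hs : ∀ a ∈ s, ∀ b ∈ s, a + b ∈ s) {a b : X} (ha : a ∈ closure s)
    (hb : b ∈ closure s) : a + b ∈ closure s :=
  map_mem_closure₂ continuous_add ha hb hs

theorem smul_mem_closure_of_smul_mem {X : Type*} [TopologicalSpace X] [SMul ℝ X]
    [ContinuousConstSMul ℝ X] {s : Set X} (c : ℝ) (hs : ∀ a ∈ s, c • a ∈ s) {a : X}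
    (ha : a ∈ closure s) : c • a ∈ closure s :=
  map_mem_closure (continuous_const_smul c) ha hs

theorem norm_snd_le_of_mem_closure {X Y : Type*} [SeminormedAddCommGroup X]
    [SeminormedAddCommGroup Y] {s : Set (X × Y)} {C : ℝ} (hs : ∀ z ∈ s, ‖z.2‖ ≤ C * ‖z.1‖)
    {z : X × Y} (hz : z ∈ closure s) : ‖z.2‖ ≤ C * ‖z.1‖ :=
  closure_minimal (t := {z : X × Y | ‖z.2‖ ≤ C * ‖z.1‖}) hs
    (isClosed_le (by fun_prop) (by fun_prop)) hz

theorem IsTrace.add {u v : W1 Ω p} {w w' : Lp ℝ (ENNReal.ofReal p) (surf Ω)} (hu : IsTrace u w)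
    (hv : IsTrace v w') : IsTrace (u + v) (w + w') := by
  have h := add_mem_closure_of_add_mem (s := classicalTraces Ω p)
    (fun _ ha _ hb => classicalTraces_add ha hb) hu hv
  rwa [Prod.mk_add_mk] at h

theorem IsTrace.smul (c : ℝ) {u : W1 Ω p} {w : Lp ℝ (ENNReal.ofReal p) (surf Ω)}
    (hu : IsTrace u w) : IsTrace (c • u) (c • w) := by
  have h := smul_mem_closure_of_smul_mem (s := classicalTraces Ω p) c
    (fun _ ha => classicalTraces_smul c ha) hu
  rwa [Prod.smul_mk] at h

/-- The trace inequality, in terms of the norms of `W^{1,p}(Ω)` and `L^p(∂Ω)`. -/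
theorem IsC2Domain.exists_norm_le (hN : 1 ≤ N) (hΩ : IsC2Domain Ω) (p : ℝ) [hp : Fact (1 < p)] :
    ∃ C : ℝ, 0 ≤ C ∧ ∀ (u : W1 Ω p) w, IsTrace u w → ‖w‖ ≤ C * ‖u‖ := by
  have hp0 : 0 < p := zero_lt_one.trans hp.out
  obtain ⟨C, hC, hle⟩ := hΩ.exists_trace_le hN hp.out
  refine ⟨((C * 2) ^ (1 / p)).toReal, ENNReal.toReal_nonneg, fun u w huw => ?_⟩
  refine norm_snd_le_of_mem_closure ?_ huw
  rintro ⟨u, w⟩ ⟨φ, hφ, h1, h2⟩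
  have hg := W1.grad_ae_eq_of_contDiff hΩ.isOpen hΩ.isBounded hφ h1
  have e1 : ‖w‖ₑ ^ p = ∫⁻ x, ‖φ x‖ₑ ^ p ∂surf Ω := by
    rw [Lp_enorm_rpow]
    refine lintegral_congr_ae ?_
    filter_upwards [h2] with x hx
    rw [hx]
  have e2 : ∫⁻ x in Ω, (‖φ x‖ₑ ^ p + ‖fderiv ℝ φ x‖ₑ ^ p) = ‖u.1.fst‖ₑ ^ p + ‖u.1.snd‖ₑ ^ p := by
    rw [Lp_enorm_rpow, Lp_enorm_rpow, ← lintegral_add_left'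
      ((Lp.aestronglyMeasurable u.1.fst).enorm.pow_const p)]
    refine lintegral_congr_ae ?_
    filter_upwards [h1, hg] with x hx hx'
    change _ = ‖u.fn x‖ₑ ^ p + ‖u.grad x‖ₑ ^ p
    rw [hx, hx', ← ofReal_norm (gradient φ x), norm_gradient, ofReal_norm]
  have h3 : ‖w‖ₑ ^ p ≤ (C * 2) * ‖u‖ₑ ^ p := by
    rw [e1]
    refine (hle φ hφ).trans ?_
    rw [e2, mul_assoc, two_mul]
    gcongr
    · exact enorm_le_iff_norm_le.2 u.norm_fst_le
    · exact enorm_le_iff_norm_le.2 u.norm_snd_le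
  have h4 : ‖w‖ₑ ≤ (C * 2) ^ (1 / p) * ‖u‖ₑ := by
    refine (ENNReal.rpow_le_rpow_iff hp0).1 ?_
    rwa [ENNReal.mul_rpow_of_nonneg _ _ hp0.le, ← ENNReal.rpow_mul, one_div_mul_cancel hp0.ne',
      ENNReal.rpow_one]
  have h5 := ENNReal.toReal_mono (ENNReal.mul_ne_top
    (ENNReal.rpow_ne_top_of_nonneg (by positivity) (ENNReal.mul_ne_top hC (by simp)))
    enorm_ne_top) h4
  simpa using h5

theorem IsC2Domain.isTrace_unique (hN : 1 ≤ N) (hΩ : IsC2Domain Ω) {u : W1 Ω p}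
    {w w' : Lp ℝ (ENNReal.ofReal p) (surf Ω)} (h : IsTrace u w) (h' : IsTrace u w') : w = w' := by
  obtain ⟨C, -, hC⟩ := hΩ.exists_norm_le hN p
  have h1 := hC _ _ (h.add (h'.smul (-1)))
  rw [neg_one_smul, neg_one_smul, ← sub_eq_add_neg, ← sub_eq_add_neg, sub_self, norm_zero,
    mul_zero] at h1
  exact sub_eq_zero.1 (norm_le_zero_iff.1 h1)

theorem IsC2Domain.isTrace_of_contDiff (hN : 1 ≤ N) (hΩ : IsC2Domain Ω) {u : W1 Ω p}
    {φ : Euc N → ℝ} (hφ : ContDiff ℝ 1 φ) (hu : u.fn =ᵐ[volume.restrict Ω] φ) :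
    ∃ w : Lp ℝ (ENNReal.ofReal p) (surf Ω), w =ᵐ[surf Ω] φ ∧ (u, w) ∈ classicalTraces Ω p := by
  have := hΩ.isFiniteMeasure_surf hN
  have hm : MemLp φ (ENNReal.ofReal p) (surf Ω) :=
    memLp_restrict_of_continuous hΩ.isBounded ae_surf_mem_closure hφ.continuous
  exact ⟨hm.toLp φ, hm.coeFn_toLp, φ, hφ, hu, hm.coeFn_toLp⟩

/-- The trace theorem: every Sobolev function has a trace. -/
theorem IsC2Domain.exists_isTrace (hN : 1 ≤ N) (hΩ : IsC2Domain Ω) (u : W1 Ω p) :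
    ∃ w, IsTrace u w := by
  obtain ⟨C, hC0, hC⟩ := hΩ.exists_norm_le hN p
  obtain ⟨v, hv, hlim⟩ := mem_closure_iff_seq_limit.1 (hΩ.mem_closure_classical u)
  choose φ hφ hvφ using hv
  choose w hw hvw using fun n => hΩ.isTrace_of_contDiff hN (hφ n) (hvφ n)
  have hcau : CauchySeq w := by
    refine Metric.cauchySeq_iff.2 fun ε hε => ?_
    obtain ⟨n₀, hn₀⟩ := Metric.cauchySeq_iff.1 hlim.cauchySeq (ε / (C + 1)) (by positivity)
    refine ⟨n₀, fun m hm n hn => ?_⟩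
    have h1 := hC _ _ (subset_closure (classicalTraces_sub (hvw m) (hvw n)))
    have h2 := hn₀ m hm n hn
    rw [dist_eq_norm] at h2 ⊢
    rw [lt_div_iff₀ (by positivity)] at h2
    nlinarith [norm_nonneg (v m - v n)]
  obtain ⟨w₀, hw₀⟩ := cauchySeq_tendsto_of_complete hcau
  exact ⟨w₀, mem_closure_of_tendsto (hlim.prodMk_nhds hw₀) (Eventually.of_forall hvw)⟩

theorem IsC2Domain.isTrace_trace (hN : 1 ≤ N) (hΩ : IsC2Domain Ω) (u : W1 Ω p) :
    IsTrace u (trace u) := by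
  have h := hΩ.exists_isTrace hN u
  rw [trace, dif_pos h]
  exact h.choose_spec

theorem IsTrace.trace_eq (hN : 1 ≤ N) (hΩ : IsC2Domain Ω) {u : W1 Ω p}
    {w : Lp ℝ (ENNReal.ofReal p) (surf Ω)} (h : IsTrace u w) : trace u = w :=
  hΩ.isTrace_unique hN (hΩ.isTrace_trace hN u) h

theorem IsC2Domain.trace_add (hN : 1 ≤ N) (hΩ : IsC2Domain Ω) (u v : W1 Ω p) :
    trace (u + v) = trace u + trace v :=
  ((hΩ.isTrace_trace hN u).add (hΩ.isTrace_trace hN v)).trace_eq hN hΩ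

theorem IsC2Domain.trace_smul (hN : 1 ≤ N) (hΩ : IsC2Domain Ω) (c : ℝ) (u : W1 Ω p) :
    trace (c • u) = c • trace u :=
  ((hΩ.isTrace_trace hN u).smul c).trace_eq hN hΩ

theorem IsC2Domain.trace_neg (hN : 1 ≤ N) (hΩ : IsC2Domain Ω) (u : W1 Ω p) :
    trace (-u) = -trace u := by
  simpa using hΩ.trace_smul hN (-1) u

theorem IsC2Domain.trace_sub (hN : 1 ≤ N) (hΩ : IsC2Domain Ω) (u v : W1 Ω p) :
    trace (u - v) = trace u - trace v := by
  rw [sub_eq_add_neg, hΩ.trace_add hN, hΩ.trace_neg hN, sub_eq_add_neg]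

theorem IsC2Domain.trace_zero (hN : 1 ≤ N) (hΩ : IsC2Domain Ω) : trace (0 : W1 Ω p) = 0 := by
  simpa using hΩ.trace_smul hN 0 (0 : W1 Ω p)

theorem IsC2Domain.continuous_trace (hN : 1 ≤ N) (hΩ : IsC2Domain Ω) :
    Continuous (trace : W1 Ω p → Lp ℝ (ENNReal.ofReal p) (surf Ω)) := by
  obtain ⟨C, -, hC⟩ := hΩ.exists_norm_le hN p
  let T : W1 Ω p →ₗ[ℝ] Lp ℝ (ENNReal.ofReal p) (surf Ω) :=
    { toFun := trace, map_add' := hΩ.trace_add hN, map_smul' := hΩ.trace_smul hN }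
  exact (T.mkContinuous C fun u => hC u _ (hΩ.isTrace_trace hN u)).continuous

theorem IsC2Domain.trace_ae_eq_of_contDiff (hN : 1 ≤ N) (hΩ : IsC2Domain Ω) {u : W1 Ω p}
    {φ : Euc N → ℝ} (hφ : ContDiff ℝ 1 φ) (hu : u.fn =ᵐ[volume.restrict Ω] φ) :
    trace u =ᵐ[surf Ω] φ := by
  obtain ⟨w, hw, huw⟩ := hΩ.isTrace_of_contDiff hN hφ hu
  rw [IsTrace.trace_eq hN hΩ (subset_closure huw)]
  exact hw

/-! ### Chain rule and positive parts -/

/-- The chain rule for the composition with a function of class `C¹` with bounded derivative, and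
the trace of the composition. -/
theorem IsC2Domain.exists_comp (hN : 1 ≤ N) (hΩ : IsC2Domain Ω) {F : ℝ → ℝ} (hF : ContDiff ℝ 1 F)
    (hF0 : F 0 = 0) (hF1 : ∀ s, |deriv F s| ≤ 1) (u : W1 Ω p) :
    ∃ v : W1 Ω p, v.fn =ᵐ[volume.restrict Ω] (fun x => F (u.fn x)) ∧
      v.grad =ᵐ[volume.restrict Ω] (fun x => deriv F (u.fn x) • u.grad x) ∧
      trace v =ᵐ[surf Ω] fun x => F (trace u x) := by
  have hdc : Continuous (deriv F) := hF.continuous_deriv le_rfl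
  have hlip : LipschitzWith 1 F := lipschitzWith_of_nnnorm_deriv_le (hF.differentiable one_ne_zero)
    fun s => by simpa [← NNReal.coe_le_coe] using hF1 s
  -- approximate `u` and its trace by functions `φ n` of class `C¹`
  obtain ⟨z, hz, hlim⟩ := mem_closure_iff_seq_limit.1 (hΩ.isTrace_trace hN u)
  have hz1 : Tendsto (fun n => (z n).1) atTop (𝓝 u) := (continuous_fst.tendsto _).comp hlim
  have hz2 : Tendsto (fun n => (z n).2) atTop (𝓝 (trace u)) := (continuous_snd.tendsto _).comp hlim
  obtain ⟨ns, hns, hae⟩ := exists_subseq_tendsto_ae (W1.tendsto_fst hz1)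
  have hz1' := hz1.comp hns.tendsto_atTop
  have hz2' := hz2.comp hns.tendsto_atTop
  choose φ hφ hzφ hzφ' using fun n => hz (ns n)
  have hcomp : ∀ n, ContDiff ℝ 1 (F ∘ φ n) := fun n => hF.comp (hφ n)
  choose v hv hv' using fun n => W1.exists_of_contDiff (p := p) hΩ.isOpen hΩ.isBounded (hcomp n)
  have hgradm : ∀ a : W1 Ω p, MemLp (fun x => deriv F (a.fn x) • u.grad x) (ENNReal.ofReal p)
      (volume.restrict Ω) := fun a => by
    refine MemLp.of_le u.memLp_grad
      ((hdc.comp_aestronglyMeasurable a.memLp_fn.1).smul u.memLp_grad.1)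
      (Eventually.of_forall fun x => ?_)
    rw [norm_smul]
    exact mul_le_of_le_one_left (norm_nonneg _) (hF1 _)
  set G := (hgradm u).toLp _ with hG
  have hfst : Tendsto (fun n => (v n).1.fst) atTop (𝓝 (hlip.compLp hF0 u.1.fst)) := by
    have h1 := (hlip.continuous_compLp hF0).tendsto u.1.fst |>.comp (W1.tendsto_fst hz1')
    refine h1.congr fun n => Lp.ext ?_
    filter_upwards [hlip.coeFn_compLp hF0 (z (ns n)).1.1.fst, hv n, hzφ n] with x h2 h3 h4
    change _ = (v n).fn x
    rw [Function.comp_apply, Function.comp_apply, h2, h3, Function.comp_apply, Function.comp_apply,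
      ← h4]
    rfl
  -- compare `F' (φ n) ∇φ n` with `F' (φ n) ∇u`, and the latter with `F' u ∇u`
  have hsnd : Tendsto (fun n => (v n).1.snd) atTop (𝓝 G) := by
    have h1 : Tendsto (fun n => (hgradm (z (ns n)).1).toLp _) atTop (𝓝 G) := by
      refine tendsto_Lp_of_dominated (u.memLp_grad.norm.const_mul 2) (fun n => ?_) ?_
      · filter_upwards [(hgradm (z (ns n)).1).coeFn_toLp, (hgradm u).coeFn_toLp] with x h1 h2
        rw [h1, h2, ← sub_smul, norm_smul]
        gcongr
        refine (norm_sub_le _ _).trans ?_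
        have := hF1 ((z (ns n)).1.fn x)
        have := hF1 (u.fn x)
        simp only [Real.norm_eq_abs]
        linarith
      · filter_upwards [ae_all_iff.2 fun n => (hgradm (z (ns n)).1).coeFn_toLp,
          (hgradm u).coeFn_toLp, hae] with x h1 h2 h3
        rw [hG, h2]
        simp only [h1]
        exact ((hdc.tendsto (u.fn x)).comp h3).smul_const (u.grad x)
    have h2 : Tendsto (fun n => (v n).1.snd - (hgradm (z (ns n)).1).toLp _) atTop (𝓝 0) := by
      have h3 := tendsto_iff_norm_sub_tendsto_zero.1 (W1.tendsto_snd hz1')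
      refine squeeze_zero_norm (fun n => ?_) h3
      refine Lp.norm_le_norm_of_ae_le ?_
      have hg := W1.grad_ae_eq_of_contDiff hΩ.isOpen hΩ.isBounded (hφ n) (hzφ n)
      filter_upwards [Lp.coeFn_sub (v n).1.snd ((hgradm (z (ns n)).1).toLp _),
        Lp.coeFn_sub (z (ns n)).1.1.snd u.1.snd, (hgradm (z (ns n)).1).coeFn_toLp, hv' n, hg,
        hzφ n] with x h4 h5 h6 h7 h8 h9
      have h10 : gradient (F ∘ φ n) x = deriv F ((z (ns n)).1.fn x) • (z (ns n)).1.grad x := by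
        refine ext_inner_right ℝ fun e => ?_
        have h11 := ((hF.differentiable one_ne_zero (φ n x)).hasDerivAt).comp_hasFDerivAt x
          ((hφ n).differentiable one_ne_zero x).hasFDerivAt
        rw [inner_gradient_left, h11.fderiv, real_inner_smul_left, h8, inner_gradient_left, h9]
        simp
      change (v n).1.snd x = _ at h7
      rw [h4, Function.comp_apply, h5, Pi.sub_apply, Pi.sub_apply, h6, h7, h10, ← smul_sub,
        norm_smul]
      exact mul_le_of_le_one_left (norm_nonneg _) (hF1 _)
    simpa using h2.add h1
  have hweak := isWeakGradient_of_tendsto hΩ.isBounded hfst hsnd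
  let v₀ : W1 Ω p := ⟨WithLp.toLp _ (hlip.compLp hF0 u.1.fst, G), hweak⟩
  have hvlim : Tendsto v atTop (𝓝 v₀) := W1.tendsto_iff.2 ⟨hfst, hsnd⟩
  have htr : trace v₀ = hlip.compLp hF0 (trace u) := by
    refine tendsto_nhds_unique (((hΩ.continuous_trace hN).tendsto _).comp hvlim) ?_
    refine ((hlip.continuous_compLp hF0).tendsto (trace u) |>.comp hz2').congr fun n => Lp.ext ?_
    filter_upwards [hlip.coeFn_compLp hF0 (z (ns n)).2,
      hΩ.trace_ae_eq_of_contDiff hN (hcomp n) (hv n), hzφ' n] with x h2 h3 h4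
    rw [Function.comp_apply, Function.comp_apply, Function.comp_apply, h2, h3, Function.comp_apply,
      Function.comp_apply, h4]
  refine ⟨v₀, hlip.coeFn_compLp hF0 u.1.fst, (hgradm u).coeFn_toLp, ?_⟩
  rw [htr]
  exact hlip.coeFn_compLp hF0 (trace u)

end


/-- The continuous ramps `s ↦ min (max ((n + 1) s) 0) 1` increase to the indicator function of
`(0, ∞)`. -/
noncomputable def ramp (n : ℕ) (s : ℝ) : ℝ := min (max ((n + 1) * s) 0) 1

theorem continuous_ramp (n : ℕ) : Continuous (ramp n) := by
  unfold ramp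
  fun_prop

theorem abs_ramp_le (n : ℕ) (s : ℝ) : |ramp n s| ≤ 1 := by
  unfold ramp
  rw [abs_of_nonneg (le_min (le_max_right _ _) zero_le_one)]
  exact min_le_right _ _

theorem tendsto_ramp (s : ℝ) : Tendsto (fun n => ramp n s) atTop (𝓝 ((Ioi 0).indicator 1 s)) := by
  by_cases hs : 0 < s
  · rw [indicator_of_mem (mem_Ioi.2 hs), Pi.one_apply]
    refine tendsto_const_nhds.congr' ?_
    obtain ⟨m, hm⟩ := exists_nat_ge (1 / s)
    filter_upwards [eventually_ge_atTop m] with n hn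
    have h1 : (m : ℝ) ≤ n := by exact_mod_cast hn
    have h2 : 1 ≤ (n + 1) * s := by
      rw [div_le_iff₀ hs] at hm
      nlinarith
    rw [ramp, max_eq_left (by linarith), min_eq_right h2]
  · rw [indicator_of_notMem (by simpa using hs)]
    refine tendsto_const_nhds.congr fun n => ?_
    have h1 : (n + 1) * s ≤ 0 := mul_nonpos_of_nonneg_of_nonpos (by positivity) (not_lt.1 hs)
    rw [ramp, max_eq_right h1, min_eq_left zero_le_one]

/-- Approximations of class `C¹` of the positive part. -/
noncomputable def rampInt (n : ℕ) (s : ℝ) : ℝ := ∫ r in (0 : ℝ)..s, ramp n r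

theorem hasDerivAt_rampInt (n : ℕ) (s : ℝ) : HasDerivAt (rampInt n) (ramp n s) s :=
  (continuous_ramp n).integral_hasStrictDerivAt 0 s |>.hasDerivAt

theorem deriv_rampInt (n : ℕ) : deriv (rampInt n) = ramp n :=
  funext fun s => (hasDerivAt_rampInt n s).deriv

theorem contDiff_rampInt (n : ℕ) : ContDiff ℝ 1 (rampInt n) :=
  contDiff_one_iff_deriv.2 ⟨fun s => (hasDerivAt_rampInt n s).differentiableAt, by
    rw [deriv_rampInt]; exact continuous_ramp n⟩

theorem abs_rampInt_le (n : ℕ) (s : ℝ) : |rampInt n s| ≤ |s| := by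
  have := intervalIntegral.norm_integral_le_of_norm_le_const (a := 0) (b := s) (C := 1)
    (f := ramp n) fun x _ => abs_ramp_le n x
  simpa [rampInt] using this

theorem tendsto_rampInt (s : ℝ) : Tendsto (fun n => rampInt n s) atTop (𝓝 (max s 0)) := by
  have h1 : Tendsto (fun n => rampInt n s) atTop
      (𝓝 (∫ r in (0 : ℝ)..s, (Ioi (0 : ℝ)).indicator 1 r)) :=
    intervalIntegral.tendsto_integral_filter_of_dominated_convergence (fun _ => 1)
      (Eventually.of_forall fun n => (continuous_ramp n).aestronglyMeasurable)
      (Eventually.of_forall fun n => Eventually.of_forall fun r _ => abs_ramp_le n r)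
      intervalIntegrable_const (Eventually.of_forall fun r _ => tendsto_ramp r)
  have h2 : ∫ r in (0 : ℝ)..s, (Ioi (0 : ℝ)).indicator 1 r = max s 0 := by
    rcases le_total s 0 with hs | hs
    · rw [intervalIntegral.integral_symm, intervalIntegral.integral_of_le hs, max_eq_right hs,
        setIntegral_congr_fun (g := fun _ => (0 : ℝ)) measurableSet_Ioc]
      · simp
      · intro r hr
        exact indicator_of_notMem (by simpa using hr.2) _
    · rw [intervalIntegral.integral_of_le hs, max_eq_left hs,
        setIntegral_congr_fun (g := fun _ => (1 : ℝ)) measurableSet_Ioc]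
      · simp [hs]
      · intro r hr
        exact indicator_of_mem (mem_Ioi.2 hr.1) _
  rwa [h2] at h1

section

variable {N : ℕ} {Ω : Set (Euc N)} {p : ℝ} [hp : Fact (1 < p)]

/-- The positive part of a Sobolev function is a Sobolev function; its gradient and its trace are
obtained as limits of the compositions with `rampInt n`. -/
theorem IsC2Domain.exists_posPart (hN : 1 ≤ N) (hΩ : IsC2Domain Ω) (u : W1 Ω p) :
    ∃ v : W1 Ω p, v.fn =ᵐ[volume.restrict Ω] (fun x => max (u.fn x) 0) ∧
      v.grad =ᵐ[volume.restrict Ω] {x | 0 < u.fn x}.indicator u.grad ∧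
      trace v =ᵐ[surf Ω] fun x => max (trace u x) 0 := by
  choose v hv hv' hvt using fun n => hΩ.exists_comp hN (contDiff_rampInt n)
    (by simp [rampInt]) (by rw [deriv_rampInt]; exact abs_ramp_le n) u
  simp only [deriv_rampInt] at hv'
  have hms : MeasurableSet {x | 0 < u.fn x} :=
    measurableSet_lt measurable_const (Lp.stronglyMeasurable u.1.fst).measurable
  have hmg : MemLp ({x | 0 < u.fn x}.indicator u.grad) (ENNReal.ofReal p) (volume.restrict Ω) :=
    u.memLp_grad.indicator hms
  have hfst : Tendsto (fun n => (v n).1.fst) atTop (𝓝 (Lp.posPart u.1.fst)) := by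
    refine tendsto_Lp_of_dominated (u.memLp_fn.norm.const_mul 2) (fun n => ?_) ?_
    · filter_upwards [hv n, Lp.coeFn_posPart u.1.fst] with x h1 h2
      change ‖(v n).fn x - _‖ ≤ _
      rw [h1, h2]
      refine (norm_sub_le _ _).trans ?_
      rw [two_mul]
      refine add_le_add (abs_rampInt_le n _) ?_
      exact (abs_max_le_max_abs_abs).trans (by simp [W1.fn])
    · filter_upwards [ae_all_iff.2 hv, Lp.coeFn_posPart u.1.fst] with x h1 h2
      rw [h2]
      exact (tendsto_rampInt (u.fn x)).congr fun n => (h1 n).symm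
  have hsnd : Tendsto (fun n => (v n).1.snd) atTop (𝓝 (hmg.toLp _)) := by
    have hle : ∀ n x, ‖ramp n (u.fn x) • u.grad x‖ ≤ ‖u.grad x‖ := fun n x => by
      rw [norm_smul]
      exact mul_le_of_le_one_left (norm_nonneg _) (abs_ramp_le n _)
    refine tendsto_Lp_of_dominated (u.memLp_grad.norm.const_mul 2) (fun n => ?_) ?_
    · filter_upwards [hv' n, hmg.coeFn_toLp] with x h1 h2
      change ‖(v n).grad x - _‖ ≤ _
      rw [h1, h2]
      refine (norm_sub_le _ _).trans ?_
      rw [two_mul]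
      exact add_le_add (hle n x) (norm_indicator_le_norm_self _ _)
    · filter_upwards [ae_all_iff.2 hv', hmg.coeFn_toLp] with x h1 h2
      rw [h2]
      have h3 : {x | 0 < u.fn x}.indicator u.grad x =
          (Ioi (0 : ℝ)).indicator (1 : ℝ → ℝ) (u.fn x) • u.grad x := by
        by_cases hx : 0 < u.fn x
        · rw [indicator_of_mem (show x ∈ {x | 0 < u.fn x} from hx), indicator_of_mem (mem_Ioi.2 hx),
            Pi.one_apply, one_smul]
        · rw [indicator_of_notMem (show x ∉ {x | 0 < u.fn x} from hx),
            indicator_of_notMem (by simpa using hx), zero_smul]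
      rw [h3]
      exact ((tendsto_ramp (u.fn x)).smul_const (u.grad x)).congr fun n => (h1 n).symm
  have hweak := isWeakGradient_of_tendsto hΩ.isBounded hfst hsnd
  let v₀ : W1 Ω p := ⟨WithLp.toLp _ (Lp.posPart u.1.fst, hmg.toLp _), hweak⟩
  have hvlim : Tendsto v atTop (𝓝 v₀) := W1.tendsto_iff.2 ⟨hfst, hsnd⟩
  have htr : trace v₀ = Lp.posPart (trace u) := by
    refine tendsto_nhds_unique (((hΩ.continuous_trace hN).tendsto _).comp hvlim) ?_
    refine tendsto_Lp_of_dominated ((Lp.memLp (trace u)).norm.const_mul 2) (fun n => ?_) ?_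
    · filter_upwards [hvt n, Lp.coeFn_posPart (trace u)] with x h1 h2
      rw [Function.comp_apply, h1, h2]
      refine (norm_sub_le _ _).trans ?_
      rw [two_mul]
      refine add_le_add (abs_rampInt_le n _) ?_
      exact (abs_max_le_max_abs_abs).trans (by simp)
    · filter_upwards [ae_all_iff.2 hvt, Lp.coeFn_posPart (trace u)] with x h1 h2
      rw [h2]
      exact (tendsto_rampInt _).congr fun n => (h1 n).symm
  refine ⟨v₀, Lp.coeFn_posPart u.1.fst, hmg.coeFn_toLp, ?_⟩
  rw [htr]
  exact Lp.coeFn_posPart (trace u)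

theorem W1.norm_posPart_le {u v : W1 Ω p} (h : v.fn =ᵐ[volume.restrict Ω] fun x => max (u.fn x) 0)
    (h' : v.grad =ᵐ[volume.restrict Ω] {x | 0 < u.fn x}.indicator u.grad) : ‖v‖ ≤ ‖u‖ := by
  have hp0 : 0 < p := zero_lt_one.trans hp.out
  refine (Real.rpow_le_rpow_iff (norm_nonneg _) (norm_nonneg _) hp0).1 ?_
  rw [W1.norm_rpow, W1.norm_rpow]
  refine add_le_add (integral_mono_ae (integrable_rpow_norm v.memLp_grad)
    (integrable_rpow_norm u.memLp_grad) ?_) (integral_mono_ae (integrable_rpow_norm v.memLp_fn)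
    (integrable_rpow_norm u.memLp_fn) ?_)
  · filter_upwards [h'] with x hx
    simp only [hx]
    exact Real.rpow_le_rpow (norm_nonneg _) (norm_indicator_le_norm_self _ _) hp0.le
  · filter_upwards [h] with x hx
    simp only [hx]
    exact Real.rpow_le_rpow (abs_nonneg _) (abs_max_le_max_abs_abs.trans (by simp)) hp0.le

/-- Taking traces preserves inequalities. -/
theorem IsC2Domain.trace_mono (hN : 1 ≤ N) (hΩ : IsC2Domain Ω) {u v : W1 Ω p}
    (h : ∀ᵐ x ∂volume.restrict Ω, u.fn x ≤ v.fn x) :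
    ∀ᵐ x ∂surf Ω, trace u x ≤ trace v x := by
  obtain ⟨w, hw, -, hwt⟩ := hΩ.exists_posPart hN (u - v)
  have hw0 : w = 0 := by
    refine W1.ext_fn hΩ.isOpen ?_
    filter_upwards [hw, W1.fn_sub u v, h, W1.fn_zero (Ω := Ω) (p := p)] with x h1 h2 h3 h4
    rw [h1, h2, h4, Pi.sub_apply, Pi.zero_apply]
    exact max_eq_right (by linarith)
  rw [hw0, hΩ.trace_zero hN, hΩ.trace_sub hN] at hwt
  filter_upwards [hwt, Lp.coeFn_zero ℝ (ENNReal.ofReal p) (surf Ω),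
    Lp.coeFn_sub (trace u) (trace v)] with x h1 h2 h3
  rw [h2, h3, Pi.zero_apply, Pi.sub_apply] at h1
  have := le_max_left (trace u x - trace v x) 0
  linarith

/-- The trace of a function bounded above by a constant is bounded by this constant. -/
theorem IsC2Domain.trace_le_const (hN : 1 ≤ N) (hΩ : IsC2Domain Ω) {u : W1 Ω p} {k : ℝ}
    (h : ∀ᵐ x ∂volume.restrict Ω, u.fn x ≤ k) : ∀ᵐ x ∂surf Ω, trace u x ≤ k := by
  obtain ⟨v, hv, -⟩ := W1.exists_of_contDiff (p := p) hΩ.isOpen hΩ.isBounded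
    (contDiff_const (c := k))
  have h1 : ∀ᵐ x ∂volume.restrict Ω, u.fn x ≤ v.fn x := by
    filter_upwards [h, hv] with x h1 h2
    rwa [h2]
  filter_upwards [hΩ.trace_mono hN h1, hΩ.trace_ae_eq_of_contDiff hN contDiff_const hv] with x h2 h3
  rwa [h3] at h2

end


/-! ### Truncated potentials -/

theorem IsCaratheodory.aemeasurable_comp {N : ℕ} {Ω : Set (Euc N)} {f : Euc N → ℝ → ℝ → ℝ}
    (hf : IsCaratheodory Ω f) {s t : Euc N → ℝ} (hs : AEMeasurable s (surf Ω))
    (ht : AEMeasurable t (surf Ω)) : AEMeasurable (fun x => f x (s x) (t x)) (surf Ω) := by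
  -- approximate `(s, t)` by simple functions
  have hst : AEStronglyMeasurable (fun x => (s x, t x)) (surf Ω) :=
    (hs.prodMk ht).aestronglyMeasurable
  set q := hst.mk _ with hq
  have hqs : StronglyMeasurable q := hst.stronglyMeasurable_mk
  refine aemeasurable_of_tendsto_metrizable_ae atTop
    (f := fun n x => f x (hqs.approx n x).1 (hqs.approx n x).2) (fun n => ?_) ?_
  · have h1 : (fun x => f x (hqs.approx n x).1 (hqs.approx n x).2) = fun x =>
        ∑ c ∈ (hqs.approx n).range, (hqs.approx n ⁻¹' {c}).indicator (fun x => f x c.1 c.2) x := by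
      funext x
      rw [Finset.sum_eq_single (hqs.approx n x)]
      · rw [indicator_of_mem (by simp)]
      · intro c _ hc
        exact indicator_of_notMem (fun h => hc (by simpa using h.symm)) _
      · intro h
        exact absurd (SimpleFunc.mem_range_self _ _) h
    rw [h1]
    exact Finset.aemeasurable_fun_sum _ fun c _ =>
      (hf.1 c.1 c.2).indicator ((hqs.approx n).measurableSet_preimage _)
  · filter_upwards [hf.2, hst.ae_eq_mk] with x hx hx'
    have h2 := (hx.tendsto (q x)).comp (hqs.tendsto_approx x)
    have h3 : q x = (s x, t x) := hx'.symm
    rw [h3] at h2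
    exact h2

theorem clamp_mem {a b : ℝ} (hab : a ≤ b) (s : ℝ) : clamp a b s ∈ Icc a b :=
  ⟨le_max_left _ _, max_le hab (min_le_right _ _)⟩

theorem clamp_mono (a b : ℝ) : Monotone (clamp a b) := fun _ _ h =>
  max_le_max le_rfl (min_le_min h le_rfl)

theorem continuous_clamp (a b : ℝ) : Continuous (clamp a b) := by
  unfold clamp
  fun_prop

theorem clamp_of_ge {a b s : ℝ} (hab : a ≤ b) (h : b ≤ s) : clamp a b s = b := by
  rw [clamp, min_eq_right h, max_eq_right hab]

theorem clamp_le_self {a b s : ℝ} (h : a ≤ s) : clamp a b s ≤ s := max_le h (min_le_left _ _)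

theorem self_le_clamp {a b s : ℝ} (h : s ≤ b) : s ≤ clamp a b s := by
  rw [clamp, min_eq_left h]
  exact le_max_right _ _

theorem clamp_nonneg {a b s : ℝ} (hb : 0 ≤ b) (hs : 0 ≤ s) : 0 ≤ clamp a b s :=
  le_max_of_le_right (le_min hs hb)

theorem clamp_nonpos {a b s : ℝ} (ha : a ≤ 0) (hs : s ≤ 0) : clamp a b s ≤ 0 :=
  max_le ha ((min_le_left _ _).trans hs)

theorem abs_clamp_le {a b : ℝ} (ha : a ≤ 0) (hb : 0 ≤ b) (s : ℝ) : |clamp a b s| ≤ |s| := by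
  rcases le_total 0 s with h | h
  · rw [abs_of_nonneg h, abs_of_nonneg (clamp_nonneg hb h)]
    exact clamp_le_self (ha.trans h)
  · rw [abs_of_nonpos h, abs_of_nonpos (clamp_nonpos ha h)]
    linarith [self_le_clamp (a := a) (h.trans hb)]

theorem abs_sub_clamp_le {a b : ℝ} (ha : a ≤ 0) (hb : 0 ≤ b) (s : ℝ) :
    |s - clamp a b s| ≤ |s| := by
  rcases le_total 0 s with h | h
  · rw [abs_of_nonneg h, abs_of_nonneg (sub_nonneg.2 (clamp_le_self (ha.trans h)))]
    linarith [clamp_nonneg (a := a) hb h]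
  · rw [abs_of_nonpos h, abs_of_nonpos (sub_nonpos.2 (self_le_clamp (h.trans hb)))]
    linarith [clamp_nonpos (b := b) ha h]

theorem clamp_neg {a b : ℝ} (hab : a ≤ b) (s : ℝ) : clamp (-b) (-a) s = -clamp a b (-s) := by
  unfold clamp
  rcases le_total (-s) b with h | h <;> rcases le_total (-s) a with h' | h' <;>
  simp [min_def, max_def] <;> split_ifs <;> linarith

/-- A function of class `C¹` on `[a, b]`, continued affinely outside, is Lipschitz with the same
constant. -/
theorem abs_affine_extension_sub_le {h h' : ℝ → ℝ} {a b C : ℝ} (hab : a ≤ b)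
    (hd : ∀ s ∈ Icc a b, HasDerivAt h (h' s) s) (hC : ∀ s ∈ Icc a b, |h' s| ≤ C) (s s' : ℝ) :
    |(h (clamp a b s) + (s - clamp a b s) * h' (clamp a b s)) -
      (h (clamp a b s') + (s' - clamp a b s') * h' (clamp a b s'))| ≤ C * |s - s'| := by
  wlog hss : s' ≤ s generalizing s s'
  · rw [abs_sub_comm, abs_sub_comm s]
    exact this s' s (le_of_not_ge hss)
  have hm := clamp_mem hab s
  have hm' := clamp_mem hab s'
  have hC0 : 0 ≤ C := (abs_nonneg _).trans (hC _ hm)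
  have hlip : |h (clamp a b s) - h (clamp a b s')| ≤ C * |clamp a b s - clamp a b s'| := by
    simpa using (convex_Icc a b).norm_image_sub_le_of_norm_hasDerivWithin_le
      (fun x hx => (hd x hx).hasDerivWithinAt) hC hm' hm
  have hmono := clamp_mono a b hss
  rw [abs_of_nonneg (sub_nonneg.2 hmono)] at hlip
  rw [abs_of_nonneg (sub_nonneg.2 hss)]
  rcases hmono.eq_or_lt with heq | hlt
  · rw [heq, show h (clamp a b s) + (s - clamp a b s) * h' (clamp a b s) -
      (h (clamp a b s) + (s' - clamp a b s) * h' (clamp a b s)) = h' (clamp a b s) * (s - s') by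
      ring, abs_mul, abs_of_nonneg (sub_nonneg.2 hss)]
    exact mul_le_mul_of_nonneg_right (hC _ hm) (sub_nonneg.2 hss)
  · have h1 : clamp a b s ≤ s := by
      by_contra! hlt'
      have : clamp a b s ≤ a := by
        rw [clamp] at hlt' ⊢
        rcases le_total a (min s b) with h | h
        · rw [max_eq_right h] at hlt'
          exact absurd (min_le_left s b) (not_le.2 hlt')
        · rw [max_eq_left h]
      linarith [hm'.1]
    have h2 : s' ≤ clamp a b s' := by
      refine self_le_clamp ?_
      by_contra! hlt'
      rw [clamp_of_ge hab hlt'.le] at hlt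
      linarith [hm.2]
    have h3 := hC _ hm
    have h4 := hC _ hm'
    calc _ = |(h (clamp a b s) - h (clamp a b s')) + (s - clamp a b s) * h' (clamp a b s) +
          (clamp a b s' - s') * h' (clamp a b s')| := by congr 1; ring
      _ ≤ |h (clamp a b s) - h (clamp a b s')| + |(s - clamp a b s) * h' (clamp a b s)| +
          |(clamp a b s' - s') * h' (clamp a b s')| := abs_add_three _ _ _
      _ ≤ C * (clamp a b s - clamp a b s') + (s - clamp a b s) * C + (clamp a b s' - s') * C := by
          rw [abs_mul, abs_mul, abs_of_nonneg (sub_nonneg.2 h1), abs_of_nonneg (sub_nonneg.2 h2)]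
          have := mul_le_mul_of_nonneg_left h3 (sub_nonneg.2 h1)
          have := mul_le_mul_of_nonneg_left h4 (sub_nonneg.2 h2)
          linarith
      _ = C * (s - s') := by ring

/-- The potential `f` on the box `[a₁, b₁] × [a₂, b₂]`, continued linearly in the distance to the
box; `f₁` and `f₂` stand for the partial derivatives of `f`. -/
noncomputable def truncPot (f f₁ f₂ : ℝ → ℝ → ℝ) (a₁ b₁ a₂ b₂ s t : ℝ) : ℝ :=
  f (clamp a₁ b₁ s) (clamp a₂ b₂ t) +
    (s - clamp a₁ b₁ s) * f₁ (clamp a₁ b₁ s) (clamp a₂ b₂ t) +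
    (t - clamp a₂ b₂ t) * f₂ (clamp a₁ b₁ s) (clamp a₂ b₂ t)

/-- The part of `truncPot` that is Lipschitz in the first variable. -/
noncomputable def truncMain (f f₁ : ℝ → ℝ → ℝ) (a₁ b₁ a₂ b₂ s t : ℝ) : ℝ :=
  f (clamp a₁ b₁ s) (clamp a₂ b₂ t) +
    (s - clamp a₁ b₁ s) * f₁ (clamp a₁ b₁ s) (clamp a₂ b₂ t)

/-- The remaining part of `truncPot`. Its dependence on the first variable is through `f₂` only,
for which no modulus of continuity is available. -/
noncomputable def truncRest (f₂ : ℝ → ℝ → ℝ) (a₁ b₁ a₂ b₂ s t : ℝ) : ℝ :=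
  (t - clamp a₂ b₂ t) * f₂ (clamp a₁ b₁ s) (clamp a₂ b₂ t)

/-- A lower bound for the growth in `t` of the increment of `truncRest` in `s`: passing from `t` to
`t + ρ t⁺` increases it by at least `ρ (t - b₂)⁺` times the increment of `f₂(·, b₂)`. -/
theorem le_truncRest_diff {f₂ : ℝ → ℝ → ℝ} {a₁ b₁ a₂ b₂ : ℝ} (h₁ : a₁ ≤ b₁) (ha₂ : a₂ ≤ 0)
    (hb₂ : 0 ≤ b₂) (hm : ∀ t ∈ Icc a₂ b₂, MonotoneOn (fun s => f₂ s t) (Icc a₁ b₁)) {s s' : ℝ}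
    (hs : s' ≤ s) (t : ℝ) {ρ : ℝ} (hρ : 0 ≤ ρ) :
    ρ * (max (t - b₂) 0 * (f₂ (clamp a₁ b₁ s) b₂ - f₂ (clamp a₁ b₁ s') b₂)) ≤
      (truncRest f₂ a₁ b₁ a₂ b₂ s (t + ρ * max t 0) -
        truncRest f₂ a₁ b₁ a₂ b₂ s' (t + ρ * max t 0)) -
      (truncRest f₂ a₁ b₁ a₂ b₂ s t - truncRest f₂ a₁ b₁ a₂ b₂ s' t) := by
  have h₂ : a₂ ≤ b₂ := ha₂.trans hb₂
  have hD : ∀ r ∈ Icc a₂ b₂, 0 ≤ f₂ (clamp a₁ b₁ s) r - f₂ (clamp a₁ b₁ s') r := fun r hr =>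
    sub_nonneg.2 (hm r hr (clamp_mem h₁ s') (clamp_mem h₁ s) (clamp_mono _ _ hs))
  unfold truncRest
  rcases lt_or_ge b₂ t with hbt | hbt
  · have ht0 : 0 ≤ t := hb₂.trans hbt.le
    have h3 : b₂ ≤ t + ρ * t := by nlinarith [mul_nonneg hρ ht0]
    rw [max_eq_left ht0, max_eq_left (by linarith), clamp_of_ge h₂ hbt.le, clamp_of_ge h₂ h3]
    nlinarith [hD b₂ ⟨h₂, le_rfl⟩, mul_nonneg (mul_nonneg hρ hb₂) (hD b₂ ⟨h₂, le_rfl⟩)]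
  · rw [max_eq_right (by linarith : t - b₂ ≤ 0), zero_mul, mul_zero]
    have hDt := hD _ (clamp_mem h₂ t)
    rcases le_total t 0 with ht0 | ht0
    · rw [max_eq_right ht0, mul_zero, add_zero, sub_self]
    · have hDt' := hD _ (clamp_mem h₂ (t + ρ * max t 0))
      have h4 : t - clamp a₂ b₂ t ≤ 0 := by linarith [self_le_clamp (a := a₂) hbt]
      have h5 : 0 ≤ t + ρ * max t 0 - clamp a₂ b₂ (t + ρ * max t 0) := by
        have : 0 ≤ ρ * max t 0 := mul_nonneg hρ (le_max_right _ _)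
        linarith [clamp_le_self (a := a₂) (b := b₂) (s := t + ρ * max t 0) (by linarith)]
      nlinarith [mul_nonneg h5 hDt', mul_nonneg (neg_nonneg.2 h4) hDt]

/-- The increment of `truncRest` between `s` and `s - τ y`, with `y = (V - b₁)⁺`, is nonzero only
where `s - τ y` has dropped below `b₁`; there `y` is at most `(V - s + τ y)⁺`. -/
theorem truncRest_diff_le {f₂ : ℝ → ℝ → ℝ} {a₁ b₁ a₂ b₂ : ℝ} (h₁ : a₁ ≤ b₁) (h₂ : a₂ ≤ b₂)
    (hm : ∀ t ∈ Icc a₂ b₂, MonotoneOn (fun s => f₂ s t) (Icc a₁ b₁)) (s t V : ℝ) {τ : ℝ}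
    (hτ : 0 ≤ τ) :
    truncRest f₂ a₁ b₁ a₂ b₂ s t - truncRest f₂ a₁ b₁ a₂ b₂ (s - τ * max (V - b₁) 0) t ≤
      max (t - b₂) 0 * (f₂ (clamp a₁ b₁ s) b₂ -
        f₂ (clamp a₁ b₁ (s - τ * max (V - s + τ * max (V - b₁) 0) 0)) b₂) := by
  set y := max (V - b₁) 0 with hy
  set ζ := max (V - s + τ * y) 0 with hζ
  have hy0 : 0 ≤ y := le_max_right _ _
  have hζ0 : 0 ≤ ζ := le_max_right _ _
  have hmono : ∀ {s s'}, s' ≤ s → ∀ r ∈ Icc a₂ b₂,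
      f₂ (clamp a₁ b₁ s') r ≤ f₂ (clamp a₁ b₁ s) r := fun h r hr =>
    hm r hr (clamp_mem h₁ _) (clamp_mem h₁ _) (clamp_mono _ _ h)
  have hτy : 0 ≤ τ * y := mul_nonneg hτ hy0
  have hτζ : 0 ≤ τ * ζ := mul_nonneg hτ hζ0
  unfold truncRest
  rcases lt_or_ge b₂ t with hbt | hbt
  · rw [max_eq_left (by linarith), clamp_of_ge h₂ hbt.le, ← mul_sub]
    refine mul_le_mul_of_nonneg_left ?_ (by linarith)
    refine sub_le_sub_left ?_ _
    rcases le_total y ζ with hle | hle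
    · exact hmono (by nlinarith) b₂ ⟨h₂, le_rfl⟩
    · rcases hle.eq_or_lt with heq | hlt
      · rw [heq]
      · -- here `y > ζ`, and `s - τ y` still exceeds `b₁`
        have hypos : 0 < y := hζ0.trans_lt hlt
        have hyV : y = V - b₁ := by
          rcases max_choice (V - b₁) 0 with h | h
          · exact h
          · rw [hy, h] at hypos
            exact absurd hypos (lt_irrefl _)
        have h3 : V - s + τ * y ≤ ζ := le_max_left _ _
        have h4 : b₁ ≤ s - τ * y := by linarith
        have h5 : b₁ ≤ s - τ * ζ := by nlinarith
        rw [clamp_of_ge h₁ h4, clamp_of_ge h₁ h5]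
  · rw [max_eq_right (by linarith : t - b₂ ≤ 0), zero_mul, ← mul_sub]
    have h4 : t - clamp a₂ b₂ t ≤ 0 := by linarith [self_le_clamp (a := a₂) hbt]
    exact mul_nonpos_of_nonpos_of_nonneg h4
      (sub_nonneg.2 (hmono (by linarith) _ (clamp_mem h₂ t)))


/-! ### Boundary integrals of truncated potentials -/

/-- A family of potentials `f x` with partial derivatives `f₁ x`, `f₂ x` on boxes
`[a₁ x, b₁ x] × [a₂ x, b₂ x]` that contain the origin: `f` vanishes at the origin, the partial
derivatives are bounded by `C` on the boxes, and each of them is nondecreasing in the variable with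
respect to which it is not a derivative. -/
structure IsBoxPotential {α : Type*} [MeasurableSpace α] (μ : Measure α) (f f₁ f₂ : α → ℝ → ℝ → ℝ)
    (a₁ b₁ a₂ b₂ : α → ℝ) (C : ℝ) : Prop where
  meas : ∀ s t : α → ℝ, AEMeasurable s μ → AEMeasurable t μ →
    AEMeasurable (fun x => f x (s x) (t x)) μ
  meas₁ : ∀ s t : α → ℝ, AEMeasurable s μ → AEMeasurable t μ →
    AEMeasurable (fun x => f₁ x (s x) (t x)) μ
  meas₂ : ∀ s t : α → ℝ, AEMeasurable s μ → AEMeasurable t μ →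
    AEMeasurable (fun x => f₂ x (s x) (t x)) μ
  meas_a₁ : AEMeasurable a₁ μ
  meas_b₁ : AEMeasurable b₁ μ
  meas_a₂ : AEMeasurable a₂ μ
  meas_b₂ : AEMeasurable b₂ μ
  a₁_nonpos : ∀ᵐ x ∂μ, a₁ x ≤ 0
  b₁_nonneg : ∀ᵐ x ∂μ, 0 ≤ b₁ x
  a₂_nonpos : ∀ᵐ x ∂μ, a₂ x ≤ 0
  b₂_nonneg : ∀ᵐ x ∂μ, 0 ≤ b₂ x
  zero : ∀ᵐ x ∂μ, f x 0 0 = 0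
  deriv₁ : ∀ᵐ x ∂μ, ∀ s t, HasDerivAt (fun s => f x s t) (f₁ x s t) s
  deriv₂ : ∀ᵐ x ∂μ, ∀ s t, HasDerivAt (fun t => f x s t) (f₂ x s t) t
  cont₁ : ∀ᵐ x ∂μ, ∀ s, Continuous fun t => f₁ x s t
  cont₂ : ∀ᵐ x ∂μ, ∀ t, Continuous fun s => f₂ x s t
  bound₁ : ∀ᵐ x ∂μ, ∀ s ∈ Icc (a₁ x) (b₁ x), ∀ t ∈ Icc (a₂ x) (b₂ x), |f₁ x s t| ≤ C
  bound₂ : ∀ᵐ x ∂μ, ∀ s ∈ Icc (a₁ x) (b₁ x), ∀ t ∈ Icc (a₂ x) (b₂ x), |f₂ x s t| ≤ C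
  mono₁ : ∀ᵐ x ∂μ, ∀ s ∈ Icc (a₁ x) (b₁ x), MonotoneOn (fun t => f₁ x s t) (Icc (a₂ x) (b₂ x))
  mono₂ : ∀ᵐ x ∂μ, ∀ t ∈ Icc (a₂ x) (b₂ x), MonotoneOn (fun s => f₂ x s t) (Icc (a₁ x) (b₁ x))

section

variable {α : Type*} [MeasurableSpace α] {μ : Measure α} {f f₁ f₂ : α → ℝ → ℝ → ℝ}
  {a₁ b₁ a₂ b₂ : α → ℝ} {C : ℝ}

/-- The exchange of the two variables. -/
theorem IsBoxPotential.swap (h : IsBoxPotential μ f f₁ f₂ a₁ b₁ a₂ b₂ C) :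
    IsBoxPotential μ (fun x s t => f x t s) (fun x s t => f₂ x t s) (fun x s t => f₁ x t s)
      a₂ b₂ a₁ b₁ C where
  meas s t hs ht := h.meas t s ht hs
  meas₁ s t hs ht := h.meas₂ t s ht hs
  meas₂ s t hs ht := h.meas₁ t s ht hs
  meas_a₁ := h.meas_a₂
  meas_b₁ := h.meas_b₂
  meas_a₂ := h.meas_a₁
  meas_b₂ := h.meas_b₁
  a₁_nonpos := h.a₂_nonpos
  b₁_nonneg := h.b₂_nonneg
  a₂_nonpos := h.a₁_nonpos
  b₂_nonneg := h.b₁_nonneg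
  zero := h.zero
  deriv₁ := h.deriv₂.mono fun _ hx s t => hx t s
  deriv₂ := h.deriv₁.mono fun _ hx s t => hx t s
  cont₁ := h.cont₂
  cont₂ := h.cont₁
  bound₁ := h.bound₂.mono fun _ hx s hs t ht => hx t ht s hs
  bound₂ := h.bound₁.mono fun _ hx s hs t ht => hx t ht s hs
  mono₁ := h.mono₂
  mono₂ := h.mono₁

theorem neg_mem_Icc_of_mem {a b s : ℝ} (hs : s ∈ Icc (-b) (-a)) : -s ∈ Icc a b :=
  ⟨by linarith [hs.2], by linarith [hs.1]⟩

/-- The reflection of both variables at the origin. -/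
theorem IsBoxPotential.reflect (h : IsBoxPotential μ f f₁ f₂ a₁ b₁ a₂ b₂ C) :
    IsBoxPotential μ (fun x s t => f x (-s) (-t)) (fun x s t => -f₁ x (-s) (-t))
      (fun x s t => -f₂ x (-s) (-t)) (-b₁) (-a₁) (-b₂) (-a₂) C where
  meas s t hs ht := h.meas (-s) (-t) hs.neg ht.neg
  meas₁ s t hs ht := (h.meas₁ (-s) (-t) hs.neg ht.neg).neg
  meas₂ s t hs ht := (h.meas₂ (-s) (-t) hs.neg ht.neg).neg
  meas_a₁ := h.meas_b₁.neg
  meas_b₁ := h.meas_a₁.neg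
  meas_a₂ := h.meas_b₂.neg
  meas_b₂ := h.meas_a₂.neg
  a₁_nonpos := h.b₁_nonneg.mono fun _ hx => neg_nonpos.2 hx
  b₁_nonneg := h.a₁_nonpos.mono fun _ hx => neg_nonneg.2 hx
  a₂_nonpos := h.b₂_nonneg.mono fun _ hx => neg_nonpos.2 hx
  b₂_nonneg := h.a₂_nonpos.mono fun _ hx => neg_nonneg.2 hx
  zero := h.zero.mono fun _ hx => by simpa using hx
  deriv₁ := h.deriv₁.mono fun x hx s t => by
    simpa [Function.comp_def] using (hx (-s) (-t)).comp s (hasDerivAt_neg s)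
  deriv₂ := h.deriv₂.mono fun x hx s t => by
    simpa [Function.comp_def] using (hx (-s) (-t)).comp t (hasDerivAt_neg t)
  cont₁ := h.cont₁.mono fun _ hx s => ((hx (-s)).comp continuous_neg).neg
  cont₂ := h.cont₂.mono fun _ hx t => ((hx (-t)).comp continuous_neg).neg
  bound₁ := h.bound₁.mono fun _ hx s hs t ht => by
    rw [abs_neg]
    exact hx _ (neg_mem_Icc_of_mem hs) _ (neg_mem_Icc_of_mem ht)
  bound₂ := h.bound₂.mono fun _ hx s hs t ht => by
    rw [abs_neg]
    exact hx _ (neg_mem_Icc_of_mem hs) _ (neg_mem_Icc_of_mem ht)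
  mono₁ := h.mono₁.mono fun _ hx s hs _ ht _ ht' hle => neg_le_neg
    (hx _ (neg_mem_Icc_of_mem hs) (neg_mem_Icc_of_mem ht') (neg_mem_Icc_of_mem ht)
      (neg_le_neg hle))
  mono₂ := h.mono₂.mono fun _ hx t ht _ hs _ hs' hle => neg_le_neg
    (hx _ (neg_mem_Icc_of_mem ht) (neg_mem_Icc_of_mem hs') (neg_mem_Icc_of_mem hs)
      (neg_le_neg hle))

theorem aemeasurable_clamp {a b s : α → ℝ} (ha : AEMeasurable a μ) (hb : AEMeasurable b μ)
    (hs : AEMeasurable s μ) : AEMeasurable (fun x => clamp (a x) (b x) (s x)) μ :=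
  ha.max (hs.min hb)

namespace IsBoxPotential

theorem aemeasurable_main (h : IsBoxPotential μ f f₁ f₂ a₁ b₁ a₂ b₂ C) {S T : α → ℝ}
    (hS : AEMeasurable S μ) (hT : AEMeasurable T μ) :
    AEMeasurable (fun x => truncMain (f x) (f₁ x) (a₁ x) (b₁ x) (a₂ x) (b₂ x) (S x) (T x)) μ := by
  have h1 := aemeasurable_clamp h.meas_a₁ h.meas_b₁ hS
  have h2 := aemeasurable_clamp h.meas_a₂ h.meas_b₂ hT
  exact (h.meas _ _ h1 h2).add ((hS.sub h1).mul (h.meas₁ _ _ h1 h2))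

theorem aemeasurable_rest (h : IsBoxPotential μ f f₁ f₂ a₁ b₁ a₂ b₂ C) {S T : α → ℝ}
    (hS : AEMeasurable S μ) (hT : AEMeasurable T μ) :
    AEMeasurable (fun x => truncRest (f₂ x) (a₁ x) (b₁ x) (a₂ x) (b₂ x) (S x) (T x)) μ := by
  have h1 := aemeasurable_clamp h.meas_a₁ h.meas_b₁ hS
  have h2 := aemeasurable_clamp h.meas_a₂ h.meas_b₂ hT
  exact (hT.sub h2).mul (h.meas₂ _ _ h1 h2)

/-- `truncMain` is Lipschitz in the first variable. -/
theorem abs_main_sub_le (h : IsBoxPotential μ f f₁ f₂ a₁ b₁ a₂ b₂ C) :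
    ∀ᵐ x ∂μ, ∀ s s' t, |truncMain (f x) (f₁ x) (a₁ x) (b₁ x) (a₂ x) (b₂ x) s t -
      truncMain (f x) (f₁ x) (a₁ x) (b₁ x) (a₂ x) (b₂ x) s' t| ≤ C * |s - s'| := by
  filter_upwards [h.a₁_nonpos, h.b₁_nonneg, h.a₂_nonpos, h.b₂_nonneg, h.deriv₁, h.bound₁] with
    x h1 h2 h3 h4 h5 h6 s s' t
  exact abs_affine_extension_sub_le (h := fun s => f x s (clamp (a₂ x) (b₂ x) t))
    (h' := fun s => f₁ x s (clamp (a₂ x) (b₂ x) t)) (h1.trans h2) (fun s _ => h5 s _)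
    (fun s hs => h6 s hs _ (clamp_mem (h3.trans h4) t)) s s'

theorem abs_main_le (h : IsBoxPotential μ f f₁ f₂ a₁ b₁ a₂ b₂ C) :
    ∀ᵐ x ∂μ, ∀ s t, |truncMain (f x) (f₁ x) (a₁ x) (b₁ x) (a₂ x) (b₂ x) s t| ≤
      C * |s| + C * |t| := by
  filter_upwards [h.a₁_nonpos, h.b₁_nonneg, h.a₂_nonpos, h.b₂_nonneg, h.deriv₂, h.bound₂,
    h.abs_main_sub_le, h.zero] with x h1 h2 h3 h4 h5 h6 h7 h8 s t
  have e1 := h7 s 0 t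
  have e2 : clamp (a₁ x) (b₁ x) 0 = 0 := by rw [clamp, min_eq_left h2, max_eq_right h1]
  have hz : (0 : ℝ) ∈ Icc (a₁ x) (b₁ x) := ⟨h1, h2⟩
  have e3 : truncMain (f x) (f₁ x) (a₁ x) (b₁ x) (a₂ x) (b₂ x) 0 t =
      f x 0 (clamp (a₂ x) (b₂ x) t) := by simp [truncMain, e2]
  have e4 : |f x 0 (clamp (a₂ x) (b₂ x) t)| ≤ C * |clamp (a₂ x) (b₂ x) t| := by
    have := (convex_Icc (a₂ x) (b₂ x)).norm_image_sub_le_of_norm_hasDerivWithin_le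
      (fun t _ => (h5 0 t).hasDerivWithinAt) (fun t ht => h6 0 hz t ht) (⟨h3, h4⟩)
      (clamp_mem (h3.trans h4) t)
    simpa [h8] using this
  have hC : 0 ≤ C := (abs_nonneg _).trans (h6 0 hz 0 ⟨h3, h4⟩)
  have e5 := mul_le_mul_of_nonneg_left (abs_clamp_le h3 h4 t) hC
  rw [sub_zero, e3] at e1
  have e6 := abs_add_le (truncMain (f x) (f₁ x) (a₁ x) (b₁ x) (a₂ x) (b₂ x) s t -
    f x 0 (clamp (a₂ x) (b₂ x) t)) (f x 0 (clamp (a₂ x) (b₂ x) t))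
  rw [sub_add_cancel] at e6
  linarith

theorem abs_rest_le (h : IsBoxPotential μ f f₁ f₂ a₁ b₁ a₂ b₂ C) :
    ∀ᵐ x ∂μ, ∀ s t, |truncRest (f₂ x) (a₁ x) (b₁ x) (a₂ x) (b₂ x) s t| ≤ |t| * C := by
  filter_upwards [h.a₁_nonpos, h.b₁_nonneg, h.a₂_nonpos, h.b₂_nonneg, h.bound₂] with
    x h1 h2 h3 h4 h5 s t
  rw [truncRest, abs_mul]
  exact mul_le_mul (abs_sub_clamp_le h3 h4 t)
    (h5 _ (clamp_mem (h1.trans h2) s) _ (clamp_mem (h3.trans h4) t)) (abs_nonneg _) (abs_nonneg _)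

theorem integrable_main (h : IsBoxPotential μ f f₁ f₂ a₁ b₁ a₂ b₂ C) {S T : α → ℝ}
    (hS : Integrable S μ) (hT : Integrable T μ) :
    Integrable (fun x => truncMain (f x) (f₁ x) (a₁ x) (b₁ x) (a₂ x) (b₂ x) (S x) (T x)) μ := by
  refine ((hS.abs.const_mul C).add (hT.abs.const_mul C)).mono'
    (h.aemeasurable_main hS.aemeasurable hT.aemeasurable).aestronglyMeasurable ?_
  filter_upwards [h.abs_main_le] with x hx
  exact hx _ _

theorem integrable_rest (h : IsBoxPotential μ f f₁ f₂ a₁ b₁ a₂ b₂ C) {S T : α → ℝ}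
    (hS : Integrable S μ) (hT : Integrable T μ) :
    Integrable (fun x => truncRest (f₂ x) (a₁ x) (b₁ x) (a₂ x) (b₂ x) (S x) (T x)) μ := by
  refine (hT.abs.mul_const C).mono'
    (h.aemeasurable_rest hS.aemeasurable hT.aemeasurable).aestronglyMeasurable ?_
  filter_upwards [h.abs_rest_le] with x hx
  exact hx _ _

/-- The integral of the truncated potential along the boundary values `S`, `T`. -/
theorem integral_truncPot (h : IsBoxPotential μ f f₁ f₂ a₁ b₁ a₂ b₂ C) {S T : α → ℝ}
    (hS : Integrable S μ) (hT : Integrable T μ) :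
    ∫ x, truncPot (f x) (f₁ x) (f₂ x) (a₁ x) (b₁ x) (a₂ x) (b₂ x) (S x) (T x) ∂μ =
      (∫ x, truncMain (f x) (f₁ x) (a₁ x) (b₁ x) (a₂ x) (b₂ x) (S x) (T x) ∂μ) +
        ∫ x, truncRest (f₂ x) (a₁ x) (b₁ x) (a₂ x) (b₂ x) (S x) (T x) ∂μ := by
  rw [← integral_add (h.integrable_main hS hT) (h.integrable_rest hS hT)]
  rfl

theorem abs_integral_main_sub_le (h : IsBoxPotential μ f f₁ f₂ a₁ b₁ a₂ b₂ C) {S S' T : α → ℝ}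
    (hS : Integrable S μ) (hS' : Integrable S' μ) (hT : Integrable T μ) :
    |(∫ x, truncMain (f x) (f₁ x) (a₁ x) (b₁ x) (a₂ x) (b₂ x) (S x) (T x) ∂μ) -
      ∫ x, truncMain (f x) (f₁ x) (a₁ x) (b₁ x) (a₂ x) (b₂ x) (S' x) (T x) ∂μ| ≤
      C * ∫ x, |S x - S' x| ∂μ := by
  rw [← integral_sub (h.integrable_main hS hT) (h.integrable_main hS' hT), ← integral_const_mul,
    ← Real.norm_eq_abs]
  refine norm_integral_le_of_norm_le ((hS.sub hS').abs.const_mul C) ?_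
  filter_upwards [h.abs_main_sub_le] with x hx
  exact hx _ _ _

/-- Integrability of the weighted increment of `f₂(·, b₂)` that controls `truncRest`. -/
theorem integrable_excess (h : IsBoxPotential μ f f₁ f₂ a₁ b₁ a₂ b₂ C) {S S' T : α → ℝ}
    (hS : Integrable S μ) (hS' : Integrable S' μ) (hT : Integrable T μ) :
    Integrable (fun x => max (T x - b₂ x) 0 * (f₂ x (clamp (a₁ x) (b₁ x) (S x)) (b₂ x) -
      f₂ x (clamp (a₁ x) (b₁ x) (S' x)) (b₂ x))) μ := by
  have h1 := aemeasurable_clamp h.meas_a₁ h.meas_b₁ hS.aemeasurable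
  have h2 := aemeasurable_clamp h.meas_a₁ h.meas_b₁ hS'.aemeasurable
  refine (hT.abs.mul_const (2 * C)).mono' ((((hT.aemeasurable.sub h.meas_b₂).max
    aemeasurable_const).mul ((h.meas₂ _ _ h1 h.meas_b₂).sub
      (h.meas₂ _ _ h2 h.meas_b₂))).aestronglyMeasurable) ?_
  filter_upwards [h.a₁_nonpos, h.b₁_nonneg, h.a₂_nonpos, h.b₂_nonneg, h.bound₂] with
    x h1 h2 h3 h4 h5
  have e1 := h5 _ (clamp_mem (h1.trans h2) (S x)) (b₂ x) ⟨h3.trans h4, le_rfl⟩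
  have e2 := h5 _ (clamp_mem (h1.trans h2) (S' x)) (b₂ x) ⟨h3.trans h4, le_rfl⟩
  rw [norm_mul]
  refine mul_le_mul ?_ ((norm_sub_le _ _).trans ?_) (norm_nonneg _) (abs_nonneg _)
  · rw [Real.norm_of_nonneg (le_max_right _ _)]
    refine max_le ?_ (abs_nonneg _)
    linarith [le_abs_self (T x)]
  · simp only [Real.norm_eq_abs]
    linarith

/-- The integrated form of `le_truncRest_diff`. -/
theorem le_integral_rest_diff (h : IsBoxPotential μ f f₁ f₂ a₁ b₁ a₂ b₂ C) {S S' T : α → ℝ}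
    (hS : Integrable S μ) (hS' : Integrable S' μ) (hT : Integrable T μ)
    (hle : ∀ᵐ x ∂μ, S' x ≤ S x) {ρ : ℝ} (hρ : 0 ≤ ρ) :
    ρ * ∫ x, max (T x - b₂ x) 0 * (f₂ x (clamp (a₁ x) (b₁ x) (S x)) (b₂ x) -
        f₂ x (clamp (a₁ x) (b₁ x) (S' x)) (b₂ x)) ∂μ ≤
      ((∫ x, truncRest (f₂ x) (a₁ x) (b₁ x) (a₂ x) (b₂ x) (S x) (T x + ρ * max (T x) 0) ∂μ) -
        ∫ x, truncRest (f₂ x) (a₁ x) (b₁ x) (a₂ x) (b₂ x) (S' x) (T x + ρ * max (T x) 0) ∂μ) -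
      ((∫ x, truncRest (f₂ x) (a₁ x) (b₁ x) (a₂ x) (b₂ x) (S x) (T x) ∂μ) -
        ∫ x, truncRest (f₂ x) (a₁ x) (b₁ x) (a₂ x) (b₂ x) (S' x) (T x) ∂μ) := by
  have hT' : Integrable (fun x => T x + ρ * max (T x) 0) μ := hT.add (hT.pos_part.const_mul ρ)
  have i1 := h.integrable_rest hS hT'
  have i2 := h.integrable_rest hS' hT'
  have i3 := h.integrable_rest hS hT
  have i4 := h.integrable_rest hS' hT
  have i5 := Integrable.sub' i1 i2
  have i6 := Integrable.sub' i3 i4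
  rw [← integral_sub i1 i2, ← integral_sub i3 i4, ← integral_sub i5 i6, ← integral_const_mul]
  refine integral_mono_ae ((h.integrable_excess hS hS' hT).const_mul ρ) (i5.sub i6) ?_
  filter_upwards [h.a₁_nonpos, h.b₁_nonneg, h.a₂_nonpos, h.b₂_nonneg, h.mono₂, hle] with
    x h1 h2 h3 h4 h5 h6
  exact le_truncRest_diff (h1.trans h2) h3 h4 h5 h6 _ hρ

/-- The integrated form of `truncRest_diff_le`. -/
theorem integral_rest_diff_le (h : IsBoxPotential μ f f₁ f₂ a₁ b₁ a₂ b₂ C)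
    {S T V Y Z : α → ℝ} {τ : ℝ} (hS : Integrable S μ) (hT : Integrable T μ) (hYi : Integrable Y μ)
    (hZi : Integrable Z μ) (hτ : 0 ≤ τ) (hY : ∀ᵐ x ∂μ, Y x = max (V x - b₁ x) 0)
    (hZ : ∀ᵐ x ∂μ, Z x = max (V x - S x + τ * Y x) 0) :
    (∫ x, truncRest (f₂ x) (a₁ x) (b₁ x) (a₂ x) (b₂ x) (S x) (T x) ∂μ) -
      ∫ x, truncRest (f₂ x) (a₁ x) (b₁ x) (a₂ x) (b₂ x) (S x - τ * Y x) (T x) ∂μ ≤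
    ∫ x, max (T x - b₂ x) 0 * (f₂ x (clamp (a₁ x) (b₁ x) (S x)) (b₂ x) -
        f₂ x (clamp (a₁ x) (b₁ x) (S x - τ * Z x)) (b₂ x)) ∂μ := by
  have hSY : Integrable (fun x => S x - τ * Y x) μ := hS.sub (hYi.const_mul τ)
  have hSZ : Integrable (fun x => S x - τ * Z x) μ := hS.sub (hZi.const_mul τ)
  rw [← integral_sub (h.integrable_rest hS hT) (h.integrable_rest hSY hT)]
  refine integral_mono_ae ((h.integrable_rest hS hT).sub (h.integrable_rest hSY hT))
    (h.integrable_excess hS hSZ hT) ?_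
  filter_upwards [h.a₁_nonpos, h.b₁_nonneg, h.a₂_nonpos, h.b₂_nonneg, h.mono₂, hY, hZ] with
    x h1 h2 h3 h4 h5 h6 h7
  simp only [h7, h6]
  exact truncRest_diff_le (h1.trans h2) (h3.trans h4) h5 _ _ _ hτ

/-- The difference quotients of `truncMain` in the direction `-Y`, with `Y` supported where the
first variable exceeds `b₁`, have a limit that is at most the integral of `f₁(·, b₁, b₂) Y`. -/
theorem exists_tendsto_main_quotient (h : IsBoxPotential μ f f₁ f₂ a₁ b₁ a₂ b₂ C)
    {S T : ℕ → α → ℝ} {V W Y : α → ℝ} {τ : ℕ → ℝ} (hS : ∀ n, Integrable (S n) μ)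
    (hT : ∀ n, Integrable (T n) μ) (hWm : AEMeasurable W μ) (hYi : Integrable Y μ)
    (hY : ∀ᵐ x ∂μ, Y x = max (V x - b₁ x) 0) (hτ : ∀ n, 0 < τ n) (hτ0 : Tendsto τ atTop (𝓝 0))
    (hSV : ∀ᵐ x ∂μ, Tendsto (fun n => S n x) atTop (𝓝 (V x)))
    (hTW : ∀ᵐ x ∂μ, Tendsto (fun n => T n x) atTop (𝓝 (W x))) :
    ∃ l, Tendsto (fun n =>
      ((∫ x, truncMain (f x) (f₁ x) (a₁ x) (b₁ x) (a₂ x) (b₂ x) (S n x) (T n x) ∂μ) -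
        ∫ x, truncMain (f x) (f₁ x) (a₁ x) (b₁ x) (a₂ x) (b₂ x) (S n x - τ n * Y x) (T n x) ∂μ) /
          τ n) atTop (𝓝 l) ∧ l ≤ ∫ x, f₁ x (b₁ x) (b₂ x) * Y x ∂μ := by
  have hSY : ∀ n, Integrable (fun x => S n x - τ n * Y x) μ := fun n =>
    (hS n).sub (hYi.const_mul _)
  have hWc := aemeasurable_clamp h.meas_a₂ h.meas_b₂ hWm
  have hint : ∀ r : α → ℝ, AEMeasurable r μ → (∀ᵐ x ∂μ, r x ∈ Icc (a₂ x) (b₂ x)) →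
      Integrable (fun x => f₁ x (b₁ x) (r x) * Y x) μ := fun r hr hr' => by
    refine (hYi.abs.const_mul C).mono'
      ((h.meas₁ _ _ h.meas_b₁ hr).mul hYi.aemeasurable).aestronglyMeasurable ?_
    filter_upwards [h.a₁_nonpos, h.b₁_nonneg, h.bound₁, hr'] with x h1 h2 h3 h4
    rw [norm_mul]
    exact mul_le_mul_of_nonneg_right (h3 _ ⟨h1.trans h2, le_rfl⟩ _ h4) (norm_nonneg _)
  refine ⟨∫ x, f₁ x (b₁ x) (clamp (a₂ x) (b₂ x) (W x)) * Y x ∂μ, ?_, ?_⟩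
  · have h1 : Tendsto (fun n => ∫ x,
        (truncMain (f x) (f₁ x) (a₁ x) (b₁ x) (a₂ x) (b₂ x) (S n x) (T n x) -
          truncMain (f x) (f₁ x) (a₁ x) (b₁ x) (a₂ x) (b₂ x) (S n x - τ n * Y x) (T n x)) / τ n ∂μ)
        atTop (𝓝 (∫ x, f₁ x (b₁ x) (clamp (a₂ x) (b₂ x) (W x)) * Y x ∂μ)) := by
      refine tendsto_integral_of_dominated_convergence (fun x => C * |Y x|) (fun n => ?_)
        (hYi.abs.const_mul C) (fun n => ?_) ?_
      · exact (((h.integrable_main (hS n) (hT n)).sub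
          (h.integrable_main (hSY n) (hT n))).div_const (τ n)).aestronglyMeasurable
      · filter_upwards [h.abs_main_sub_le] with x hx
        rw [norm_div, Real.norm_of_nonneg (hτ n).le, div_le_iff₀ (hτ n)]
        refine (hx _ _ _).trans (le_of_eq ?_)
        rw [sub_sub_cancel, abs_mul, abs_of_pos (hτ n)]
        ring
      · filter_upwards [h.a₁_nonpos, h.b₁_nonneg, h.cont₁, hY, hSV, hTW] with x h1 h2 h3 h4 h5 h6
        have hab := h1.trans h2
        rcases le_or_gt (V x) (b₁ x) with hV | hV
        · have hY0 : Y x = 0 := by rw [h4, max_eq_right (by linarith)]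
          simp [hY0]
        · -- here both points of the difference quotient eventually exceed `b₁`
          have hYp : 0 < Y x := by
            rw [h4]
            exact lt_max_of_lt_left (by linarith)
          have h7 : Tendsto (fun n => S n x - τ n * Y x) atTop (𝓝 (V x)) := by
            simpa using h5.sub (hτ0.mul_const (Y x))
          have h8 : Tendsto (fun n => f₁ x (b₁ x) (clamp (a₂ x) (b₂ x) (T n x)) * Y x) atTop
              (𝓝 (f₁ x (b₁ x) (clamp (a₂ x) (b₂ x) (W x)) * Y x)) :=
            ((((h3 (b₁ x)).comp (continuous_clamp _ _)).tendsto (W x)).comp h6).mul_const _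
          refine h8.congr' ?_
          filter_upwards [h7.eventually_const_lt hV] with n hn
          have hτY : 0 < τ n * Y x := mul_pos (hτ n) hYp
          have hn' : b₁ x ≤ S n x := by linarith
          have hτn := (hτ n).ne'
          rw [truncMain, truncMain, clamp_of_ge hab hn.le, clamp_of_ge hab hn']
          field_simp
          ring
    refine h1.congr fun n => ?_
    rw [integral_div, integral_sub (h.integrable_main (hS n) (hT n))
      (h.integrable_main (hSY n) (hT n))]
  · have hc : ∀ᵐ x ∂μ, clamp (a₂ x) (b₂ x) (W x) ∈ Icc (a₂ x) (b₂ x) := by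
      filter_upwards [h.a₂_nonpos, h.b₂_nonneg] with x h1 h2
      exact clamp_mem (h1.trans h2) _
    have hb : ∀ᵐ x ∂μ, b₂ x ∈ Icc (a₂ x) (b₂ x) := by
      filter_upwards [h.a₂_nonpos, h.b₂_nonneg] with x h1 h2
      exact ⟨h1.trans h2, le_rfl⟩
    -- `f₁(b₁, ·)` is nondecreasing
    refine integral_mono_ae (hint _ hWc hc) (hint _ h.meas_b₂ hb) ?_
    filter_upwards [h.a₁_nonpos, h.b₁_nonneg, h.mono₁, hY, hc, hb] with x h1 h2 h3 h4 h5 h6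
    have hY0 : 0 ≤ Y x := by
      rw [h4]
      exact le_max_right _ _
    exact mul_le_mul_of_nonneg_right (h3 _ ⟨h1.trans h2, le_rfl⟩ h5 h6 h5.2) hY0

end IsBoxPotential

end


/-! ### Convexity of the norm term -/

/-- Strict convexity of `s ↦ s ^ p` on `[0, ∞)`, in terms of tangents. -/
theorem add_mul_rpow_mul_sub_lt_rpow {p A B : ℝ} (hp : 1 < p) (hA : 0 ≤ A) (hB : 0 ≤ B)
    (hAB : B ≠ A) : A ^ p + p * (A ^ (p - 1) * (B - A)) < B ^ p := by
  rcases hA.eq_or_lt with rfl | hA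
  · rw [Real.zero_rpow (by linarith), Real.zero_rpow (by linarith)]
    simpa using Real.rpow_pos_of_pos (lt_of_le_of_ne hB hAB.symm) p
  · have h := one_add_mul_self_lt_rpow_one_add (s := (B - A) / A)
      (by rw [le_div_iff₀ hA]; linarith) (div_ne_zero (sub_ne_zero.2 hAB) hA.ne') hp
    have h1 : 1 + (B - A) / A = B / A := by field_simp; ring
    rw [h1, Real.div_rpow hB hA.le, lt_div_iff₀ (Real.rpow_pos_of_pos hA p)] at h
    refine lt_of_eq_of_lt ?_ h
    rw [Real.rpow_sub_one hA.ne']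
    field_simp

theorem rpow_sub_two_mul_self {p a : ℝ} (hp : 1 < p) (ha : 0 ≤ a) :
    a ^ (p - 2) * a = a ^ (p - 1) := by
  rcases ha.eq_or_lt with rfl | ha
  · rw [mul_zero, Real.zero_rpow (by linarith)]
  · rw [← Real.rpow_add_one ha.ne']
    congr 1
    ring

/-- The function `|·|^p / p` on an inner product space lies above its tangents. -/
theorem rpow_norm_add_inner_le {E : Type*} [NormedAddCommGroup E] [InnerProductSpace ℝ E] {p : ℝ}
    (hp : 1 < p) (a c : E) :
    1 / p * ‖a‖ ^ p + ‖a‖ ^ (p - 2) * inner ℝ a (c - a) ≤ 1 / p * ‖c‖ ^ p := by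
  have hp0 : 0 < p := by linarith
  have h1 : ‖a‖ ^ (p - 2) * inner ℝ a (c - a) ≤ ‖a‖ ^ (p - 1) * (‖c‖ - ‖a‖) := by
    rw [← rpow_sub_two_mul_self hp (norm_nonneg a), mul_assoc, inner_sub_right,
      real_inner_self_eq_norm_sq]
    refine mul_le_mul_of_nonneg_left ?_ (by positivity)
    linarith [real_inner_le_norm a c]
  have h2 : ‖a‖ ^ p + p * (‖a‖ ^ (p - 1) * (‖c‖ - ‖a‖)) ≤ ‖c‖ ^ p := by
    by_cases h : ‖c‖ = ‖a‖
    · rw [h]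
      simp
    · exact (add_mul_rpow_mul_sub_lt_rpow hp (norm_nonneg a) (norm_nonneg c) h).le
  have h3 := mul_le_mul_of_nonneg_left h2 (by positivity : 0 ≤ 1 / p)
  have h4 : 1 / p * (‖a‖ ^ p + p * (‖a‖ ^ (p - 1) * (‖c‖ - ‖a‖))) =
      1 / p * ‖a‖ ^ p + ‖a‖ ^ (p - 1) * (‖c‖ - ‖a‖) := by
    field_simp
  linarith

theorem rpow_abs_add_mul_lt {p a c : ℝ} (hp : 1 < p) (ha : 0 ≤ a) (hac : a < c) :
    1 / p * |a| ^ p + |a| ^ (p - 2) * a * (c - a) < 1 / p * |c| ^ p := by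
  have hp0 : 0 < p := by linarith
  have h2 := add_mul_rpow_mul_sub_lt_rpow hp ha (ha.trans hac.le) hac.ne'
  have h3 := mul_lt_mul_of_pos_left h2 (by positivity : 0 < 1 / p)
  have h4 : 1 / p * (a ^ p + p * (a ^ (p - 1) * (c - a))) =
      1 / p * a ^ p + a ^ (p - 1) * (c - a) := by
    field_simp
  rw [abs_of_nonneg ha, abs_of_nonneg (ha.trans hac.le), rpow_sub_two_mul_self hp ha]
  linarith

/-- The difference quotients of a power of the norm are monotone. -/
theorem rpow_norm_sub_smul_sub_le {E : Type*} [NormedAddCommGroup E] [NormedSpace ℝ E] {p : ℝ}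
    (hp : 1 < p) (z y : E) {t : ℝ} (ht0 : 0 ≤ t) (ht1 : t ≤ 1) :
    1 / p * ‖z - t • y‖ ^ p - 1 / p * ‖z‖ ^ p ≤
      t * (1 / p * ‖z - y‖ ^ p - 1 / p * ‖z‖ ^ p) := by
  have hp0 : 0 < p := by linarith
  have h1 : ‖z - t • y‖ ≤ (1 - t) * ‖z‖ + t * ‖z - y‖ := by
    calc ‖z - t • y‖ = ‖(1 - t) • z + t • (z - y)‖ := by
          congr 1
          rw [sub_smul, smul_sub, one_smul]
          abel
      _ ≤ ‖(1 - t) • z‖ + ‖t • (z - y)‖ := norm_add_le _ _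
      _ = _ := by
          rw [norm_smul, norm_smul, Real.norm_of_nonneg ht0, Real.norm_of_nonneg (by linarith)]
  have h2 : ‖z - t • y‖ ^ p ≤ (1 - t) * ‖z‖ ^ p + t * ‖z - y‖ ^ p :=
    (Real.rpow_le_rpow (norm_nonneg _) h1 hp0.le).trans
      ((convexOn_rpow hp.le).2 (norm_nonneg z) (norm_nonneg (z - y)) (by linarith) ht0 (by ring))
  have h3 := mul_le_mul_of_nonneg_left h2 (by positivity : 0 ≤ 1 / p)
  linarith

section

variable {N : ℕ} {Ω : Set (Euc N)} {p : ℝ} [hp : Fact (1 < p)]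

/-- Let `y = (v - b)⁺` with `b ≥ 0`. If the norm term drops, on passing from `v` to `v - y`, by no
more than its derivative at `b` in the direction `y`, then `v ≤ b`: by strict convexity, the drop is
larger wherever `v > b`. -/
theorem W1.le_of_tangent_nonneg {v b y : W1 Ω p}
    (hy : y.fn =ᵐ[volume.restrict Ω] fun x => max ((v - b).fn x) 0)
    (hy' : y.grad =ᵐ[volume.restrict Ω] {x | 0 < (v - b).fn x}.indicator (v - b).grad)
    (hb : ∀ᵐ x ∂volume.restrict Ω, 0 ≤ b.fn x) (hi : IntegrableOn (gradTerm b y) Ω)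
    (hi' : IntegrableOn (massTerm b y) Ω)
    (h : 0 ≤ 1 / p * ‖v - y‖ ^ p - 1 / p * ‖v‖ ^ p +
      ((∫ x in Ω, gradTerm b y x) + ∫ x in Ω, massTerm b y x)) :
    ∀ᵐ x ∂volume.restrict Ω, v.fn x ≤ b.fn x := by
  have hp1 := hp.out
  have i1 := (integrable_rpow_norm (v - y).memLp_grad).const_mul (1 / p)
  have i2 := (integrable_rpow_norm v.memLp_grad).const_mul (1 / p)
  have i3 := (integrable_rpow_norm (v - y).memLp_fn).const_mul (1 / p)
  have i4 := (integrable_rpow_norm v.memLp_fn).const_mul (1 / p)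
  have i5 := (Integrable.sub' i2 i1).sub' hi
  have i6 := (Integrable.sub' i4 i3).sub' hi'
  have hG : ∀ᵐ x ∂volume.restrict Ω, 0 ≤ 1 / p * ‖v.grad x‖ ^ p - 1 / p * ‖(v - y).grad x‖ ^ p -
      gradTerm b y x := by
    filter_upwards [hy', W1.grad_sub v b, W1.grad_sub v y] with x h1 h2 h3
    rw [gradTerm, h3, Pi.sub_apply, h1]
    by_cases hx : x ∈ {x | 0 < (v - b).fn x}
    · rw [indicator_of_mem hx, h2, Pi.sub_apply, sub_sub_cancel]
      linarith [rpow_norm_add_inner_le hp1 (b.grad x) (v.grad x)]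
    · rw [indicator_of_notMem hx]
      simp
  have hM' : ∀ᵐ x ∂volume.restrict Ω,
      (0 ≤ 1 / p * ‖v.fn x‖ ^ p - 1 / p * ‖(v - y).fn x‖ ^ p - massTerm b y x) ∧
      (1 / p * ‖v.fn x‖ ^ p - 1 / p * ‖(v - y).fn x‖ ^ p - massTerm b y x = 0 →
        v.fn x ≤ b.fn x) := by
    filter_upwards [hy, W1.fn_sub v b, W1.fn_sub v y, hb] with x h1 h2 h3 h4
    rw [massTerm, h3, Pi.sub_apply, h1, h2, Pi.sub_apply]
    rcases le_or_gt (v.fn x) (b.fn x) with hx | hx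
    · rw [max_eq_right (by linarith)]
      simpa using hx
    · rw [max_eq_left (by linarith), sub_sub_cancel]
      have := rpow_abs_add_mul_lt hp1 h4 hx
      simp only [Real.norm_eq_abs]
      exact ⟨by linarith, fun h => by linarith⟩
  have hM := hM'.mono fun _ hx => hx.1
  have e1 := integral_nonneg_of_ae hG
  have e2 := integral_nonneg_of_ae hM
  -- both integrands are nonnegative and the sum of the integrals is nonpositive
  have e3 : (∫ x in Ω, 1 / p * ‖v.fn x‖ ^ p - 1 / p * ‖(v - y).fn x‖ ^ p - massTerm b y x) = 0 := by
    refine le_antisymm ?_ e2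
    rw [integral_sub (i2.sub' i1) hi, integral_sub i2 i1, integral_const_mul,
      integral_const_mul] at e1
    rw [integral_sub (i4.sub' i3) hi', integral_sub i4 i3, integral_const_mul, integral_const_mul]
    rw [W1.norm_rpow, W1.norm_rpow] at h
    simp only [Real.norm_eq_abs] at *
    linarith
  have e4 := (integral_eq_zero_iff_of_nonneg_ae hM i6).1 e3
  filter_upwards [e4, hM'] with x h1 h2
  exact h2.2 h1

end

/-! ### Criticality in one component -/

/-- The information on a critical point `(v₁, v₂)` of a functional on a product that is used for
variations of the first component: a Lipschitz estimate near `(v₁, v₂)`, and the existence of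
difference quotients at nearby points whose lower limit is nonnegative. -/
def PartialCritical {X Y : Type*} [NormedAddCommGroup X] [NormedSpace ℝ X] [NormedAddCommGroup Y]
    (E : X → Y → ℝ) (v₁ : X) (v₂ : Y) : Prop :=
  (∃ K, ∃ δ > 0, ∀ w, ‖w - v₁‖ < δ → ∀ w', ‖w' - v₁‖ < δ → ∀ w₂, ‖w₂ - v₂‖ < δ →
    |E w w₂ - E w' w₂| ≤ K * ‖w - w'‖) ∧
  ∀ y, ∃ (z₁ : ℕ → X) (z₂ : ℕ → Y) (τ ε : ℕ → ℝ), Tendsto z₁ atTop (𝓝 v₁) ∧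
    Tendsto z₂ atTop (𝓝 v₂) ∧ (∀ n, 0 < τ n) ∧ Tendsto τ atTop (𝓝 0) ∧ Tendsto ε atTop (𝓝 0) ∧
    ∀ n, -ε n * τ n ≤ E (z₁ n + τ n • y) (z₂ n) - E (z₁ n) (z₂ n)

section

variable {X Y : Type*} [NormedAddCommGroup X] [NormedSpace ℝ X] [NormedAddCommGroup Y]

/-- At a critical point there are difference quotients, at nearby points and with small steps, whose
lower limit is nonnegative. The Lipschitz continuity bounds the difference quotients, so that the
upper limit in `clarkeDeriv` is not a default value. -/
theorem IsCriticalPoint.exists_seq {f : X → ℝ} {v : X} (h : IsCriticalPoint f v) (y : X) :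
    ∃ (z : ℕ → X) (τ ε : ℕ → ℝ), Tendsto z atTop (𝓝 v) ∧ (∀ n, 0 < τ n) ∧
      Tendsto τ atTop (𝓝 0) ∧ Tendsto ε atTop (𝓝 0) ∧
      ∀ n, -ε n * τ n ≤ f (z n + τ n • y) - f (z n) := by
  obtain ⟨⟨K, U, hU, hK⟩, hc⟩ := h
  have hc' : 0 ≤ clarkeDeriv f v y := hc y
  have t1 : Tendsto (fun q : X × ℝ => q.1) (𝓝 v ×ˢ 𝓝[>] (0 : ℝ)) (𝓝 v) := tendsto_fst
  have t2 : Tendsto (fun q : X × ℝ => q.2) (𝓝 v ×ˢ 𝓝[>] (0 : ℝ)) (𝓝[>] 0) := tendsto_snd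
  have t2' : Tendsto (fun q : X × ℝ => q.2) (𝓝 v ×ˢ 𝓝[>] (0 : ℝ)) (𝓝 0) :=
    t2.mono_right nhdsWithin_le_nhds
  have hpos : ∀ᶠ q : X × ℝ in 𝓝 v ×ˢ 𝓝[>] (0 : ℝ), 0 < q.2 := t2.eventually self_mem_nhdsWithin
  have t3 : Tendsto (fun q : X × ℝ => q.1 + q.2 • y) (𝓝 v ×ˢ 𝓝[>] (0 : ℝ)) (𝓝 v) := by
    simpa using t1.add (t2'.smul_const y)
  have hb : ∀ᶠ q : X × ℝ in 𝓝 v ×ˢ 𝓝[>] (0 : ℝ),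
      -(K * ‖y‖) ≤ (f (q.1 + q.2 • y) - f q.1) / q.2 := by
    filter_upwards [t1.eventually hU, t3.eventually hU, hpos] with q h1 h2 h3
    have h4 := hK.dist_le_mul _ h2 _ h1
    rw [dist_eq_norm, dist_eq_norm, add_sub_cancel_left, norm_smul, Real.norm_of_nonneg h3.le] at h4
    rw [le_div_iff₀ h3]
    have := (abs_le.1 h4).1
    linarith
  have hcob : IsCoboundedUnder (· ≤ ·) (𝓝 v ×ˢ 𝓝[>] (0 : ℝ))
      (fun q : X × ℝ => (f (q.1 + q.2 • y) - f q.1) / q.2) :=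
    IsBoundedUnder.isCoboundedUnder_le ⟨_, hb⟩
  have hex : ∀ n : ℕ, ∃ q : X × ℝ, -(1 / ((n : ℝ) + 1)) < (f (q.1 + q.2 • y) - f q.1) / q.2 ∧
      ‖q.1 - v‖ < 1 / ((n : ℝ) + 1) ∧ q.2 < 1 / ((n : ℝ) + 1) ∧ 0 < q.2 := fun n => by
    have hn : 0 < 1 / ((n : ℝ) + 1) := Nat.one_div_pos_of_nat
    have h1 := frequently_lt_of_lt_limsup hcob
      (lt_of_lt_of_le (neg_lt_zero.2 hn) hc' :
        -(1 / ((n : ℝ) + 1)) < limsup _ (𝓝 v ×ˢ 𝓝[>] (0 : ℝ)))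
    have h2 : ∀ᶠ q : X × ℝ in 𝓝 v ×ˢ 𝓝[>] (0 : ℝ), ‖q.1 - v‖ < 1 / ((n : ℝ) + 1) := by
      have := t1.eventually (Metric.ball_mem_nhds v hn)
      simpa [dist_eq_norm] using this
    have h3 : ∀ᶠ q : X × ℝ in 𝓝 v ×ˢ 𝓝[>] (0 : ℝ), q.2 < 1 / ((n : ℝ) + 1) :=
      t2'.eventually (Iio_mem_nhds hn)
    obtain ⟨q, h4, h5, h6, h7⟩ := (h1.and_eventually (h2.and (h3.and hpos))).exists
    exact ⟨q, h4, h5, h6, h7⟩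
  choose q h1 h2 h3 h4 using hex
  have hlim : Tendsto (fun n : ℕ => 1 / ((n : ℝ) + 1)) atTop (𝓝 0) :=
    tendsto_one_div_add_atTop_nhds_zero_nat
  refine ⟨fun n => (q n).1, fun n => (q n).2, fun n => 1 / ((n : ℝ) + 1), ?_, h4, ?_, hlim,
    fun n => ?_⟩
  · exact tendsto_iff_norm_sub_tendsto_zero.2 (squeeze_zero (fun _ => norm_nonneg _)
      (fun n => (h2 n).le) hlim)
  · exact squeeze_zero (fun n => (h4 n).le) (fun n => (h3 n).le) hlim
  · exact ((lt_div_iff₀ (h4 n)).1 (h1 n)).le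

theorem LipschitzNear.exists_abs_sub_le {Z : Type*} [NormedAddCommGroup Z] {f : Z → ℝ} {v : Z}
    (h : LipschitzNear f v) :
    ∃ K : ℝ, ∃ δ > 0, ∀ w, ‖w - v‖ < δ → ∀ w', ‖w' - v‖ < δ → |f w - f w'| ≤ K * ‖w - w'‖ := by
  obtain ⟨K, U, hU, hK⟩ := h
  obtain ⟨δ, hδ, hδU⟩ := Metric.mem_nhds_iff.1 hU
  refine ⟨K, δ, hδ, fun w hw w' hw' => ?_⟩
  have := hK.dist_le_mul w (hδU (by simpa [dist_eq_norm] using hw)) w'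
    (hδU (by simpa [dist_eq_norm] using hw'))
  rwa [dist_eq_norm, dist_eq_norm] at this

theorem IsCriticalPoint.partialCritical_fst [NormedSpace ℝ Y] {f : X × Y → ℝ} {v : X × Y}
    (h : IsCriticalPoint f v) : PartialCritical (fun w₁ w₂ => f (w₁, w₂)) v.1 v.2 := by
  obtain ⟨K, δ, hδ, hK⟩ := h.1.exists_abs_sub_le
  refine ⟨⟨K, δ, hδ, fun w hw w' hw' w₂ hw₂ => ?_⟩, fun y => ?_⟩
  · have := hK (w, w₂) (by simp [Prod.norm_def, hw, hw₂]) (w', w₂)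
      (by simp [Prod.norm_def, hw', hw₂])
    simpa [Prod.norm_def] using this
  · obtain ⟨z, τ, ε, h1, h2, h3, h4, h5⟩ := h.exists_seq (y, 0)
    refine ⟨fun n => (z n).1, fun n => (z n).2, τ, ε, (continuous_fst.tendsto v).comp h1,
      (continuous_snd.tendsto v).comp h1, h2, h3, h4, fun n => ?_⟩
    have := h5 n
    rwa [show z n + τ n • (y, (0 : Y)) = ((z n).1 + τ n • y, (z n).2) by ext <;> simp] at this

theorem IsCriticalPoint.partialCritical_snd [NormedSpace ℝ Y] {f : X × Y → ℝ} {v : X × Y}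
    (h : IsCriticalPoint f v) : PartialCritical (fun w₂ w₁ => f (w₁, w₂)) v.2 v.1 := by
  obtain ⟨K, δ, hδ, hK⟩ := h.1.exists_abs_sub_le
  refine ⟨⟨K, δ, hδ, fun w hw w' hw' w₂ hw₂ => ?_⟩, fun y => ?_⟩
  · have := hK (w₂, w) (by simp [Prod.norm_def, hw, hw₂]) (w₂, w')
      (by simp [Prod.norm_def, hw', hw₂])
    simpa [Prod.norm_def] using this
  · obtain ⟨z, τ, ε, h1, h2, h3, h4, h5⟩ := h.exists_seq (0, y)
    refine ⟨fun n => (z n).2, fun n => (z n).1, τ, ε, (continuous_snd.tendsto v).comp h1,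
      (continuous_fst.tendsto v).comp h1, h2, h3, h4, fun n => ?_⟩
    have := h5 n
    rwa [show z n + τ n • ((0 : X), y) = ((z n).1, (z n).2 + τ n • y) by ext <;> simp] at this

theorem norm_neg_sub_eq {Z : Type*} [NormedAddCommGroup Z] (w v : Z) : ‖-w - v‖ = ‖w - -v‖ := by
  rw [← norm_neg]
  congr 1
  abel

theorem PartialCritical.reflect {E : X → Y → ℝ} {v₁ : X} {v₂ : Y} (h : PartialCritical E v₁ v₂) :
    PartialCritical (fun w₁ w₂ => E (-w₁) (-w₂)) (-v₁) (-v₂) := by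
  obtain ⟨⟨K, δ, hδ, hK⟩, h⟩ := h
  refine ⟨⟨K, δ, hδ, fun w hw w' hw' w₂ hw₂ => ?_⟩, fun y => ?_⟩
  · have := hK (-w) (by rwa [norm_neg_sub_eq]) (-w') (by rwa [norm_neg_sub_eq]) (-w₂)
      (by rwa [norm_neg_sub_eq])
    rwa [norm_neg_sub_eq, neg_neg] at this
  · obtain ⟨z₁, z₂, τ, ε, h1, h2, h3, h4, h5, h6⟩ := h (-y)
    refine ⟨fun n => -z₁ n, fun n => -z₂ n, τ, ε, h1.neg, h2.neg, h3, h4, h5, fun n => ?_⟩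
    have := h6 n
    show -ε n * τ n ≤ E (-(-z₁ n + τ n • y)) (-(-z₂ n)) - E (-(-z₁ n)) (-(-z₂ n))
    rwa [show -(-z₁ n + τ n • y) = z₁ n + τ n • -y by rw [smul_neg]; abel, neg_neg, neg_neg]

end


/-! ### Critical points of truncated energies -/

section

variable {N : ℕ} {Ω : Set (Euc N)} {p p₁ p₂ : ℝ} [hp : Fact (1 < p)] [hp₁ : Fact (1 < p₁)]
  [hp₂ : Fact (1 < p₂)]

theorem IsC2Domain.integrable_trace (hN : 1 ≤ N) (hΩ : IsC2Domain Ω) (u : W1 Ω p) :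
    Integrable (trace u) (surf Ω) :=
  have := hΩ.isFiniteMeasure_surf hN
  (Lp.memLp (trace u)).integrable (fact_one_le_ofReal p).out

theorem IsC2Domain.tendsto_integral_abs_trace (hN : 1 ≤ N) (hΩ : IsC2Domain Ω) {u : ℕ → W1 Ω p}
    (hu : Tendsto (fun n => ‖u n‖) atTop (𝓝 0)) :
    Tendsto (fun n => ∫ x, |trace (u n) x| ∂surf Ω) atTop (𝓝 0) := by
  have := hΩ.isFiniteMeasure_surf hN
  have h1 : Tendsto (fun n => ‖trace (u n)‖) atTop (𝓝 0) := by
    have := ((hΩ.continuous_trace hN).tendsto (0 : W1 Ω p)).comp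
      (tendsto_zero_iff_norm_tendsto_zero.2 hu)
    rw [hΩ.trace_zero hN] at this
    exact tendsto_zero_iff_norm_tendsto_zero.1 this
  have h2 := h1.mul_const (surf Ω univ ^ (1 - 1 / p)).toReal
  rw [zero_mul] at h2
  exact squeeze_zero (fun n => integral_nonneg fun x => abs_nonneg _)
    (fun n => integral_norm_le_mul_norm (p := p) (trace (u n))) h2

theorem IsC2Domain.trace_sub_smul_ae (hN : 1 ≤ N) (hΩ : IsC2Domain Ω) (z y : W1 Ω p) (t : ℝ) :
    trace (z - t • y) =ᵐ[surf Ω] fun x => trace z x - t * trace y x := by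
  rw [hΩ.trace_sub hN, hΩ.trace_smul hN]
  filter_upwards [Lp.coeFn_sub (trace z) (t • trace y), Lp.coeFn_smul t (trace y)] with x h1 h2
  rw [h1, Pi.sub_apply, h2]
  rfl

theorem IsC2Domain.trace_add_smul_ae (hN : 1 ≤ N) (hΩ : IsC2Domain Ω) (z y : W1 Ω p) (t : ℝ) :
    trace (z + t • y) =ᵐ[surf Ω] fun x => trace z x + t * trace y x := by
  have h := hΩ.trace_sub_smul_ae hN z y (-t)
  rw [neg_smul, sub_neg_eq_add] at h
  filter_upwards [h] with x hx
  rw [hx]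
  ring

/-- The energy whose boundary potential is the truncation of `f` to the boxes
`[a₁ x, b₁ x] × [a₂ x, b₂ x]`. -/
noncomputable def truncEnergy (f f₁ f₂ : Euc N → ℝ → ℝ → ℝ) (a₁ b₁ a₂ b₂ : Euc N → ℝ)
    (w₁ : W1 Ω p₁) (w₂ : W1 Ω p₂) : ℝ :=
  1 / p₁ * ‖w₁‖ ^ p₁ + 1 / p₂ * ‖w₂‖ ^ p₂ -
    ∫ x, truncPot (f x) (f₁ x) (f₂ x) (a₁ x) (b₁ x) (a₂ x) (b₂ x) (trace w₁ x) (trace w₂ x) ∂surf Ω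

variable {f f₁ f₂ : Euc N → ℝ → ℝ → ℝ} {a₁ b₁ a₂ b₂ : Euc N → ℝ} {C : ℝ}

theorem truncEnergy_swap (w₁ : W1 Ω p₁) (w₂ : W1 Ω p₂) :
    truncEnergy (fun x s t => f x t s) (fun x s t => f₂ x t s) (fun x s t => f₁ x t s)
      a₂ b₂ a₁ b₁ w₂ w₁ = truncEnergy f f₁ f₂ a₁ b₁ a₂ b₂ w₁ w₂ := by
  unfold truncEnergy truncPot
  congr 1
  · ring
  · congr 1
    funext x
    ring

theorem IsC2Domain.truncEnergy_reflect (hN : 1 ≤ N) (hΩ : IsC2Domain Ω)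
    (h : IsBoxPotential (surf Ω) f f₁ f₂ a₁ b₁ a₂ b₂ C) (w₁ : W1 Ω p₁) (w₂ : W1 Ω p₂) :
    truncEnergy (fun x s t => f x (-s) (-t)) (fun x s t => -f₁ x (-s) (-t))
      (fun x s t => -f₂ x (-s) (-t)) (-b₁) (-a₁) (-b₂) (-a₂) w₁ w₂ =
      truncEnergy f f₁ f₂ a₁ b₁ a₂ b₂ (-w₁) (-w₂) := by
  unfold truncEnergy
  rw [norm_neg, norm_neg, hΩ.trace_neg hN, hΩ.trace_neg hN]
  congr 1
  refine integral_congr_ae ?_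
  filter_upwards [h.a₁_nonpos, h.b₁_nonneg, h.a₂_nonpos, h.b₂_nonneg, Lp.coeFn_neg (trace w₁),
    Lp.coeFn_neg (trace w₂)] with x h1 h2 h3 h4 h5 h6
  simp only [truncPot, Pi.neg_apply, h5, h6, clamp_neg (h1.trans h2), clamp_neg (h3.trans h4),
    neg_neg]
  ring

/-- The energy in terms of representatives `S`, `T` of the traces, with the boundary integral split
into its two parts. -/
theorem IsBoxPotential.truncEnergy_eq (h : IsBoxPotential (surf Ω) f f₁ f₂ a₁ b₁ a₂ b₂ C)
    {w₁ : W1 Ω p₁} {w₂ : W1 Ω p₂} {S T : Euc N → ℝ} (hS : trace w₁ =ᵐ[surf Ω] S)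
    (hT : trace w₂ =ᵐ[surf Ω] T) (hSi : Integrable S (surf Ω)) (hTi : Integrable T (surf Ω)) :
    truncEnergy f f₁ f₂ a₁ b₁ a₂ b₂ w₁ w₂ = 1 / p₁ * ‖w₁‖ ^ p₁ + 1 / p₂ * ‖w₂‖ ^ p₂ -
      ((∫ x, truncMain (f x) (f₁ x) (a₁ x) (b₁ x) (a₂ x) (b₂ x) (S x) (T x) ∂surf Ω) +
        ∫ x, truncRest (f₂ x) (a₁ x) (b₁ x) (a₂ x) (b₂ x) (S x) (T x) ∂surf Ω) := by
  rw [← h.integral_truncPot hSi hTi, truncEnergy]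
  congr 1
  refine integral_congr_ae ?_
  filter_upwards [hS, hT] with x h1 h2
  rw [h1, h2]

/-- The Lipschitz estimate controls the part of the increment of the energy for which no modulus of
continuity is available: near `(v₁, v₂)`, the increment of `f₂(·, b₂)` along `Z ≥ 0`, weighted with
`(w₂ - b₂)⁺`, is at most a multiple of the size of `Z`. Comparing the increments of the energy in
the first variable at `w₂` and at `w₂ + ρ w₂⁺`, the convex terms cancel. -/
theorem IsC2Domain.excess_le (hN : 1 ≤ N) (hΩ : IsC2Domain Ω)
    (h : IsBoxPotential (surf Ω) f f₁ f₂ a₁ b₁ a₂ b₂ C) {v₁ : W1 Ω p₁} {v₂ : W1 Ω p₂} {K δ : ℝ}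
    (hK : ∀ w, ‖w - v₁‖ < δ → ∀ w', ‖w' - v₁‖ < δ → ∀ w₂, ‖w₂ - v₂‖ < δ →
      |truncEnergy f f₁ f₂ a₁ b₁ a₂ b₂ w w₂ - truncEnergy f f₁ f₂ a₁ b₁ a₂ b₂ w' w₂| ≤
        K * ‖w - w'‖) {w₁ Z : W1 Ω p₁} {w₂ : W1 Ω p₂} {τ ρ : ℝ} (hτ : 0 ≤ τ) (hρ : 0 ≤ ρ)
    (hZ : ∀ᵐ x ∂surf Ω, 0 ≤ trace Z x) (h1 : ‖w₁ - v₁‖ < δ) (h1' : ‖w₁ - τ • Z - v₁‖ < δ)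
    (h2 : ‖w₂ - v₂‖ + ρ * ‖w₂‖ < δ) :
    ρ * ∫ x, max (trace w₂ x - b₂ x) 0 * (f₂ x (clamp (a₁ x) (b₁ x) (trace w₁ x)) (b₂ x) -
        f₂ x (clamp (a₁ x) (b₁ x) (trace w₁ x - τ * trace Z x)) (b₂ x)) ∂surf Ω ≤
      τ * (2 * K * ‖Z‖ + 2 * C * ∫ x, |trace Z x| ∂surf Ω) := by
  obtain ⟨P, hP, hP', hPt⟩ := hΩ.exists_posPart hN w₂
  have hPn := W1.norm_posPart_le hP hP'
  have iS := hΩ.integrable_trace hN w₁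
  have iT := hΩ.integrable_trace hN w₂
  have iZ := hΩ.integrable_trace hN Z
  have iS' : Integrable (fun x => trace w₁ x - τ * trace Z x) (surf Ω) := iS.sub (iZ.const_mul τ)
  have iT' : Integrable (fun x => trace w₂ x + ρ * max (trace w₂ x) 0) (surf Ω) :=
    iT.add (iT.pos_part.const_mul ρ)
  have tS := hΩ.trace_sub_smul_ae hN w₁ Z τ
  have tT : trace (w₂ + ρ • P) =ᵐ[surf Ω] fun x => trace w₂ x + ρ * max (trace w₂ x) 0 := by
    filter_upwards [hΩ.trace_add_smul_ae hN w₂ P ρ, hPt] with x e1 e2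
    rw [e1, e2]
  have hle : ∀ᵐ x ∂surf Ω, trace w₁ x - τ * trace Z x ≤ trace w₁ x := by
    filter_upwards [hZ] with x hx
    linarith [mul_nonneg hτ hx]
  have hd : ‖w₂ + ρ • P - v₂‖ < δ := by
    rw [show w₂ + ρ • P - v₂ = w₂ - v₂ + ρ • P by abel]
    refine (norm_add_le _ _).trans_lt ?_
    rw [norm_smul, Real.norm_of_nonneg hρ]
    linarith [mul_le_mul_of_nonneg_left hPn hρ]
  have hd' : ‖w₂ - v₂‖ < δ := by linarith [mul_nonneg hρ (norm_nonneg w₂)]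
  -- the increments of the energy from `w₁ - τ Z` to `w₁`, at `w₂ + ρ w₂⁺` and at `w₂`
  have k1 := (abs_le.1 (hK _ h1 _ h1' _ hd)).1
  have k2 := (abs_le.1 (hK _ h1 _ h1' _ hd')).2
  have hn : ‖w₁ - (w₁ - τ • Z)‖ = τ * ‖Z‖ := by
    rw [sub_sub_cancel, norm_smul, Real.norm_of_nonneg hτ]
  rw [h.truncEnergy_eq .rfl tT iS iT', h.truncEnergy_eq tS tT iS' iT', hn] at k1
  rw [h.truncEnergy_eq .rfl .rfl iS iT, h.truncEnergy_eq tS .rfl iS' iT, hn] at k2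
  have m1 := (abs_le.1 (h.abs_integral_main_sub_le iS iS' iT')).1
  have m2 := (abs_le.1 (h.abs_integral_main_sub_le iS iS' iT)).2
  have hZi : ∫ x, |trace w₁ x - (trace w₁ x - τ * trace Z x)| ∂surf Ω =
      τ * ∫ x, |trace Z x| ∂surf Ω := by
    rw [← integral_const_mul]
    refine integral_congr_ae (Eventually.of_forall fun x => ?_)
    simp only [sub_sub_cancel, abs_mul, abs_of_nonneg hτ]
  rw [hZi] at m1 m2
  have r := h.le_integral_rest_diff iS iS' iT hle hρ
  linarith

theorem tendsto_norm_sub_add_smul {X : Type*} [NormedAddCommGroup X] [NormedSpace ℝ X] {v : X}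
    {z : ℕ → X} {τ : ℕ → ℝ} (hz : Tendsto z atTop (𝓝 v)) (hτ : Tendsto τ atTop (𝓝 0)) (y : X) :
    Tendsto (fun n => ‖v - z n + τ n • y‖) atTop (𝓝 0) := by
  simpa using ((hz.const_sub v).add (hτ.smul_const y)).norm

theorem tendsto_norm_sub_smul_sub {X : Type*} [NormedAddCommGroup X] [NormedSpace ℝ X] {v : X}
    {z Z : ℕ → X} {τ : ℕ → ℝ} (hz : Tendsto z atTop (𝓝 v)) (hτ : Tendsto τ atTop (𝓝 0))
    (hZ : Tendsto (fun n => ‖Z n‖) atTop (𝓝 0)) :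
    Tendsto (fun n => ‖z n - τ n • Z n - v‖) atTop (𝓝 0) := by
  simpa using ((hz.sub (hτ.smul (tendsto_zero_iff_norm_tendsto_zero.2 hZ))).sub_const v).norm

theorem tendsto_rpow_norm_sub_sub {X : Type*} [NormedAddCommGroup X] {p : ℝ} (hp : 1 < p) {v : X}
    {z : ℕ → X} (hz : Tendsto z atTop (𝓝 v)) (y : X) :
    Tendsto (fun n => 1 / p * ‖z n - y‖ ^ p - 1 / p * ‖z n‖ ^ p) atTop
      (𝓝 (1 / p * ‖v - y‖ ^ p - 1 / p * ‖v‖ ^ p)) := by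
  have hp0 : 0 ≤ p := by linarith
  exact (((hz.sub_const y).norm.rpow_const (Or.inr hp0)).const_mul _).sub
    ((hz.norm.rpow_const (Or.inr hp0)).const_mul _)

/-- For a critical point, the near-optimal difference quotients can be taken along points whose
boundary values converge almost everywhere. -/
theorem IsC2Domain.exists_seq_tendsto_ae (hN : 1 ≤ N) (hΩ : IsC2Domain Ω)
    {E : W1 Ω p₁ → W1 Ω p₂ → ℝ} {v₁ : W1 Ω p₁} {v₂ : W1 Ω p₂} (h : PartialCritical E v₁ v₂)
    (y : W1 Ω p₁) :
    ∃ (z₁ : ℕ → W1 Ω p₁) (z₂ : ℕ → W1 Ω p₂) (τ ε : ℕ → ℝ), Tendsto z₁ atTop (𝓝 v₁) ∧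
      Tendsto z₂ atTop (𝓝 v₂) ∧ (∀ n, 0 < τ n) ∧ Tendsto τ atTop (𝓝 0) ∧ Tendsto ε atTop (𝓝 0) ∧
      (∀ n, -ε n * τ n ≤ E (z₁ n - τ n • y) (z₂ n) - E (z₁ n) (z₂ n)) ∧
      (∀ᵐ x ∂surf Ω, Tendsto (fun n => trace (z₁ n) x) atTop (𝓝 (trace v₁ x))) ∧
      ∀ᵐ x ∂surf Ω, Tendsto (fun n => trace (z₂ n) x) atTop (𝓝 (trace v₂ x)) := by
  obtain ⟨z₁, z₂, τ, ε, hz₁, hz₂, hτ, hτ0, hε, hE⟩ := h.2 (-y)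
  obtain ⟨ns, hns, h1⟩ := exists_subseq_tendsto_ae
    (((hΩ.continuous_trace hN).tendsto v₁).comp hz₁)
  obtain ⟨ms, hms, h2⟩ := exists_subseq_tendsto_ae
    (((hΩ.continuous_trace hN).tendsto v₂).comp (hz₂.comp hns.tendsto_atTop))
  have hlim := hns.tendsto_atTop.comp hms.tendsto_atTop
  refine ⟨fun n => z₁ (ns (ms n)), fun n => z₂ (ns (ms n)), fun n => τ (ns (ms n)),
    fun n => ε (ns (ms n)), hz₁.comp hlim, hz₂.comp hlim, fun n => hτ _, hτ0.comp hlim,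
    hε.comp hlim, fun n => ?_, h1.mono fun x hx => hx.comp hms.tendsto_atTop, h2⟩
  rw [sub_eq_add_neg (z₁ (ns (ms n))), ← smul_neg]
  exact hE _

/-- The difference quotient of the energy at `(w₁, w₂)` in the direction `-y` is bounded above by
difference quotients that pass to the limit, up to an error governed by `Z`. -/
theorem IsC2Domain.neg_sub_le_quotient (hN : 1 ≤ N) (hΩ : IsC2Domain Ω)
    (h : IsBoxPotential (surf Ω) f f₁ f₂ a₁ b₁ a₂ b₂ C) {v₁ : W1 Ω p₁} {v₂ : W1 Ω p₂} {K δ : ℝ}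
    (hK : ∀ w, ‖w - v₁‖ < δ → ∀ w', ‖w' - v₁‖ < δ → ∀ w₂, ‖w₂ - v₂‖ < δ →
      |truncEnergy f f₁ f₂ a₁ b₁ a₂ b₂ w w₂ - truncEnergy f f₁ f₂ a₁ b₁ a₂ b₂ w' w₂| ≤
        K * ‖w - w'‖) {w₁ y Z : W1 Ω p₁} {w₂ : W1 Ω p₂} {τ ρ ε : ℝ} (hτ : 0 < τ) (hτ1 : τ ≤ 1)
    (hρ : 0 < ρ) (hY : ∀ᵐ x ∂surf Ω, trace y x = max (trace v₁ x - b₁ x) 0)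
    (hZ : ∀ᵐ x ∂surf Ω, trace Z x = max (trace v₁ x - trace w₁ x + τ * trace y x) 0)
    (h1 : ‖w₁ - v₁‖ < δ) (h1' : ‖w₁ - τ • Z - v₁‖ < δ) (h2 : ‖w₂ - v₂‖ + ρ * ‖w₂‖ < δ)
    (hE : -ε * τ ≤ truncEnergy f f₁ f₂ a₁ b₁ a₂ b₂ (w₁ - τ • y) w₂ -
      truncEnergy f f₁ f₂ a₁ b₁ a₂ b₂ w₁ w₂) :
    -ε - (2 * K * ‖Z‖ + 2 * C * ∫ x, |trace Z x| ∂surf Ω) / ρ ≤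
      (1 / p₁ * ‖w₁ - y‖ ^ p₁ - 1 / p₁ * ‖w₁‖ ^ p₁) +
      ((∫ x, truncMain (f x) (f₁ x) (a₁ x) (b₁ x) (a₂ x) (b₂ x) (trace w₁ x) (trace w₂ x) ∂surf Ω) -
        ∫ x, truncMain (f x) (f₁ x) (a₁ x) (b₁ x) (a₂ x) (b₂ x)
          (trace w₁ x - τ * trace y x) (trace w₂ x) ∂surf Ω) / τ := by
  have iy := hΩ.integrable_trace hN y
  have i1 := hΩ.integrable_trace hN w₁
  have i2 := hΩ.integrable_trace hN w₂
  have hZ0 : ∀ᵐ x ∂surf Ω, 0 ≤ trace Z x := hZ.mono fun x hx => by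
    rw [hx]
    exact le_max_right _ _
  rw [h.truncEnergy_eq (hΩ.trace_sub_smul_ae hN w₁ y τ) .rfl
    (i1.sub (iy.const_mul τ)) i2, h.truncEnergy_eq .rfl .rfl i1 i2] at hE
  have q2 := rpow_norm_sub_smul_sub_le hp₁.out w₁ y hτ.le hτ1
  have q3 := h.integral_rest_diff_le (V := trace v₁) i1 i2 iy (hΩ.integrable_trace hN Z) hτ.le hY hZ
  have q4 := hΩ.excess_le hN h hK hτ.le hρ.le hZ0 h1 h1' h2
  generalize 2 * K * ‖Z‖ + 2 * C * ∫ x, |trace Z x| ∂surf Ω = e at q4 ⊢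
  rw [← mul_div_cancel₀ e hρ.ne', mul_left_comm] at q4
  have q6 := q3.trans (le_of_mul_le_mul_left q4 hρ)
  rw [← sub_le_iff_le_add', le_div_iff₀ hτ]
  linarith

/-- A critical point stays below a nonnegative solution `b` of the first equation, taken at the
upper corner of the boxes: test with `-(v₁ - b)⁺`. -/
theorem IsC2Domain.trace_le_of_partialCritical (hN : 1 ≤ N) (hΩ : IsC2Domain Ω)
    (h : IsBoxPotential (surf Ω) f f₁ f₂ a₁ b₁ a₂ b₂ C) {v₁ : W1 Ω p₁} {v₂ : W1 Ω p₂}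
    (hcrit : PartialCritical (truncEnergy f f₁ f₂ a₁ b₁ a₂ b₂) v₁ v₂) {b : W1 Ω p₁}
    (hb : trace b =ᵐ[surf Ω] b₁) (hb0 : ∀ᵐ x ∂volume.restrict Ω, 0 ≤ b.fn x)
    (hbi : ∀ φ : W1 Ω p₁, IntegrableOn (gradTerm b φ) Ω ∧ IntegrableOn (massTerm b φ) Ω)
    (hsol : ∀ φ : W1 Ω p₁, (∫ x in Ω, gradTerm b φ x) + ∫ x in Ω, massTerm b φ x =
      ∫ x, f₁ x (b₁ x) (b₂ x) * trace φ x ∂surf Ω) :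
    ∀ᵐ x ∂surf Ω, trace v₁ x ≤ b₁ x := by
  obtain ⟨y, hy, hy', hyt⟩ := hΩ.exists_posPart hN (v₁ - b)
  suffices hle : ∀ᵐ x ∂volume.restrict Ω, v₁.fn x ≤ b.fn x by
    filter_upwards [hΩ.trace_mono hN hle, hb] with x e1 e2
    rwa [← e2]
  refine W1.le_of_tangent_nonneg hy hy' hb0 (hbi y).1 (hbi y).2 ?_
  rw [hsol]
  have hY : ∀ᵐ x ∂surf Ω, trace y x = max (trace v₁ x - b₁ x) 0 := by
    rw [hΩ.trace_sub hN] at hyt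
    filter_upwards [hyt, Lp.coeFn_sub (trace v₁) (trace b), hb] with x e1 e2 e3
    rw [e1, e2, Pi.sub_apply, e3]
  obtain ⟨z₁, z₂, τ, ε, hz₁, hz₂, hτ, hτ0, hε, hE, hae₁, hae₂⟩ := hΩ.exists_seq_tendsto_ae hN hcrit y
  obtain ⟨⟨K, δ, hδ, hK⟩, -⟩ := hcrit
  -- the displacements `Z n`, which tend to zero
  choose Z hZ hZ' hZt using fun n => hΩ.exists_posPart hN (v₁ - z₁ n + τ n • y)
  have hZn : Tendsto (fun n => ‖Z n‖) atTop (𝓝 0) := by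
    exact squeeze_zero (fun _ => norm_nonneg _) (fun n => W1.norm_posPart_le (hZ n) (hZ' n))
      (tendsto_norm_sub_add_smul hz₁ hτ0 y)
  have hZeq : ∀ n, ∀ᵐ x ∂surf Ω, trace (Z n) x =
      max (trace v₁ x - trace (z₁ n) x + τ n * trace y x) 0 := fun n => by
    have e0 := hZt n
    rw [hΩ.trace_add hN, hΩ.trace_sub hN, hΩ.trace_smul hN] at e0
    filter_upwards [e0, Lp.coeFn_add (trace v₁ - trace (z₁ n)) (τ n • trace y),
      Lp.coeFn_sub (trace v₁) (trace (z₁ n)), Lp.coeFn_smul (τ n) (trace y)] with x e1 e2 e3 e4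
    rw [e1, e2, Pi.add_apply, e3, Pi.sub_apply, e4]
    rfl
  have iy := hΩ.integrable_trace hN y
  have i1 : ∀ n, Integrable (trace (z₁ n)) (surf Ω) := fun n => hΩ.integrable_trace hN _
  have i2 : ∀ n, Integrable (trace (z₂ n)) (surf Ω) := fun n => hΩ.integrable_trace hN _
  obtain ⟨l, hl, hl'⟩ := h.exists_tendsto_main_quotient i1 i2
    (hΩ.integrable_trace hN v₂).aemeasurable iy hY hτ hτ0 hae₁ hae₂
  -- `ρ` keeps `z₂ + ρ z₂⁺` in the ball on which the energy is Lipschitz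
  obtain ⟨ρ, hρ, hρδ⟩ : ∃ ρ, 0 < ρ ∧ ρ * ‖v₂‖ < δ :=
    ⟨δ / (‖v₂‖ + 1), by positivity, by
      rw [div_mul_eq_mul_div, div_lt_iff₀ (by positivity)]
      linarith⟩
  have ev1 : ∀ᶠ n in atTop, ‖z₁ n - v₁‖ < δ :=
    (tendsto_iff_norm_sub_tendsto_zero.1 hz₁).eventually_lt_const hδ
  have ev2 : ∀ᶠ n in atTop, ‖z₁ n - τ n • Z n - v₁‖ < δ :=
    (tendsto_norm_sub_smul_sub hz₁ hτ0 hZn).eventually_lt_const hδ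
  have ev3 : ∀ᶠ n in atTop, ‖z₂ n - v₂‖ + ρ * ‖z₂ n‖ < δ := by
    have h1 : Tendsto (fun n => ‖z₂ n - v₂‖ + ρ * ‖z₂ n‖) atTop (𝓝 (0 + ρ * ‖v₂‖)) :=
      (tendsto_iff_norm_sub_tendsto_zero.1 hz₂).add (hz₂.norm.const_mul ρ)
    exact h1.eventually_lt_const (by rwa [zero_add])
  have ev4 : ∀ᶠ n in atTop, τ n ≤ 1 := hτ0.eventually_le_const one_pos
  have he0 : Tendsto (fun n => (2 * K * ‖Z n‖ + 2 * C * ∫ x, |trace (Z n) x| ∂surf Ω) / ρ) atTop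
      (𝓝 0) := by
    have h1 := ((hZn.const_mul (2 * K)).add
      ((hΩ.tendsto_integral_abs_trace hN hZn).const_mul (2 * C))).div_const ρ
    rwa [mul_zero, mul_zero, add_zero, zero_div] at h1
  have key := (ev1.and (ev2.and (ev3.and ev4))).mono fun n hn =>
    hΩ.neg_sub_le_quotient hN h hK (hτ n) hn.2.2.2 hρ hY (hZeq n) hn.1 hn.2.1 hn.2.2.1 (hE n)
  have lim1 := hε.neg.sub he0
  rw [neg_zero, sub_zero] at lim1
  have lim2 := tendsto_rpow_norm_sub_sub hp₁.out hz₁ y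
  have := le_of_tendsto_of_tendsto lim1 (lim2.add hl) key
  linarith

end


/-! ### Localization of critical points between weak solutions -/

section

variable {N : ℕ} {Ω : Set (Euc N)} {p p₁ p₂ : ℝ} [hp : Fact (1 < p)] [hp₁ : Fact (1 < p₁)]
  [hp₂ : Fact (1 < p₂)] {f f₁ f₂ : Euc N → ℝ → ℝ → ℝ} {a₁ b₁ a₂ b₂ : Euc N → ℝ} {C : ℝ}

theorem gradTerm_neg_ae (u φ : W1 Ω p) :
    gradTerm (-u) φ =ᵐ[volume.restrict Ω] fun x => -gradTerm u φ x := by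
  filter_upwards [W1.grad_neg u] with x hx
  rw [gradTerm, gradTerm, hx, Pi.neg_apply, norm_neg, inner_neg_left, mul_neg]

theorem massTerm_neg_ae (u φ : W1 Ω p) :
    massTerm (-u) φ =ᵐ[volume.restrict Ω] fun x => -massTerm u φ x := by
  filter_upwards [W1.fn_neg u] with x hx
  rw [massTerm, massTerm, hx, Pi.neg_apply, abs_neg, mul_neg, neg_mul]

/-- The reflected form of `IsC2Domain.trace_le_of_partialCritical`. -/
theorem IsC2Domain.le_trace_of_partialCritical (hN : 1 ≤ N) (hΩ : IsC2Domain Ω)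
    (h : IsBoxPotential (surf Ω) f f₁ f₂ a₁ b₁ a₂ b₂ C) {v₁ : W1 Ω p₁} {v₂ : W1 Ω p₂}
    (hcrit : PartialCritical (truncEnergy f f₁ f₂ a₁ b₁ a₂ b₂) v₁ v₂) {a : W1 Ω p₁}
    (ha : trace a =ᵐ[surf Ω] a₁) (ha0 : ∀ᵐ x ∂volume.restrict Ω, a.fn x ≤ 0)
    (hai : ∀ φ : W1 Ω p₁, IntegrableOn (gradTerm a φ) Ω ∧ IntegrableOn (massTerm a φ) Ω)
    (hsol : ∀ φ : W1 Ω p₁, (∫ x in Ω, gradTerm a φ x) + ∫ x in Ω, massTerm a φ x =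
      ∫ x, f₁ x (a₁ x) (a₂ x) * trace φ x ∂surf Ω) :
    ∀ᵐ x ∂surf Ω, a₁ x ≤ trace v₁ x := by
  have hcrit' := hcrit.reflect
  have hfun : (fun (w₁ : W1 Ω p₁) (w₂ : W1 Ω p₂) =>
      truncEnergy f f₁ f₂ a₁ b₁ a₂ b₂ (-w₁) (-w₂)) =
      truncEnergy (fun x s t => f x (-s) (-t)) (fun x s t => -f₁ x (-s) (-t))
        (fun x s t => -f₂ x (-s) (-t)) (-b₁) (-a₁) (-b₂) (-a₂) :=
    funext fun w₁ => funext fun w₂ => (hΩ.truncEnergy_reflect hN h w₁ w₂).symm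
  rw [hfun] at hcrit'
  have hle := hΩ.trace_le_of_partialCritical hN h.reflect hcrit' (b := -a) ?_ ?_ (fun φ => ?_)
    (fun φ => ?_)
  · rw [hΩ.trace_neg hN] at hle
    filter_upwards [hle, Lp.coeFn_neg (trace v₁)] with x e1 e2
    rw [e2] at e1
    exact neg_le_neg_iff.1 e1
  · rw [hΩ.trace_neg hN]
    exact (Lp.coeFn_neg _).trans ha.neg
  · filter_upwards [ha0, W1.fn_neg a] with x e1 e2
    rw [e2]
    exact neg_nonneg.2 e1
  · exact ⟨(hai φ).1.neg.congr (gradTerm_neg_ae a φ).symm,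
      (hai φ).2.neg.congr (massTerm_neg_ae a φ).symm⟩
  · rw [integral_congr_ae (gradTerm_neg_ae a φ), integral_congr_ae (massTerm_neg_ae a φ),
      integral_neg, integral_neg, ← neg_add, hsol, ← integral_neg]
    simp only [Pi.neg_apply, neg_neg, neg_mul]

/-- A critical point of the truncated energy lies, on the boundary, between the weak solutions
`a ≤ 0` and `b ≥ 0` that span the boxes. -/
theorem IsC2Domain.trace_mem_Icc_of_isCriticalPoint (hN : 1 ≤ N) (hΩ : IsC2Domain Ω)
    {a b v : W1 Ω p₁ × W1 Ω p₂} (h : IsBoxPotential (surf Ω) f f₁ f₂ (trace a.1) (trace b.1)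
      (trace a.2) (trace b.2) C) (ha : IsWeakSolution f₁ f₂ a) (hb : IsWeakSolution f₁ f₂ b)
    (ha0 : ∀ᵐ x ∂volume.restrict Ω, a.1.fn x ≤ 0 ∧ a.2.fn x ≤ 0)
    (hb0 : ∀ᵐ x ∂volume.restrict Ω, 0 ≤ b.1.fn x ∧ 0 ≤ b.2.fn x)
    (hv : IsCriticalPoint (fun w : W1 Ω p₁ × W1 Ω p₂ => truncEnergy f f₁ f₂ (trace a.1) (trace b.1)
      (trace a.2) (trace b.2) w.1 w.2) v) :
    ∀ᵐ x ∂surf Ω, (trace a.1 x ≤ trace v.1 x ∧ trace v.1 x ≤ trace b.1 x) ∧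
      (trace a.2 x ≤ trace v.2 x ∧ trace v.2 x ≤ trace b.2 x) := by
  have c1 : PartialCritical (truncEnergy f f₁ f₂ (trace a.1) (trace b.1) (trace a.2) (trace b.2))
      v.1 v.2 := hv.partialCritical_fst
  have c2 : PartialCritical (truncEnergy (fun x s t => f x t s) (fun x s t => f₂ x t s)
      (fun x s t => f₁ x t s) (trace a.2) (trace b.2) (trace a.1) (trace b.1)) v.2 v.1 := by
    have h1 := hv.partialCritical_snd
    have hfun : (fun (w₂ : W1 Ω p₂) (w₁ : W1 Ω p₁) => truncEnergy f f₁ f₂ (trace a.1) (trace b.1)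
        (trace a.2) (trace b.2) w₁ w₂) = truncEnergy (fun x s t => f x t s) (fun x s t => f₂ x t s)
        (fun x s t => f₁ x t s) (trace a.2) (trace b.2) (trace a.1) (trace b.1) :=
      funext fun w₂ => funext fun w₁ => (truncEnergy_swap w₁ w₂).symm
    rwa [hfun] at h1
  filter_upwards [
    hΩ.le_trace_of_partialCritical hN h c1 .rfl (ha0.mono fun _ hx => hx.1)
      (fun φ => ⟨(ha.integrable₁ φ).1, (ha.integrable₁ φ).2.1⟩) ha.eq₁,
    hΩ.trace_le_of_partialCritical hN h c1 .rfl (hb0.mono fun _ hx => hx.1)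
      (fun φ => ⟨(hb.integrable₁ φ).1, (hb.integrable₁ φ).2.1⟩) hb.eq₁,
    hΩ.le_trace_of_partialCritical hN h.swap c2 .rfl (ha0.mono fun _ hx => hx.2)
      (fun φ => ⟨(ha.integrable₂ φ).1, (ha.integrable₂ φ).2.1⟩) ha.eq₂,
    hΩ.trace_le_of_partialCritical hN h.swap c2 .rfl (hb0.mono fun _ hx => hx.2)
      (fun φ => ⟨(hb.integrable₂ φ).1, (hb.integrable₂ φ).2.1⟩) hb.eq₂] with x e1 e2 e3 e4
  exact ⟨⟨e1, e2⟩, e3, e4⟩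

theorem gradTerm_zero_ae (φ : W1 Ω p) : gradTerm 0 φ =ᵐ[volume.restrict Ω] fun _ => 0 := by
  filter_upwards [W1.grad_zero (Ω := Ω) (p := p)] with x hx
  rw [gradTerm, hx, Pi.zero_apply, inner_zero_left, mul_zero]

theorem massTerm_zero_ae (φ : W1 Ω p) : massTerm 0 φ =ᵐ[volume.restrict Ω] fun _ => 0 := by
  filter_upwards [W1.fn_zero (Ω := Ω) (p := p)] with x hx
  rw [massTerm, hx, Pi.zero_apply, mul_zero, zero_mul]

theorem isWeakSolution_zero (hN : 1 ≤ N) (hΩ : IsC2Domain Ω) {g₁ g₂ : Euc N → ℝ → ℝ → ℝ}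
    (h₁ : ∀ᵐ x ∂surf Ω, g₁ x 0 0 = 0) (h₂ : ∀ᵐ x ∂surf Ω, g₂ x 0 0 = 0) :
    IsWeakSolution g₁ g₂ (0 : W1 Ω p₁ × W1 Ω p₂) := by
  have hT : ∀ {p : ℝ} [Fact (1 < p)], ∀ᵐ x ∂surf Ω, trace (0 : W1 Ω p) x = 0 := fun {p} _ => by
    rw [hΩ.trace_zero hN]
    exact Lp.coeFn_zero _ _ _
  have hB : ∀ {p : ℝ} [Fact (1 < p)] {g : Euc N → ℝ → ℝ → ℝ}, (∀ᵐ x ∂surf Ω, g x 0 0 = 0) →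
      ∀ φ : W1 Ω p, (fun x => g x (trace (0 : W1 Ω p₁) x) (trace (0 : W1 Ω p₂) x) * trace φ x)
        =ᵐ[surf Ω] fun _ => 0 := fun h φ => by
    filter_upwards [h, hT (p := p₁), hT (p := p₂)] with x e1 e2 e3
    rw [e2, e3, e1, zero_mul]
  have hi : ∀ {μ : Measure (Euc N)} {F : Euc N → ℝ}, F =ᵐ[μ] (fun _ => 0) → Integrable F μ :=
    fun h => (integrable_zero _ _ _).congr h.symm
  have h0 : ∀ {μ : Measure (Euc N)} {F : Euc N → ℝ}, F =ᵐ[μ] (fun _ => 0) → ∫ x, F x ∂μ = 0 :=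
    fun h => by rw [integral_congr_ae h, integral_zero]
  refine ⟨fun φ => ⟨hi (gradTerm_zero_ae φ), hi (massTerm_zero_ae φ), hi (hB h₁ φ)⟩,
    fun φ => ⟨hi (gradTerm_zero_ae φ), hi (massTerm_zero_ae φ), hi (hB h₂ φ)⟩,
    fun φ => ?_, fun φ => ?_⟩
  · exact (congrArg₂ (· + ·) (h0 (gradTerm_zero_ae φ)) (h0 (massTerm_zero_ae φ))).trans
      ((add_zero 0).trans (h0 (hB h₁ φ)).symm)
  · exact (congrArg₂ (· + ·) (h0 (gradTerm_zero_ae φ)) (h0 (massTerm_zero_ae φ))).trans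
      ((add_zero 0).trans (h0 (hB h₂ φ)).symm)

theorem IsC2Domain.const_le_trace (hN : 1 ≤ N) (hΩ : IsC2Domain Ω) {u : W1 Ω p} {k : ℝ}
    (h : ∀ᵐ x ∂volume.restrict Ω, k ≤ u.fn x) : ∀ᵐ x ∂surf Ω, k ≤ trace u x := by
  have h1 : ∀ᵐ x ∂volume.restrict Ω, (-u).fn x ≤ -k := by
    filter_upwards [h, W1.fn_neg u] with x e1 e2
    rw [e2]
    exact neg_le_neg e1
  have h2 := hΩ.trace_le_const hN h1
  rw [hΩ.trace_neg hN] at h2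
  filter_upwards [h2, Lp.coeFn_neg (trace u)] with x e1 e2
  rw [e2] at e1
  exact neg_le_neg_iff.1 e1

/-! ### The truncations of the boundary potential -/

theorem BoundedOnBounded.exists_bound {φ : Euc N → ℝ → ℝ → ℝ} (h : BoundedOnBounded Ω φ)
    (d₁ k₁ d₂ k₂ : ℝ) :
    ∃ C, ∀ᵐ x ∂surf Ω, ∀ s ∈ Icc d₁ k₁, ∀ t ∈ Icc d₂ k₂, |φ x s t| ≤ C := by
  obtain ⟨H, hH, hle⟩ := h (Icc d₁ k₁ ×ˢ Icc d₂ k₂)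
    ((Metric.isBounded_Icc _ _).prod (Metric.isBounded_Icc _ _))
  refine ⟨(eLpNorm H ⊤ (surf Ω)).toReal, ?_⟩
  have h1 : ∀ᵐ x ∂surf Ω, ‖H x‖ₑ ≤ eLpNorm H ⊤ (surf Ω) := by
    rw [eLpNorm_exponent_top]
    exact ae_le_eLpNormEssSup
  filter_upwards [h1, hle] with x e1 e2 s hs t ht
  refine (e2 (s, t) ⟨hs, ht⟩).trans ((le_abs_self _).trans ?_)
  have := ENNReal.toReal_mono hH.eLpNorm_ne_top e1
  rwa [toReal_enorm] at this

/-- The potential `g` satisfies the assumptions of `IsBoxPotential` on the boxes spanned by functions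
`a ≤ 0 ≤ b` with values between `d` and `k`, where (H4) applies. -/
theorem exists_isBoxPotential {g : Euc N → ℝ → ℝ → ℝ} (hg : IsPotential Ω g) {k₁ k₂ d₁ d₂ : ℝ}
    (hH4 : HypH4 Ω (ds₁ g) (ds₂ g) k₁ k₂ d₁ d₂) (ma₁ : AEMeasurable a₁ (surf Ω))
    (mb₁ : AEMeasurable b₁ (surf Ω)) (ma₂ : AEMeasurable a₂ (surf Ω))
    (mb₂ : AEMeasurable b₂ (surf Ω)) (ha₁ : ∀ᵐ x ∂surf Ω, a₁ x ∈ Icc d₁ 0)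
    (hb₁ : ∀ᵐ x ∂surf Ω, b₁ x ∈ Icc 0 k₁) (ha₂ : ∀ᵐ x ∂surf Ω, a₂ x ∈ Icc d₂ 0)
    (hb₂ : ∀ᵐ x ∂surf Ω, b₂ x ∈ Icc 0 k₂) :
    ∃ C, IsBoxPotential (surf Ω) g (ds₁ g) (ds₂ g) a₁ b₁ a₂ b₂ C := by
  obtain ⟨C₁, hC₁⟩ := hg.bounded₁.exists_bound d₁ k₁ d₂ k₂
  obtain ⟨C₂, hC₂⟩ := hg.bounded₂.exists_bound d₁ k₁ d₂ k₂
  have s1 : ∀ᵐ x ∂surf Ω, Icc (a₁ x) (b₁ x) ⊆ Icc d₁ k₁ := by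
    filter_upwards [ha₁, hb₁] with x e1 e2 using Icc_subset_Icc e1.1 e2.2
  have s2 : ∀ᵐ x ∂surf Ω, Icc (a₂ x) (b₂ x) ⊆ Icc d₂ k₂ := by
    filter_upwards [ha₂, hb₂] with x e1 e2 using Icc_subset_Icc e1.1 e2.2
  refine ⟨max C₁ C₂,
    { meas := fun s t hs ht => hg.caratheodory.aemeasurable_comp hs ht
      meas₁ := fun s t hs ht => hg.caratheodory₁.aemeasurable_comp hs ht
      meas₂ := fun s t hs ht => hg.caratheodory₂.aemeasurable_comp hs ht
      meas_a₁ := ma₁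
      meas_b₁ := mb₁
      meas_a₂ := ma₂
      meas_b₂ := mb₂
      a₁_nonpos := ha₁.mono fun _ hx => hx.2
      b₁_nonneg := hb₁.mono fun _ hx => hx.1
      a₂_nonpos := ha₂.mono fun _ hx => hx.2
      b₂_nonneg := hb₂.mono fun _ hx => hx.1
      zero := hg.zero
      deriv₁ := hg.differentiable.mono fun x hx s t => ?_
      deriv₂ := hg.differentiable.mono fun x hx s t => ?_
      cont₁ := hg.caratheodory₁.2.mono fun x hx s => hx.comp (Continuous.prodMk_right s)
      cont₂ := hg.caratheodory₂.2.mono fun x hx t => hx.comp (Continuous.prodMk_left t)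
      bound₁ := ?_
      bound₂ := ?_
      mono₁ := ?_
      mono₂ := ?_ }⟩
  · have h1 : Differentiable ℝ fun s => g x s t :=
      hx.comp (differentiable_id.prodMk (differentiable_const t))
    exact (h1 s).hasDerivAt
  · have h1 : Differentiable ℝ fun t => g x s t :=
      hx.comp ((differentiable_const s).prodMk differentiable_id)
    exact (h1 t).hasDerivAt
  · filter_upwards [hC₁, s1, s2] with x e1 e2 e3 s hs t ht
    exact (e1 s (e2 hs) t (e3 ht)).trans (le_max_left _ _)
  · filter_upwards [hC₂, s1, s2] with x e1 e2 e3 s hs t ht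
    exact (e1 s (e2 hs) t (e3 ht)).trans (le_max_right _ _)
  · filter_upwards [hH4.mono₁, s1, s2] with x e1 e2 e3 s hs
    exact (e1 s (e2 hs)).mono e3
  · filter_upwards [hH4.mono₂, s1, s2] with x e1 e2 e3 t ht
    exact (e1 t (e3 ht)).mono e2

theorem posPart_sub_negPart_eq_sub_clamp {a b : ℝ} (hab : a ≤ b) (s : ℝ) :
    (s - b)⁺ - (s - a)⁻ = s - clamp a b s := by
  rw [posPart_def, negPart_def, clamp]
  rcases le_total s a with h | h
  · rw [sup_of_le_right (by linarith), sup_of_le_left (by linarith), min_eq_left (h.trans hab),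
      max_eq_left h]
    ring
  · rw [sup_of_le_right (by linarith : -(s - a) ≤ 0)]
    rcases le_total s b with h' | h'
    · rw [sup_of_le_right (by linarith), min_eq_left h', max_eq_right h]
      ring
    · rw [sup_of_le_left (by linarith), min_eq_right h', max_eq_right hab]
      ring

theorem gZero_eq_truncPot {g : Euc N → ℝ → ℝ → ℝ} {x : Euc N} (h₁ : a₁ x ≤ b₁ x)
    (h₂ : a₂ x ≤ b₂ x) (s t : ℝ) : gZero g b₁ b₂ a₁ a₂ x s t =
      truncPot (g x) (ds₁ g x) (ds₂ g x) (a₁ x) (b₁ x) (a₂ x) (b₂ x) s t := by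
  rw [truncPot, ← posPart_sub_negPart_eq_sub_clamp h₁, ← posPart_sub_negPart_eq_sub_clamp h₂, gZero]
  ring

theorem gPlus_eq_gZero (g : Euc N → ℝ → ℝ → ℝ) (u₁ u₂ : Euc N → ℝ) (x : Euc N) (s t : ℝ) :
    gPlus g u₁ u₂ x s t = gZero g u₁ u₂ 0 0 x s t := by
  simp only [gPlus, gZero, Pi.zero_apply, sub_zero]
  ring

theorem gMinus_eq_gZero (g : Euc N → ℝ → ℝ → ℝ) (v₁ v₂ : Euc N → ℝ) (x : Euc N) (s t : ℝ) :
    gMinus g v₁ v₂ x s t = gZero g 0 0 v₁ v₂ x s t := by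
  simp only [gMinus, gZero, Pi.zero_apply, sub_zero]

theorem gZero_congr (g : Euc N → ℝ → ℝ → ℝ) {u₁ u₂ v₁ v₂ u₁' u₂' v₁' v₂' : Euc N → ℝ} {x : Euc N}
    (h₁ : u₁ x = u₁' x) (h₂ : u₂ x = u₂' x) (h₃ : v₁ x = v₁' x) (h₄ : v₂ x = v₂' x) (s t : ℝ) :
    gZero g u₁ u₂ v₁ v₂ x s t = gZero g u₁' u₂' v₁' v₂' x s t := by
  simp only [gZero, h₁, h₂, h₃, h₄]

theorem energy_congr {G G' : Euc N → ℝ → ℝ → ℝ} (h : ∀ᵐ x ∂surf Ω, ∀ s t, G x s t = G' x s t) :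
    (energy G : W1 Ω p₁ × W1 Ω p₂ → ℝ) = energy G' := by
  funext w
  unfold energy
  congr 1
  exact integral_congr_ae (h.mono fun x hx => hx _ _)

/-- The localization of critical points for the truncation between weak solutions `a ≤ 0 ≤ b`. -/
theorem IsC2Domain.trace_mem_Icc_of_isCriticalPoint_gZero (hN : 1 ≤ N) (hΩ : IsC2Domain Ω)
    {g : Euc N → ℝ → ℝ → ℝ} (hg : IsPotential Ω g) {k₁ k₂ d₁ d₂ : ℝ}
    (hH4 : HypH4 Ω (ds₁ g) (ds₂ g) k₁ k₂ d₁ d₂) {a b v : W1 Ω p₁ × W1 Ω p₂}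
    (ha : IsWeakSolution (ds₁ g) (ds₂ g) a) (hb : IsWeakSolution (ds₁ g) (ds₂ g) b)
    (ha0 : ∀ᵐ x ∂volume.restrict Ω, a.1.fn x ≤ 0 ∧ a.2.fn x ≤ 0)
    (hb0 : ∀ᵐ x ∂volume.restrict Ω, 0 ≤ b.1.fn x ∧ 0 ≤ b.2.fn x)
    (had : ∀ᵐ x ∂volume.restrict Ω, d₁ ≤ a.1.fn x ∧ d₂ ≤ a.2.fn x)
    (hbk : ∀ᵐ x ∂volume.restrict Ω, b.1.fn x ≤ k₁ ∧ b.2.fn x ≤ k₂)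
    (hv : IsCriticalPoint (energy (gZero g (trace b.1) (trace b.2) (trace a.1) (trace a.2))) v) :
    ∀ᵐ x ∂surf Ω, (trace a.1 x ≤ trace v.1 x ∧ trace v.1 x ≤ trace b.1 x) ∧
      (trace a.2 x ≤ trace v.2 x ∧ trace v.2 x ≤ trace b.2 x) := by
  have m : ∀ {p : ℝ} [Fact (1 < p)] (u : W1 Ω p), AEMeasurable (trace u) (surf Ω) := fun u =>
    (hΩ.integrable_trace hN u).aemeasurable
  have t1 := (hΩ.const_le_trace hN (had.mono fun _ hx => hx.1)).and
    (hΩ.trace_le_const hN (ha0.mono fun _ hx => hx.1))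
  have t2 := (hΩ.const_le_trace hN (had.mono fun _ hx => hx.2)).and
    (hΩ.trace_le_const hN (ha0.mono fun _ hx => hx.2))
  have t3 := (hΩ.const_le_trace hN (hb0.mono fun _ hx => hx.1)).and
    (hΩ.trace_le_const hN (hbk.mono fun _ hx => hx.1))
  have t4 := (hΩ.const_le_trace hN (hb0.mono fun _ hx => hx.2)).and
    (hΩ.trace_le_const hN (hbk.mono fun _ hx => hx.2))
  obtain ⟨C, h⟩ := exists_isBoxPotential hg hH4 (m a.1) (m b.1) (m a.2) (m b.2) t1 t3 t2 t4
  refine hΩ.trace_mem_Icc_of_isCriticalPoint hN h ha hb ha0 hb0 ?_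
  rw [energy_congr (G' := fun x => truncPot (g x) (ds₁ g x) (ds₂ g x) (trace a.1 x) (trace b.1 x)
    (trace a.2 x) (trace b.2 x))] at hv
  · exact hv
  · filter_upwards [t1, t2, t3, t4] with x e1 e2 e3 e4 s t
    exact gZero_eq_truncPot (e1.2.trans e3.1) (e2.2.trans e4.1) s t

end

end SteklovSystem

theorem mainTheorem6 {N : ℕ} (hN : 1 ≤ N) (Ω : Set (Euc N)) (hΩ : IsC2Domain Ω)
    (p₁ p₂ : ℝ) [Fact (1 < p₁)] [Fact (1 < p₂)]
    (g : Euc N → ℝ → ℝ → ℝ) (hg : IsPotential Ω g)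
    (k₁ k₂ d₁ d₂ c₁ c₂ α₁ α₂ : ℝ)
    (hH0₁ : HypH0 Ω (ds₁ g)) (hH0₂ : HypH0 Ω (ds₂ g))
    (hH1 : HypH1 Ω (ds₁ g) (ds₂ g) k₁ k₂ d₁ d₂)
    (hH2 : HypH2 Ω p₁ p₂ (ds₁ g) (ds₂ g) k₁ k₂ d₁ d₂ c₁ c₂)
    (hH3 : HypH3 Ω p₁ p₂ (ds₁ g) (ds₂ g) k₁ k₂ d₁ d₂ c₁ c₂ α₁ α₂)
    (hH4 : HypH4 Ω (ds₁ g) (ds₂ g) k₁ k₂ d₁ d₂)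
    (uP uM : W1 Ω p₁ × W1 Ω p₂)
    (huP : IsMinimalPositiveSolution (ds₁ g) (ds₂ g) uP)
    (huP_le : ∀ᵐ x ∂volume.restrict Ω, uP.1.fn x ≤ k₁ ∧ uP.2.fn x ≤ k₂)
    (huM : IsMaximalNegativeSolution (ds₁ g) (ds₂ g) uM)
    (huM_ge : ∀ᵐ x ∂volume.restrict Ω, d₁ ≤ uM.1.fn x ∧ d₂ ≤ uM.2.fn x) :
    (∀ v : W1 Ω p₁ × W1 Ω p₂, IsCriticalPoint (EPlus g uP) v →
      ∀ᵐ x ∂surf Ω, (0 ≤ trace v.1 x ∧ trace v.1 x ≤ trace uP.1 x) ∧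
        (0 ≤ trace v.2 x ∧ trace v.2 x ≤ trace uP.2 x)) ∧
    (∀ v : W1 Ω p₁ × W1 Ω p₂, IsCriticalPoint (EMinus g uM) v →
      ∀ᵐ x ∂surf Ω, (trace uM.1 x ≤ trace v.1 x ∧ trace v.1 x ≤ 0) ∧
        (trace uM.2 x ≤ trace v.2 x ∧ trace v.2 x ≤ 0)) ∧
    (∀ v : W1 Ω p₁ × W1 Ω p₂, IsCriticalPoint (EZero g uP uM) v →
      ∀ᵐ x ∂surf Ω, (trace uM.1 x ≤ trace v.1 x ∧ trace v.1 x ≤ trace uP.1 x) ∧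
        (trace uM.2 x ≤ trace v.2 x ∧ trace v.2 x ≤ trace uP.2 x)) := by
  have hP0 : ∀ᵐ x ∂volume.restrict Ω, 0 ≤ uP.1.fn x ∧ 0 ≤ uP.2.fn x :=
    huP.1.2.mono fun _ hx => ⟨hx.1.le, hx.2.le⟩
  have hM0 : ∀ᵐ x ∂volume.restrict Ω, uM.1.fn x ≤ 0 ∧ uM.2.fn x ≤ 0 :=
    huM.1.2.mono fun _ hx => ⟨hx.1.le, hx.2.le⟩
  -- the truncations at `0` are truncations at the trivial solution
  have h0 : IsWeakSolution (ds₁ g) (ds₂ g) (0 : W1 Ω p₁ × W1 Ω p₂) :=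
    isWeakSolution_zero hN hΩ hH0₁.zero hH0₂.zero
  have hz : ∀ᵐ x ∂volume.restrict Ω, (0 : W1 Ω p₁).fn x = 0 ∧ (0 : W1 Ω p₂).fn x = 0 := by
    filter_upwards [W1.fn_zero (Ω := Ω) (p := p₁), W1.fn_zero (Ω := Ω) (p := p₂)] with x e1 e2
    exact ⟨e1, e2⟩
  have hz' : ∀ᵐ x ∂surf Ω, trace (0 : W1 Ω p₁) x = 0 ∧ trace (0 : W1 Ω p₂) x = 0 := by
    rw [hΩ.trace_zero hN, hΩ.trace_zero hN]
    filter_upwards [Lp.coeFn_zero ℝ (ENNReal.ofReal p₁) (surf Ω),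
      Lp.coeFn_zero ℝ (ENNReal.ofReal p₂) (surf Ω)] with x e1 e2
    exact ⟨e1, e2⟩
  refine ⟨fun v hv => ?_, fun v hv => ?_, fun v hv =>
    hΩ.trace_mem_Icc_of_isCriticalPoint_gZero hN hg hH4 huM.1.1 huP.1.1 hM0 hP0 huM_ge huP_le hv⟩
  · rw [EPlus, energy_congr (G' := gZero g (trace uP.1) (trace uP.2) (trace (0 : W1 Ω p₁))
      (trace (0 : W1 Ω p₂)))] at hv
    · filter_upwards [hz', hΩ.trace_mem_Icc_of_isCriticalPoint_gZero hN hg hH4 h0 huP.1.1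
        (hz.mono fun _ hx => ⟨hx.1.le, hx.2.le⟩) hP0
        (hz.mono fun _ hx => ⟨hH1.d₁_neg.le.trans hx.1.ge, hH1.d₂_neg.le.trans hx.2.ge⟩)
        huP_le hv] with x e1 e2
      exact ⟨⟨e1.1.ge.trans e2.1.1, e2.1.2⟩, e1.2.ge.trans e2.2.1, e2.2.2⟩
    · filter_upwards [hz'] with x hx s t
      exact (gPlus_eq_gZero g _ _ x s t).trans (gZero_congr g rfl rfl hx.1.symm hx.2.symm s t)
  · rw [EMinus, energy_congr (G' := gZero g (trace (0 : W1 Ω p₁)) (trace (0 : W1 Ω p₂))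
      (trace uM.1) (trace uM.2))] at hv
    · filter_upwards [hz', hΩ.trace_mem_Icc_of_isCriticalPoint_gZero hN hg hH4 huM.1.1 h0 hM0
        (hz.mono fun _ hx => ⟨hx.1.ge, hx.2.ge⟩) huM_ge
        (hz.mono fun _ hx => ⟨hx.1.le.trans hH1.k₁_pos.le, hx.2.le.trans hH1.k₂_pos.le⟩)
        hv] with x e1 e2
      exact ⟨⟨e2.1.1, e2.1.2.trans e1.1.le⟩, e2.2.1, e2.2.2.trans e1.2.le⟩
    · filter_upwards [hz'] with x hx s t
      exact (gMinus_eq_gZero g _ _ x s t).trans (gZero_congr g hx.1.symm hx.2.symm rfl rfl s t)
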